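/- Let $\theta:\mathbb{R}^2\times[0,T)\to\mathbb{R}$, $0<T\le\infty$, be a smooth solution of the surface quasi-geostrophic (SQG) equation $\theta_t+\mathbf{u}\cdot\nabla\theta=0$, $\mathbf{u}=\nabla^\perp(-\Delta)^{-1/2}\theta$, where $\nabla^\perp=(-\partial_2,\partial_1)$ and $(-\Delta)^{-1/2}f(x)=\frac{1}{2\pi}\int_{\mathbb{R}^2}\frac{f(y)}{|x-y|}\,dy$, such that $\theta$ and its space derivatives of order at most $2$ are $O((1+|x|)^{-2})$ locally uniformly in $t\in[0,T)$. Put $\Omega(t)=\|\nabla^\perp\theta(\cdot,t)\|_{L^\infty}$, and where $\nabla^\perp\theta\ne0$ put $\xi=\nabla^\perp\theta/|\nabla^\perp\theta|$, $\kappa=|\xi\cdot\nabla\xi|$, $\tau=\nabla\cdot\xi$. For all $M\in\mathbb{R}$ and $b>1$ there is a constant $C_u>0$, depending only on $M$ and $b$, such that the following holds for every such $\theta$ (and $T$) with $\|\theta(\cdot,0)\|_{L^\infty}\le M$ and $\|\theta(\cdot,0)\|_{L^2}\le M$. (i) $\|\mathbf{u}(\cdot,t)\|_{L^\infty}\le C_u\log\Omega(t)$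 for every $t\in[0,T)$ with $\Omega(t)\ge b$. (ii) Let $T_0\ge 0$, and assume $\Omega(t)\ge b$ for all $t\in[T_0,T)$. Let $L^t=\{\mathbf{x}(s,t):0\le s\le L(t)\}$, $t\in[T_0,T)$, be segments of one and the same level set of $\theta$ (that is, $\theta(\mathbf{x}(s,t),t)$ is a constant independent of $s$ and $t$), where $s$ is arclength, $L(t)>0$, $\nabla^\perp\theta\neq0$ on $L^t$, and $L$ and $\mathbf{x}$ are $C^1$. Put $$\Omega_L(t)=\max_{L^t}|\nabla^\perp\theta|,\qquad V(t)=\max_{L^t}|\mathbf{u}\cdot\xi|,\qquad Q(t)=\frac1{L(t)}\int_0^{L(t)}|\nabla^\perp\theta(\mathbf{x}(s,t),t)|\,ds .$$ Assume that there are constants $0<c_0\le1$, $C_0>0$, $C_l>0$, $L_0>0$ such that for all $t\in[T_0,T)$ $$\Omega_L(t)\ge c_0\Omega(t),\qquad |\nabla^\perp\theta(\mathbf{x}(L(t),t),t)|=\Omega_L(t),\qquad L(t)\ge L_0,$$ $$\int_{L^t}|\kappa|\,ds\le C_0,\qquad\int_{L^t}|\tau|\,ds\le C_0,\qquad\Big|\frac{d\mathbf{x}(0,t)}{dt}\cdot\xi(\mathbf{x}(0,t),t)\Big|\le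 C_lV(t).$$ Then for all $t\in[T_0,T)$ $$\Omega(t)\le\exp\left(\log\Big(\frac{C_1}{c_0}Q(T_0)\Big)\exp\Big(\frac{C}{L_0}(t-T_0)\Big)\right),$$ where $C_1=e^{C_0}$, $C_U=C_0(2C_1-1)$, $C_V=2C_0C_1+(C_1-1)(C_l+1)+2C_1$ and $C=C_u\max(C_U,C_V)$; in particular $\|\nabla^\perp\theta\|_{L^\infty}$ grows at most double exponentially in time. -/

import Mathlib

open MeasureTheory Set
open scoped ContDiff

namespace SQG

noncomputable section

/-- The plane with its Euclidean norm. -/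
abbrev Plane : Type := EuclideanSpace ℝ (Fin 2)

/-- The time interval `[a, T)`, where `T` may be infinite. -/
def timeIco (a : ℝ) (T : EReal) : Set ℝ := {t | a ≤ t ∧ (t : EReal) < T}

/-- The `i`-th partial derivative. -/
def partialDeriv (i : Fin 2) (f : Plane → ℝ) (x : Plane) : ℝ :=
  fderiv ℝ f x (EuclideanSpace.single i 1)

/-- The perpendicular gradient `∇^⊥ f = (-∂₂ f, ∂₁ f)`. -/
def gradPerp (f : Plane → ℝ) (x : Plane) : Plane :=
  !₂[-partialDeriv 1 f x, partialDeriv 0 f x]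

/-- `(-Δ)^{-1/2} f`: the Riesz potential of order one in the plane, that is, the convolution of `f`
with `1 / (2 π |x|)`, whose Fourier symbol is `1 / |k|`. -/
def invSqrtNegLaplacian (f : Plane → ℝ) (x : Plane) : ℝ :=
  (2 * Real.pi)⁻¹ * ∫ y, f y / ‖x - y‖

/-- The velocity `u = ∇^⊥ (-Δ)^{-1/2} θ` of the surface quasi-geostrophic model. -/
def velocity (f : Plane → ℝ) : Plane → Plane := gradPerp (invSqrtNegLaplacian f)

/-- `θ` is a smooth solution on `[0, T)` of `θ_t + u · ∇θ = 0`, `u = ∇^⊥ (-Δ)^{-1/2} θ`, in the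
whole plane; `θ` and its first and second space derivatives decay at infinity like `|x|^{-2}`,
locally uniformly in time. -/
structure IsSolution (T : EReal) (θ : ℝ → Plane → ℝ) : Prop where
  smooth : ContDiffOn ℝ ∞ (fun p : ℝ × Plane => θ p.1 p.2) (timeIco 0 T ×ˢ univ)
  decay : ∀ t₁ ∈ timeIco 0 T, ∃ K : ℝ, ∀ t ∈ Icc 0 t₁, ∀ k ≤ 2, ∀ x : Plane,
    ‖iteratedFDeriv ℝ k (θ t) x‖ ≤ K / (1 + ‖x‖) ^ 2
  transport : ∀ t ∈ timeIco 0 T, ∀ x : Plane,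
    derivWithin (fun r => θ r x) (timeIco 0 T) t + fderiv ℝ (θ t) x (velocity (θ t) x) = 0

/-- `Ω = ‖∇^⊥ f‖_{L^∞}`, for `f` with continuous bounded gradient. -/
def maxGradPerp (f : Plane → ℝ) : ℝ := ⨆ x, ‖gradPerp f x‖

/-- The unit tangent field `ξ = ∇^⊥ f / |∇^⊥ f|` of the level sets. -/
def unitTangent (f : Plane → ℝ) (x : Plane) : Plane := ‖gradPerp f x‖⁻¹ • gradPerp f x

/-- The unsigned curvature `κ = |ξ · ∇ξ|`. -/
def curvature (f : Plane → ℝ) (x : Plane) : ℝ :=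
  ‖fderiv ℝ (unitTangent f) x (unitTangent f x)‖

/-- The divergence `τ = ∇ · ξ`. -/
def divTangent (f : Plane → ℝ) (x : Plane) : ℝ :=
  ∑ i : Fin 2, (fderiv ℝ (unitTangent f) x (EuclideanSpace.single i 1)) i

/-- A `C¹` family, indexed by `t ∈ [T₀, T)`, of segments `L^t = {X t s : 0 ≤ s ≤ L t}` of one and
the same level set of `θ`, parametrised by arclength `s`, on which `∇^⊥ θ` does not vanish. -/
structure IsLevelSetSegmentFamily (θ : ℝ → Plane → ℝ) (T₀ : ℝ) (T : EReal)
    (X : ℝ → ℝ → Plane) (L : ℝ → ℝ) : Prop where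
  length_pos : ∀ t ∈ timeIco T₀ T, 0 < L t
  contDiffOn_length : ContDiffOn ℝ 1 L (timeIco T₀ T)
  contDiffOn_curve : ContDiffOn ℝ 1 (fun p : ℝ × ℝ => X p.1 p.2)
    {p : ℝ × ℝ | p.1 ∈ timeIco T₀ T ∧ p.2 ∈ Icc 0 (L p.1)}
  arclength : ∀ t ∈ timeIco T₀ T, ∀ s ∈ Icc 0 (L t), ‖derivWithin (X t) (Icc 0 (L t)) s‖ = 1
  same_level : ∃ c : ℝ, ∀ t ∈ timeIco T₀ T, ∀ s ∈ Icc 0 (L t), θ t (X t s) = c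
  gradPerp_ne_zero : ∀ t ∈ timeIco T₀ T, ∀ s ∈ Icc 0 (L t), gradPerp (θ t) (X t s) ≠ 0

/-- `Ω_L(t)`, the maximum of `|∇^⊥ θ|` on the segment at time `t`. -/
def segmentMax (θ : ℝ → Plane → ℝ) (X : ℝ → ℝ → Plane) (L : ℝ → ℝ) (t : ℝ) : ℝ :=
  sSup ((fun s => ‖gradPerp (θ t) (X t s)‖) '' Icc 0 (L t))

/-- `Q(t)`, the mean of `|∇^⊥ θ|` on the segment at time `t`. -/
def segmentMean (θ : ℝ → Plane → ℝ) (X : ℝ → ℝ → Plane) (L : ℝ → ℝ) (t : ℝ) : ℝ :=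
  (L t)⁻¹ * ∫ s in (0 : ℝ)..(L t), ‖gradPerp (θ t) (X t s)‖

/-- `V(t)`, the maximum of `|u · ξ|` on the segment at time `t`. -/
def maxTangentialSpeed (θ : ℝ → Plane → ℝ) (X : ℝ → ℝ → Plane) (L : ℝ → ℝ) (t : ℝ) : ℝ :=
  sSup ((fun s => |inner ℝ (velocity (θ t) (X t s)) (unitTangent (θ t) (X t s))|) '' Icc 0 (L t))

/-- `C₁ = exp C₀`. -/
def constOne (C₀ : ℝ) : ℝ := Real.exp C₀

/-- `C_U = C₀ (2 C₁ - 1)`. -/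
def constU (C₀ : ℝ) : ℝ := C₀ * (2 * constOne C₀ - 1)

/-- `C_V = 2 C₀ C₁ + (C₁ - 1)(C_l + 1) + 2 C₁`. -/
def constV (C₀ Cl : ℝ) : ℝ :=
  2 * C₀ * constOne C₀ + (constOne C₀ - 1) * (Cl + 1) + 2 * constOne C₀

end

end SQG

/-! ### Kernel bounds for the potential of order one. -/

namespace SQG

/-! Velocity bound. The components of `u` are, up to sign, potentials with kernel 1/(2π|y|) of the
first partial derivatives of `θ`. Let W > 1 bound these derivatives and put ε = 1/W. Replacing 1/|y|
by 1/√(|y|² + ε²) changes the kernel by a function of mass O(ε), which costs only O(1) against a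
gradient of size W. In the regularised integral the derivative is moved to the kernel: on |y| ≤ 1
the sup norm of `θ` gives a multiple of log(W + 1), and outside the L² norm gives O(1)
(`integral_inv_smul_partialDeriv_le`). Both norms are controlled by their initial values, by a
maximum principle (`abs_le_of_initial`) and because `u` is divergence free (`integral_sq_eq`).

Growth estimate. Along a piece of length ℓ of the level set, let w = 1/|∇^⊥θ| and let F be the mean
of w. The strip between two neighbouring level sets has width proportional to w, so
incompressibility becomes a conservation law for w ds: up to orientation, the time derivative of ℓF
is the difference of the endpoint values of slip times w, where slip is the tangential velocity of
the curve relative to the fluid (`hasDerivAt_slip_mul_weight`). The motion of the far endpoint is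
eliminated with the equation for ℓ' (`inner_timeDeriv_sub`), and there remains −ℓF' ≤ ℓ'(F − w(far
end)) + 2 max(C_U, C_V) U F, with U a bound for the velocity (`neg_length_mul_deriv_le`). The factor
2 arises because curvature and endpoint terms are each bounded by the maximum; it is absorbed into
`Cu`.

Since d log|∇^⊥θ|/ds = ±τ, the gradient varies by at most the factor C₁ on the segment, hence Ω ≤
C₁/(c₀F). So φ = log(C₁/(c₀F)) dominates log Ω, the velocity bound gives U ≤ Cφ, and the inequality
closes: φ' ≤ Kφ + max(ℓ', 0)/L₀, where K is `rate` (`exists_hasDerivAt_logBound`).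

Nothing bounds L' from above. When ℓ = L, the gradient is maximal at the far end, so F − w(far end)
≥ 0: shrinking is harmless, but lengthening is not. Therefore F is taken over an initial piece whose
length l is any number in [L₀, L(t)]: l follows L where L does not increase to first order, and
otherwise stays constant. The set of times at which some l gives φ ≤ E, where E' = kE and k > K, is
closed and can always be continued to the right (`isClosed_setOf_exists_le`, `exists_forward`).
Finally k decreases to K, and at T₀ the inequality between harmonic and arithmetic mean brings in
Q(T₀). -/

lemma finrank_plane : Module.finrank ℝ Plane = 2 := by simp [Plane]

/-- A radial function `|y|⁻¹ (1 + |y|)⁻²`, integrable on the plane. -/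
noncomputable def baseKernel (r : ℝ) : ℝ := r⁻¹ * ((1 + r) ^ 2)⁻¹

lemma integrableOn_inv_one_add_sq : IntegrableOn (fun r : ℝ => ((1 + r) ^ 2)⁻¹) (Ioi 0) := by
  have h : Integrable (fun x : ℝ => (1 + ‖x‖) ^ (-(2 : ℝ))) :=
    integrable_one_add_norm (by simp)
  refine (h.integrableOn (s := Ioi 0)).congr_fun (fun r hr => ?_) measurableSet_Ioi
  have hr' : (0 : ℝ) < r := hr
  simp only [Real.norm_eq_abs, abs_of_pos hr']
  rw [Real.rpow_neg (by positivity)]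
  norm_cast

/-- In polar coordinates the Jacobian r cancels the singularity r⁻¹ and leaves (1 + r)⁻² on the half
line. -/
lemma integrable_baseKernel : Integrable (fun y : Plane => baseKernel ‖y‖) := by
  refine (integrable_fun_norm_addHaar (volume : Measure Plane) (f := baseKernel)).2 ?_
  refine integrableOn_inv_one_add_sq.congr_fun (fun r hr => ?_) measurableSet_Ioi
  have hr' : (0 : ℝ) < r := hr
  rw [finrank_plane]
  simp only [baseKernel, smul_eq_mul, Nat.add_one_sub_one, pow_one]
  rw [mul_inv_cancel_left₀ hr'.ne']

lemma integrable_inv_one_add_cube : Integrable (fun y : Plane => ((1 + ‖y‖) ^ 3)⁻¹) := by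
  have h : Integrable (fun x : Plane => (1 + ‖x‖) ^ (-(3 : ℝ))) :=
    integrable_one_add_norm (by rw [finrank_plane]; norm_num)
  refine h.congr (Filter.Eventually.of_forall fun y => ?_)
  simp only
  rw [Real.rpow_neg (by positivity)]
  norm_cast

lemma mul_sq_le_cube_add_cube {a b : ℝ} (ha : 0 ≤ a) (hb : 0 ≤ b) : a * b ^ 2 ≤ a ^ 3 + b ^ 3 := by
  rcases le_total a b with h | h
  · nlinarith [mul_le_mul_of_nonneg_right h (sq_nonneg b), pow_nonneg ha 3]
  · nlinarith [mul_le_mul_of_nonneg_left (pow_le_pow_left₀ hb h 2) ha, pow_nonneg hb 3]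

/-- A dominating function for `y ↦ |y|⁻¹ (1 + |x - y|)⁻²`. -/
noncomputable def majorant (x y : Plane) : ℝ :=
  baseKernel ‖y‖ + 2 * (((1 + ‖y‖) ^ 3)⁻¹ + ((1 + ‖x - y‖) ^ 3)⁻¹)

lemma majorant_nonneg (x y : Plane) : 0 ≤ majorant x y := by
  unfold majorant baseKernel; positivity

/-- The factor r⁻¹ splits into the singular but integrable r⁻¹(1 + r)⁻² and a remainder of at most
2(1 + r)⁻¹. The inequality ab² ≤ a³ + b³ separates this remainder from the decay in x − y, so that
by translation invariance the majorant has a mass independent of x. -/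
lemma inv_norm_mul_le_majorant (x y : Plane) :
    ‖y‖⁻¹ * ((1 + ‖x - y‖) ^ 2)⁻¹ ≤ majorant x y := by
  rcases eq_or_ne y 0 with rfl | hy
  · simpa using majorant_nonneg x 0
  have hr : 0 < ‖y‖ := norm_pos_iff.2 hy
  have hd : 0 ≤ ‖x - y‖ := norm_nonneg _
  unfold majorant baseKernel
  set r := ‖y‖
  set d := ‖x - y‖
  have h1 : ((1 + d) ^ 2)⁻¹ ≤ 1 := inv_le_one_of_one_le₀ (by nlinarith)
  have h2 : r⁻¹ = r⁻¹ * ((1 + r) ^ 2)⁻¹ + (((1 + r) ^ 2)⁻¹ + (1 + r)⁻¹) := by field_simp; ring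
  have h3 : ((1 + r) ^ 2)⁻¹ ≤ (1 + r)⁻¹ := by
    apply inv_anti₀ (by positivity); nlinarith
  have h4 := mul_sq_le_cube_add_cube (a := (1 + r)⁻¹) (b := (1 + d)⁻¹) (by positivity)
    (by positivity)
  simp only [inv_pow] at h4
  calc r⁻¹ * ((1 + d) ^ 2)⁻¹
      = r⁻¹ * ((1 + r) ^ 2)⁻¹ * ((1 + d) ^ 2)⁻¹
        + (((1 + r) ^ 2)⁻¹ + (1 + r)⁻¹) * ((1 + d) ^ 2)⁻¹ := by rw [← add_mul, ← h2]
    _ ≤ r⁻¹ * ((1 + r) ^ 2)⁻¹ * 1 + (2 * (1 + r)⁻¹) * ((1 + d) ^ 2)⁻¹ := by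
        gcongr; linarith
    _ ≤ _ := by linarith

lemma integrable_majorant (x : Plane) : Integrable (majorant x) :=
  integrable_baseKernel.add
    ((integrable_inv_one_add_cube.add (integrable_inv_one_add_cube.comp_sub_left x)).const_mul 2)

/-- The integral of `majorant x`, which does not depend on `x`. -/
noncomputable def majorantMass : ℝ :=
  (∫ y : Plane, baseKernel ‖y‖) + 2 * ((∫ y : Plane, ((1 + ‖y‖) ^ 3)⁻¹)
    + ∫ y : Plane, ((1 + ‖y‖) ^ 3)⁻¹)

lemma integral_majorant (x : Plane) : ∫ y, majorant x y = majorantMass := by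
  unfold majorant majorantMass
  have h2 := integrable_inv_one_add_cube.comp_sub_left x
  have h3 : Integrable fun y : Plane => 2 * (((1 + ‖y‖) ^ 3)⁻¹ + ((1 + ‖x - y‖) ^ 3)⁻¹) :=
    (integrable_inv_one_add_cube.add h2).const_mul 2
  rw [integral_add integrable_baseKernel h3,
    integral_const_mul, integral_add integrable_inv_one_add_cube h2,
    integral_sub_left_eq_self (fun y : Plane => ((1 + ‖y‖) ^ 3)⁻¹)]

lemma majorantMass_nonneg : 0 ≤ majorantMass := by
  rw [← integral_majorant 0]; exact integral_nonneg (majorant_nonneg 0)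

section Potential

variable {E : Type*} [NormedAddCommGroup E] [NormedSpace ℝ E]

lemma norm_inv_smul_le {f : Plane → E} {K : ℝ} (hf : ∀ x, ‖f x‖ ≤ K / (1 + ‖x‖) ^ 2)
    (x y : Plane) : ‖‖y‖⁻¹ • f (x - y)‖ ≤ K * majorant x y := by
  have hK : 0 ≤ K := by simpa using (norm_nonneg _).trans (hf 0)
  rw [norm_smul, norm_inv, norm_norm]
  calc ‖y‖⁻¹ * ‖f (x - y)‖ ≤ ‖y‖⁻¹ * (K / (1 + ‖x - y‖) ^ 2) := by gcongr; exact hf _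
    _ = K * (‖y‖⁻¹ * ((1 + ‖x - y‖) ^ 2)⁻¹) := by ring
    _ ≤ _ := by gcongr; exact inv_norm_mul_le_majorant x y

lemma aestronglyMeasurable_inv_smul {f : Plane → E} (hc : Continuous f) (x : Plane) :
    AEStronglyMeasurable (fun y : Plane => ‖y‖⁻¹ • f (x - y)) :=
  (measurable_norm.inv.aestronglyMeasurable).smul
    (hc.comp (continuous_const.sub continuous_id)).aestronglyMeasurable

lemma integrable_inv_smul {f : Plane → E} (hc : Continuous f) {K : ℝ}
    (hf : ∀ x, ‖f x‖ ≤ K / (1 + ‖x‖) ^ 2) (x : Plane) :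
    Integrable (fun y : Plane => ‖y‖⁻¹ • f (x - y)) :=
  ((integrable_majorant x).const_mul K).mono' (aestronglyMeasurable_inv_smul hc x)
    (Filter.Eventually.of_forall fun y => norm_inv_smul_le hf x y)

lemma norm_integral_inv_smul_le {f : Plane → E} {K : ℝ}
    (hf : ∀ x, ‖f x‖ ≤ K / (1 + ‖x‖) ^ 2) (x : Plane) :
    ‖∫ y : Plane, ‖y‖⁻¹ • f (x - y)‖ ≤ K * majorantMass := by
  rw [← integral_majorant x, ← integral_const_mul]
  exact norm_integral_le_of_norm_le ((integrable_majorant x).const_mul K)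
    (Filter.Eventually.of_forall fun y => norm_inv_smul_le hf x y)

lemma inv_one_add_sq_le_of_mem_ball {x x₀ : Plane} (hx : x ∈ Metric.ball x₀ 1) (y : Plane) :
    ((1 + ‖x - y‖) ^ 2)⁻¹ ≤ 4 * ((1 + ‖x₀ - y‖) ^ 2)⁻¹ := by
  have h : ‖x₀ - y‖ ≤ 1 + ‖x - y‖ := by
    have h1 : ‖x₀ - x‖ < 1 := by rw [← dist_eq_norm, dist_comm]; exact hx
    have h2 := norm_add_le (x₀ - x) (x - y)
    rw [sub_add_sub_cancel] at h2
    linarith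
  have h3 : 0 ≤ ‖x - y‖ := norm_nonneg _
  have h4 : 0 ≤ ‖x₀ - y‖ := norm_nonneg _
  rw [← div_eq_mul_inv, inv_eq_one_div, div_le_div_iff₀ (by positivity) (by positivity)]
  nlinarith

/-- The derivative is put on f, never on the singular kernel, and the integral is differentiated
under dominated convergence; the factor 4 in the bound replaces the moving point by x₀. -/
lemma hasFDerivAt_integral_inv_smul {f : Plane → E} (hd : ContDiff ℝ 1 f)
    {K : ℝ} (hf : ∀ x, ‖f x‖ ≤ K / (1 + ‖x‖) ^ 2)
    (hf' : ∀ x, ‖fderiv ℝ f x‖ ≤ K / (1 + ‖x‖) ^ 2) (x₀ : Plane) :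
    HasFDerivAt (fun x => ∫ y : Plane, ‖y‖⁻¹ • f (x - y))
      (∫ y : Plane, ‖y‖⁻¹ • fderiv ℝ f (x₀ - y)) x₀ := by
  have hK : 0 ≤ K := by simpa using (norm_nonneg _).trans (hf 0)
  have hc' : Continuous (fderiv ℝ f) := hd.continuous_fderiv one_ne_zero
  refine hasFDerivAt_integral_of_dominated_of_fderiv_le
    (F' := fun x (y : Plane) => ‖y‖⁻¹ • fderiv ℝ f (x - y)) (bound := fun y => 4 * K * majorant x₀ y) (Metric.ball_mem_nhds x₀ one_pos)
    (Filter.Eventually.of_forall fun x => aestronglyMeasurable_inv_smul hd.continuous x)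
    (integrable_inv_smul hd.continuous hf x₀) (aestronglyMeasurable_inv_smul hc' x₀)
    (Filter.Eventually.of_forall fun y x hx => ?_) ((integrable_majorant x₀).const_mul _)
    (Filter.Eventually.of_forall fun y x _ => ?_)
  · rw [norm_smul, norm_inv, norm_norm]
    calc ‖y‖⁻¹ * ‖fderiv ℝ f (x - y)‖ ≤ ‖y‖⁻¹ * (K * ((1 + ‖x - y‖) ^ 2)⁻¹) := by
          gcongr; rw [← div_eq_mul_inv]; exact hf' _
      _ ≤ ‖y‖⁻¹ * (K * (4 * ((1 + ‖x₀ - y‖) ^ 2)⁻¹)) := by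
          gcongr ‖y‖⁻¹ * (K * ?_); exact inv_one_add_sq_le_of_mem_ball hx y
      _ = 4 * K * (‖y‖⁻¹ * ((1 + ‖x₀ - y‖) ^ 2)⁻¹) := by ring
      _ ≤ _ := by gcongr; exact inv_norm_mul_le_majorant x₀ y
  · have h1 : HasFDerivAt f (fderiv ℝ f (x - y)) (x - y) :=
      (hd.differentiable one_ne_zero _).hasFDerivAt
    exact ((hasFDerivAt_comp_sub y).2 h1).const_smul _

end Potential

/-! ### The potential, the velocity and its gradient. -/

lemma invSqrtNegLaplacian_eq (f : Plane → ℝ) (x : Plane) :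
    invSqrtNegLaplacian f x = (2 * Real.pi)⁻¹ * ∫ y : Plane, ‖y‖⁻¹ • f (x - y) := by
  unfold invSqrtNegLaplacian
  rw [← integral_sub_left_eq_self (fun y => f y / ‖x - y‖) volume x]
  simp [div_eq_inv_mul]

/-- `f` is smooth and its derivatives of order at most two are bounded by `K (1 + |x|)⁻²`. -/
structure IsDecaying (f : Plane → ℝ) (K : ℝ) : Prop where
  contDiff : ContDiff ℝ ∞ f
  bound : ∀ k ≤ 2, ∀ x : Plane, ‖iteratedFDeriv ℝ k f x‖ ≤ K / (1 + ‖x‖) ^ 2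

/-- The standard basis vectors of the plane. -/
noncomputable abbrev basisVec (i : Fin 2) : Plane := EuclideanSpace.single i 1

lemma norm_basisVec (i : Fin 2) : ‖basisVec i‖ = 1 := by simp

lemma partialDeriv_def (i : Fin 2) (f : Plane → ℝ) (x : Plane) :
    partialDeriv i f x = fderiv ℝ f x (basisVec i) := rfl

lemma contDiff_partialDeriv {f : Plane → ℝ} (hf : ContDiff ℝ ∞ f) (i : Fin 2) :
    ContDiff ℝ ∞ (partialDeriv i f) :=
  (hf.fderiv_right (m := ∞) (by simp)).clm_apply contDiff_const

lemma abs_partialDeriv_le (i : Fin 2) (f : Plane → ℝ) (x : Plane) :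
    |partialDeriv i f x| ≤ ‖fderiv ℝ f x‖ := by
  simpa [partialDeriv] using (fderiv ℝ f x).le_opNorm (basisVec i)

lemma fderiv_partialDeriv {f : Plane → ℝ} (hf : ContDiff ℝ ∞ f) (i : Fin 2) (x v : Plane) :
    fderiv ℝ (partialDeriv i f) x v = fderiv ℝ (fderiv ℝ f) x v (basisVec i) := by
  have h : DifferentiableAt ℝ (fderiv ℝ f) x :=
    (hf.fderiv_right (m := ∞) (by simp)).differentiable (by simp) x
  have h2 := h.hasFDerivAt.clm_apply (hasFDerivAt_const (basisVec i) x)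
  have h3 : HasFDerivAt (partialDeriv i f) _ x := h2
  rw [h3.fderiv]
  simp

lemma norm_fderiv_partialDeriv_le {f : Plane → ℝ} (hf : ContDiff ℝ ∞ f) (i : Fin 2) (x : Plane) :
    ‖fderiv ℝ (partialDeriv i f) x‖ ≤ ‖iteratedFDeriv ℝ 2 f x‖ := by
  have h : ‖iteratedFDeriv ℝ 2 f x‖ = ‖fderiv ℝ (fderiv ℝ f) x‖ := by
    rw [← norm_iteratedFDeriv_fderiv (n := 1), norm_iteratedFDeriv_one]
  rw [h]
  refine ContinuousLinearMap.opNorm_le_bound _ (norm_nonneg (fderiv ℝ (fderiv ℝ f) x)) fun v => ?_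
  rw [fderiv_partialDeriv hf]
  refine ((fderiv ℝ (fderiv ℝ f) x v).le_opNorm _).trans ?_
  rw [norm_basisVec, mul_one]
  exact (fderiv ℝ (fderiv ℝ f) x).le_opNorm v

lemma partialDeriv_comm {f : Plane → ℝ} (hf : ContDiff ℝ ∞ f) (i j : Fin 2) (x : Plane) :
    partialDeriv i (partialDeriv j f) x = partialDeriv j (partialDeriv i f) x := by
  have h : IsSymmSndFDerivAt ℝ f x := hf.contDiffAt.isSymmSndFDerivAt
    (by rw [minSmoothness_of_isRCLikeNormedField]; exact WithTop.coe_le_coe.2 (le_top : (2 : ℕ∞) ≤ ⊤))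
  rw [partialDeriv_def i, partialDeriv_def j, fderiv_partialDeriv hf, fderiv_partialDeriv hf]
  exact h.eq _ _

namespace IsDecaying

variable {f : Plane → ℝ} {K : ℝ}

lemma nonneg (h : IsDecaying f K) : 0 ≤ K := by
  simpa using (norm_nonneg _).trans (h.bound 0 (by norm_num) 0)

lemma norm_le (h : IsDecaying f K) (x : Plane) : ‖f x‖ ≤ K / (1 + ‖x‖) ^ 2 := by
  simpa using h.bound 0 (by norm_num) x

lemma norm_fderiv_le (h : IsDecaying f K) (x : Plane) :
    ‖fderiv ℝ f x‖ ≤ K / (1 + ‖x‖) ^ 2 := by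
  simpa [norm_iteratedFDeriv_one] using h.bound 1 (by norm_num) x

lemma norm_partialDeriv_le (h : IsDecaying f K) (i : Fin 2) (x : Plane) :
    ‖partialDeriv i f x‖ ≤ K / (1 + ‖x‖) ^ 2 :=
  (abs_partialDeriv_le i f x).trans (h.norm_fderiv_le x)

lemma norm_fderiv_partialDeriv_le (h : IsDecaying f K) (i : Fin 2) (x : Plane) :
    ‖fderiv ℝ (partialDeriv i f) x‖ ≤ K / (1 + ‖x‖) ^ 2 :=
  (SQG.norm_fderiv_partialDeriv_le h.contDiff i x).trans (h.bound 2 le_rfl x)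

end IsDecaying

lemma norm_toLp_pair_le (a b : ℝ) : ‖(!₂[a, b] : Plane)‖ ≤ |a| + |b| := by
  rw [EuclideanSpace.norm_eq]
  apply Real.sqrt_le_iff.2
  refine ⟨by positivity, ?_⟩
  simp only [Fin.sum_univ_two, Real.norm_eq_abs, sq_abs, Matrix.cons_val_zero,
    Matrix.cons_val_one]
  nlinarith [mul_nonneg (abs_nonneg a) (abs_nonneg b), sq_abs a, sq_abs b]

lemma hasFDerivAt_invSqrtNegLaplacian {f : Plane → ℝ} (hd : ContDiff ℝ 1 f)
    {K : ℝ} (hf : ∀ x, ‖f x‖ ≤ K / (1 + ‖x‖) ^ 2)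
    (hf' : ∀ x, ‖fderiv ℝ f x‖ ≤ K / (1 + ‖x‖) ^ 2) (x : Plane) :
    HasFDerivAt (invSqrtNegLaplacian f)
      ((2 * Real.pi)⁻¹ • ∫ y : Plane, ‖y‖⁻¹ • fderiv ℝ f (x - y)) x := by
  have h := (hasFDerivAt_integral_inv_smul hd hf hf' x).const_smul (2 * Real.pi)⁻¹
  refine h.congr_of_eventuallyEq (Filter.Eventually.of_forall fun x => ?_)
  simp [invSqrtNegLaplacian_eq]

/-- Applied to f this expresses the velocity, and applied to the partial derivatives of f it
expresses the velocity gradient, as potentials of decaying functions. This is where decay up to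
order two is spent. -/
lemma partialDeriv_invSqrtNegLaplacian {f : Plane → ℝ} (hd : ContDiff ℝ 1 f)
    {K : ℝ} (hf : ∀ x, ‖f x‖ ≤ K / (1 + ‖x‖) ^ 2)
    (hf' : ∀ x, ‖fderiv ℝ f x‖ ≤ K / (1 + ‖x‖) ^ 2) (i : Fin 2) (x : Plane) :
    partialDeriv i (invSqrtNegLaplacian f) x = invSqrtNegLaplacian (partialDeriv i f) x := by
  have hc' : Continuous (fderiv ℝ f) := hd.continuous_fderiv one_ne_zero
  rw [partialDeriv_def, (hasFDerivAt_invSqrtNegLaplacian hd hf hf' x).fderiv,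
    invSqrtNegLaplacian_eq, smul_apply,
    ContinuousLinearMap.integral_apply (integrable_inv_smul hc' hf' x)]
  simp [partialDeriv]

lemma abs_invSqrtNegLaplacian_le {f : Plane → ℝ} {K : ℝ} (hf : ∀ x, ‖f x‖ ≤ K / (1 + ‖x‖) ^ 2)
    (x : Plane) : |invSqrtNegLaplacian f x| ≤ (2 * Real.pi)⁻¹ * (K * majorantMass) := by
  rw [invSqrtNegLaplacian_eq, abs_mul, abs_of_pos (by positivity)]
  gcongr
  exact norm_integral_inv_smul_le hf x

section Velocity

variable {f : Plane → ℝ} {K : ℝ}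

lemma velocity_zero (h : IsDecaying f K) (x : Plane) :
    velocity f x 0 = -invSqrtNegLaplacian (partialDeriv 1 f) x := by
  simp [velocity, gradPerp, partialDeriv_invSqrtNegLaplacian (h.contDiff.of_le (by simp))
    h.norm_le h.norm_fderiv_le]

lemma velocity_one (h : IsDecaying f K) (x : Plane) :
    velocity f x 1 = invSqrtNegLaplacian (partialDeriv 0 f) x := by
  simp [velocity, gradPerp, partialDeriv_invSqrtNegLaplacian (h.contDiff.of_le (by simp))
    h.norm_le h.norm_fderiv_le]

lemma velocity_eq (h : IsDecaying f K) : velocity f = fun x =>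
    !₂[-invSqrtNegLaplacian (partialDeriv 1 f) x, invSqrtNegLaplacian (partialDeriv 0 f) x] := by
  ext x i
  fin_cases i
  · exact velocity_zero h x
  · exact velocity_one h x

lemma norm_velocity_le (h : IsDecaying f K) (x : Plane) :
    ‖velocity f x‖ ≤ 2 * ((2 * Real.pi)⁻¹ * (K * majorantMass)) := by
  rw [velocity_eq h]
  refine (norm_toLp_pair_le _ _).trans ?_
  rw [abs_neg, two_mul]
  exact add_le_add (abs_invSqrtNegLaplacian_le (h.norm_partialDeriv_le 1) x)
    (abs_invSqrtNegLaplacian_le (h.norm_partialDeriv_le 0) x)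

lemma differentiableAt_invSqrt_partialDeriv (h : IsDecaying f K) (i : Fin 2) (x : Plane) :
    DifferentiableAt ℝ (invSqrtNegLaplacian (partialDeriv i f)) x :=
  (hasFDerivAt_invSqrtNegLaplacian ((contDiff_partialDeriv h.contDiff i).of_le (by simp))
    (h.norm_partialDeriv_le i) (h.norm_fderiv_partialDeriv_le i) x).differentiableAt

lemma differentiable_velocity (h : IsDecaying f K) : Differentiable ℝ (velocity f) := by
  rw [differentiable_euclidean]
  intro i x
  fin_cases i
  · simp only [Fin.zero_eta, velocity_zero h]
    exact (differentiableAt_invSqrt_partialDeriv h 1 x).neg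
  · simp only [Fin.mk_one, velocity_one h]
    exact differentiableAt_invSqrt_partialDeriv h 0 x

lemma fderiv_coord {g : Plane → Plane} {x : Plane} (hg : DifferentiableAt ℝ g x) (i : Fin 2)
    (v : Plane) : fderiv ℝ (fun y => g y i) x v = fderiv ℝ g x v i := by
  have h := (EuclideanSpace.proj i : Plane →L[ℝ] ℝ).hasFDerivAt.comp x
    hg.hasFDerivAt
  have h2 : HasFDerivAt (fun y => g y i) _ x := h
  rw [h2.fderiv]
  rfl

lemma partialDeriv_velocity_zero (h : IsDecaying f K) (j : Fin 2) (x : Plane) :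
    partialDeriv j (fun y => velocity f y 0) x =
      -invSqrtNegLaplacian (partialDeriv j (partialDeriv 1 f)) x := by
  simp only [velocity_zero h]
  rw [partialDeriv_def, fderiv_fun_neg, neg_apply, ← partialDeriv_def,
    partialDeriv_invSqrtNegLaplacian ((contDiff_partialDeriv h.contDiff 1).of_le (by simp))
    (h.norm_partialDeriv_le 1) (h.norm_fderiv_partialDeriv_le 1)]

lemma partialDeriv_velocity_one (h : IsDecaying f K) (j : Fin 2) (x : Plane) :
    partialDeriv j (fun y => velocity f y 1) x =
      invSqrtNegLaplacian (partialDeriv j (partialDeriv 0 f)) x := by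
  simp only [velocity_one h]
  exact partialDeriv_invSqrtNegLaplacian ((contDiff_partialDeriv h.contDiff 0).of_le (by simp))
    (h.norm_partialDeriv_le 0) (h.norm_fderiv_partialDeriv_le 0) j x

lemma partialDeriv_velocity_add (h : IsDecaying f K) (x : Plane) :
    partialDeriv 0 (fun y => velocity f y 0) x + partialDeriv 1 (fun y => velocity f y 1) x = 0 := by
  rw [partialDeriv_velocity_zero h, partialDeriv_velocity_one h,
    show partialDeriv 0 (partialDeriv 1 f) = partialDeriv 1 (partialDeriv 0 f) from
      funext (partialDeriv_comm h.contDiff 0 1)]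
  ring

lemma abs_partialDeriv_velocity_le (h : IsDecaying f K) (i j : Fin 2) (x : Plane) :
    |partialDeriv j (fun y => velocity f y i) x| ≤ (2 * Real.pi)⁻¹ * (K * majorantMass) := by
  have key : ∀ k, |invSqrtNegLaplacian (partialDeriv j (partialDeriv k f)) x| ≤
      (2 * Real.pi)⁻¹ * (K * majorantMass) := fun k =>
    abs_invSqrtNegLaplacian_le (fun x => (abs_partialDeriv_le j _ x).trans
      (h.norm_fderiv_partialDeriv_le k x)) x
  fin_cases i
  · simp only [Fin.zero_eta, partialDeriv_velocity_zero h, abs_neg, key]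
  · simp only [Fin.mk_one, partialDeriv_velocity_one h, key]

/-- The divergence of `u` vanishes. -/
lemma fderiv_velocity_trace (h : IsDecaying f K) (x : Plane) :
    fderiv ℝ (velocity f) x (basisVec 0) 0 + fderiv ℝ (velocity f) x (basisVec 1) 1 = 0 := by
  rw [← fderiv_coord (differentiable_velocity h x), ← fderiv_coord (differentiable_velocity h x)]
  exact partialDeriv_velocity_add h x

end Velocity

/-! ### The logarithmic velocity bound at a fixed time. -/

lemma IsDecaying.sq_le {f : Plane → ℝ} {K : ℝ} (h : IsDecaying f K) (x : Plane) :
    f x ^ 2 ≤ K ^ 2 * ((1 + ‖x‖) ^ 3)⁻¹ := by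
  have h1 := h.norm_le x
  rw [Real.norm_eq_abs] at h1
  have hn : 0 ≤ ‖x‖ := norm_nonneg x
  calc f x ^ 2 = |f x| ^ 2 := (sq_abs _).symm
    _ ≤ (K / (1 + ‖x‖) ^ 2) ^ 2 := by gcongr
    _ = K ^ 2 * ((1 + ‖x‖) ^ 4)⁻¹ := by rw [div_pow, ← pow_mul]; rfl
    -- The fourth power is weakened to the third so that a single integrable majorant serves
    -- throughout.
    _ ≤ _ := by
      gcongr
      · linarith
      · norm_num

lemma IsDecaying.integrable_sq {f : Plane → ℝ} {K : ℝ} (h : IsDecaying f K) :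
    Integrable fun x => f x ^ 2 :=
  (integrable_inv_one_add_cube.const_mul (K ^ 2)).mono'
    (h.contDiff.continuous.pow 2).aestronglyMeasurable
    (Filter.Eventually.of_forall fun x => by
      rw [Real.norm_of_nonneg (sq_nonneg _)]; exact h.sq_le x)

/-- The regularised kernel `(|y|² + ε²)^{-1/2}`. -/
noncomputable def regKernel (ε : ℝ) (y : Plane) : ℝ := (√(‖y‖ ^ 2 + ε ^ 2))⁻¹

lemma hasFDerivAt_regKernel {ε : ℝ} (hε : 0 < ε) (y : Plane) :
    HasFDerivAt (regKernel ε) (-(√(‖y‖ ^ 2 + ε ^ 2) ^ 3)⁻¹ • innerSL ℝ y) y := by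
  have h0 : 0 < ‖y‖ ^ 2 + ε ^ 2 := by positivity
  have h1 : HasFDerivAt (fun z : Plane => ‖z‖ ^ 2 + ε ^ 2) (2 • innerSL ℝ y) y :=
    (hasStrictFDerivAt_norm_sq y).hasFDerivAt.add_const _
  have h2 := (h1.sqrt h0.ne')
  have h3 := (hasDerivAt_inv (Real.sqrt_pos.2 h0).ne').comp_hasFDerivAt y h2
  refine HasFDerivAt.congr_fderiv (f := regKernel ε) h3 ?_
  ext v
  have h4 := Real.sqrt_pos.2 h0
  simp only [smul_apply, smul_eq_mul, nsmul_eq_mul, Nat.cast_ofNat]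
  field_simp

lemma norm_fderiv_regKernel_le {ε : ℝ} (hε : 0 < ε) (y v : Plane) :
    |fderiv ℝ (regKernel ε) y v| ≤ ‖y‖ * (√(‖y‖ ^ 2 + ε ^ 2) ^ 3)⁻¹ * ‖v‖ := by
  rw [(hasFDerivAt_regKernel hε y).fderiv]
  simp only [smul_apply, smul_eq_mul, abs_mul, abs_neg, innerSL_apply_apply]
  rw [abs_of_nonneg (by positivity)]
  have := abs_real_inner_le_norm y v
  calc (√(‖y‖ ^ 2 + ε ^ 2) ^ 3)⁻¹ * |inner ℝ y v|
      ≤ (√(‖y‖ ^ 2 + ε ^ 2) ^ 3)⁻¹ * (‖y‖ * ‖v‖) := by gcongr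
    _ = _ := by ring

section RealBounds

variable {r ε : ℝ}

lemma sqrt_cube_bound (hε : 0 < ε) :
    r * (√(r ^ 2 + ε ^ 2) ^ 3)⁻¹ ≤ (r ^ 2 + ε ^ 2)⁻¹ := by
  have h0 : 0 < r ^ 2 + ε ^ 2 := by positivity
  have h1 : r ≤ √(r ^ 2 + ε ^ 2) := Real.le_sqrt_of_sq_le (by nlinarith)
  have h2 := Real.sqrt_pos.2 h0
  rw [pow_succ, Real.sq_sqrt h0.le, mul_inv]
  calc r * ((r ^ 2 + ε ^ 2)⁻¹ * (√(r ^ 2 + ε ^ 2))⁻¹)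
      ≤ √(r ^ 2 + ε ^ 2) * ((r ^ 2 + ε ^ 2)⁻¹ * (√(r ^ 2 + ε ^ 2))⁻¹) := by gcongr
    _ = _ := by field_simp

/-- With the Jacobian r included, the gradient of the regularised kernel has size 1/(r + ε); its
integral over [0, 1] is the source of the logarithm. -/
lemma mul_sqrt_cube_le (hr : 0 ≤ r) (hε : 0 < ε) :
    r * (r * (√(r ^ 2 + ε ^ 2) ^ 3)⁻¹) ≤ 2 * (r + ε)⁻¹ := by
  have h0 : 0 < r ^ 2 + ε ^ 2 := by positivity
  have h2 := Real.sqrt_pos.2 h0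
  have h3 : (r + ε) ≤ 2 * √(r ^ 2 + ε ^ 2) := by
    have h5 : (r + ε) / 2 ≤ √(r ^ 2 + ε ^ 2) := Real.le_sqrt_of_sq_le (by nlinarith [sq_nonneg (r - ε)])
    linarith
  have h1 : r * r * (√(r ^ 2 + ε ^ 2) ^ 3)⁻¹ ≤ (√(r ^ 2 + ε ^ 2))⁻¹ := by
    rw [pow_succ, Real.sq_sqrt h0.le, mul_inv, ← mul_assoc]
    have : r * r * (r ^ 2 + ε ^ 2)⁻¹ ≤ 1 := by
      rw [← div_eq_mul_inv, div_le_one h0]; nlinarith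
    calc _ ≤ 1 * (√(r ^ 2 + ε ^ 2))⁻¹ := by gcongr
      _ = _ := one_mul _
  rw [← mul_assoc]
  refine h1.trans ?_
  rw [← div_eq_mul_inv, inv_eq_one_div, div_le_div_iff₀ h2 (by positivity)]
  linarith

/-- Away from the origin the gradient of the kernel is O(r⁻²), whose square is integrable at
infinity in the plane; there the L² norm of f suffices. -/
lemma sqrt_cube_sq_le (hr : 1 ≤ r) (hε : 0 < ε) :
    (r * (√(r ^ 2 + ε ^ 2) ^ 3)⁻¹) ^ 2 ≤ 16 * ((1 + r) ^ 3)⁻¹ := by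
  have hr0 : 0 < r := by linarith
  have h1 := sqrt_cube_bound (r := r) hε
  have h2 : (r ^ 2 + ε ^ 2)⁻¹ ≤ (r ^ 2)⁻¹ := inv_anti₀ (by positivity) (by nlinarith)
  calc (r * (√(r ^ 2 + ε ^ 2) ^ 3)⁻¹) ^ 2 ≤ ((r ^ 2)⁻¹) ^ 2 := by
        gcongr; exact h1.trans h2
    _ = (r ^ 4)⁻¹ := by rw [inv_pow, ← pow_mul]
    _ ≤ _ := by
        rw [← div_eq_mul_inv, inv_eq_one_div, div_le_div_iff₀ (by positivity) (by positivity)]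
        have : (1 + r) ^ 3 ≤ (2 * r) ^ 3 := by gcongr; linarith
        have h5 : r ^ 3 ≤ r ^ 4 := pow_le_pow_right₀ hr (by norm_num)
        nlinarith [pow_pos hr0 4]

/-- With s = √(r² + ε²) the difference equals ε²/(r s (s + r)), and (r + ε)² ≤ 2s(s + r). The bound
is written as a rescaled `baseKernel` so that its mass can be read off by scaling. -/
lemma inv_sub_inv_sqrt_le (hr : 0 < r) (hε : 0 < ε) :
    |r⁻¹ - (√(r ^ 2 + ε ^ 2))⁻¹| ≤ ε⁻¹ * (2 * baseKernel (ε⁻¹ * r)) := by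
  have h0 : 0 < r ^ 2 + ε ^ 2 := by positivity
  have h2 := Real.sqrt_pos.2 h0
  have h1 : r ≤ √(r ^ 2 + ε ^ 2) := Real.le_sqrt_of_sq_le (by nlinarith)
  have h3 : √(r ^ 2 + ε ^ 2) ^ 2 = r ^ 2 + ε ^ 2 := Real.sq_sqrt h0.le
  rw [abs_of_nonneg (sub_nonneg.2 (inv_anti₀ hr h1))]
  have e : ε⁻¹ * (2 * baseKernel (ε⁻¹ * r)) = 2 * ε ^ 2 / (r * (r + ε) ^ 2) := by
    unfold baseKernel; field_simp; ring
  set s := √(r ^ 2 + ε ^ 2)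
  have e2 : r⁻¹ - s⁻¹ = ε ^ 2 / (r * s * (s + r)) := by
    field_simp; linear_combination h3
  rw [e, e2, div_le_div_iff₀ (by positivity) (by positivity)]
  have h5 : (r + ε) ^ 2 ≤ 2 * (s * (s + r)) := by
    nlinarith [sq_nonneg (r - ε), mul_nonneg hr.le (sub_nonneg.2 h1), mul_nonneg h2.le hr.le]
  calc ε ^ 2 * (r * (r + ε) ^ 2) ≤ ε ^ 2 * (r * (2 * (s * (s + r)))) := by gcongr
    _ = _ := by ring

end RealBounds

/-- Scaling in the plane gives ε², of which the prefactor consumes one power. -/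
lemma integral_baseKernel_comp {ε : ℝ} (hε : 0 < ε) :
    ∫ y : Plane, ε⁻¹ * (2 * baseKernel (ε⁻¹ * ‖y‖)) =
      ε * (2 * ∫ y : Plane, baseKernel ‖y‖) := by
  have h := Measure.integral_comp_smul (volume : Measure Plane)
    (fun y : Plane => baseKernel ‖y‖) ε⁻¹
  simp only [norm_smul, Real.norm_of_nonneg (inv_pos.2 hε).le, finrank_plane, smul_eq_mul] at h
  rw [integral_const_mul, integral_const_mul, h, abs_of_pos (by positivity)]
  field_simp

lemma integrable_baseKernel_comp {ε : ℝ} (hε : 0 < ε) :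
    Integrable fun y : Plane => ε⁻¹ * (2 * baseKernel (ε⁻¹ * ‖y‖)) := by
  have h := integrable_baseKernel.comp_smul (inv_pos.2 hε).ne'
  simp only [norm_smul, Real.norm_of_nonneg (inv_pos.2 hε).le] at h
  exact (h.const_mul 2).const_mul _

lemma ae_ne_zero_plane : ∀ᵐ y : Plane, y ≠ 0 := by
  simp [ae_iff]

/-- The near part of the regularised gradient kernel. -/
noncomputable def nearKernel (ε : ℝ) : ℝ → ℝ :=
  (Iic (1 : ℝ)).indicator fun r => r * (√(r ^ 2 + ε ^ 2) ^ 3)⁻¹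

lemma integrableOn_mul_nearKernel {ε : ℝ} (hε : 0 < ε) :
    IntegrableOn (fun r : ℝ => r * nearKernel ε r) (Ioi 0) ∧
      ∫ r in Ioi (0 : ℝ), r * nearKernel ε r ≤ 2 * Real.log ((1 + ε) / ε) := by
  have hc : Continuous fun r : ℝ => r * (r * (√(r ^ 2 + ε ^ 2) ^ 3)⁻¹) := by
    have : ∀ r : ℝ, √(r ^ 2 + ε ^ 2) ^ 3 ≠ 0 := fun r => by positivity
    fun_prop (disch := assumption)
  have e : (fun r : ℝ => r * nearKernel ε r) =
      (Iic (1 : ℝ)).indicator fun r => r * (r * (√(r ^ 2 + ε ^ 2) ^ 3)⁻¹) := by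
    ext r
    by_cases h : r ∈ Iic (1 : ℝ) <;> simp [nearKernel, h]
  have hcap : Ioi (0 : ℝ) ∩ Iic 1 = Ioc 0 1 := Ioi_inter_Iic
  constructor
  · rw [e, integrableOn_indicator_iff measurableSet_Iic, inter_comm, hcap]
    exact (hc.integrableOn_Icc).mono_set Ioc_subset_Icc_self
  · rw [e, setIntegral_indicator measurableSet_Iic, hcap,
      ← intervalIntegral.integral_of_le zero_le_one]
    have hlog : ∫ r in (0 : ℝ)..1, 2 * (r + ε)⁻¹ = 2 * Real.log ((1 + ε) / ε) := by
      rw [intervalIntegral.integral_const_mul,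
        intervalIntegral.integral_comp_add_right (fun r => r⁻¹), zero_add,
        integral_inv_of_pos hε (by positivity)]
    rw [← hlog]
    refine intervalIntegral.integral_mono_on zero_le_one (hc.intervalIntegrable _ _) ?_
      fun r hr => mul_sqrt_cube_le hr.1 hε
    refine ContinuousOn.intervalIntegrable fun r hr => ContinuousAt.continuousWithinAt ?_
    rw [uIcc_of_le zero_le_one] at hr
    have : r + ε ≠ 0 := by have := hr.1; positivity
    fun_prop (disch := assumption)

lemma integrable_nearKernel {ε : ℝ} (hε : 0 < ε) :
    Integrable fun y : Plane => nearKernel ε ‖y‖ := by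
  rw [integrable_fun_norm_addHaar, finrank_plane]
  simpa using (integrableOn_mul_nearKernel hε).1

lemma integral_nearKernel_le {ε : ℝ} (hε : 0 < ε) :
    ∫ y : Plane, nearKernel ε ‖y‖ ≤
      2 * volume.real (Metric.ball (0 : Plane) 1) * (2 * Real.log ((1 + ε) / ε)) := by
  rw [integral_fun_norm_addHaar, finrank_plane]
  simp only [Nat.add_one_sub_one, pow_one, smul_eq_mul, nsmul_eq_mul, Nat.cast_ofNat]
  rw [← mul_assoc]
  gcongr
  exact (integrableOn_mul_nearKernel hε).2

/-- Inside the unit disc the sup bound for a is used; outside, the product is split by Young's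
inequality, and 8 is half the constant of `sqrt_cube_sq_le`. -/
lemma abs_mul_kernel_le {a M ε : ℝ} (hM : |a| ≤ M) (hε : 0 < ε) (y : Plane) :
    |a| * (‖y‖ * (√(‖y‖ ^ 2 + ε ^ 2) ^ 3)⁻¹) ≤
      M * nearKernel ε ‖y‖ + (a ^ 2 / 2 + 8 * ((1 + ‖y‖) ^ 3)⁻¹) := by
  have hn := norm_nonneg y
  by_cases h : ‖y‖ ∈ Iic (1 : ℝ)
  · have h1 : |a| * (‖y‖ * (√(‖y‖ ^ 2 + ε ^ 2) ^ 3)⁻¹) ≤ M * nearKernel ε ‖y‖ := by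
      rw [nearKernel, indicator_of_mem h]; gcongr
    have : 0 ≤ a ^ 2 / 2 + 8 * ((1 + ‖y‖) ^ 3)⁻¹ := by positivity
    linarith
  · rw [nearKernel, indicator_of_notMem h, mul_zero, zero_add]
    have h2 := sqrt_cube_sq_le (not_le.1 h).le hε
    set k := ‖y‖ * (√(‖y‖ ^ 2 + ε ^ 2) ^ 3)⁻¹
    nlinarith [sq_nonneg (|a| - k), sq_abs a]

lemma integral_inv_smul_partialDeriv_le {f : Plane → ℝ} {K M W : ℝ} (h : IsDecaying f K)
    (hM : ∀ x, |f x| ≤ M) (hL : ∫ x, f x ^ 2 ≤ M ^ 2) (i : Fin 2)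
    (hW : ∀ x, |partialDeriv i f x| ≤ W) (hW1 : 0 < W) (x : Plane) :
    |∫ y : Plane, ‖y‖⁻¹ • partialDeriv i f (x - y)| ≤
      2 * (∫ y : Plane, baseKernel ‖y‖) +
      (M * (2 * volume.real (Metric.ball (0 : Plane) 1) * (2 * Real.log (W + 1))) +
        (M ^ 2 / 2 + 8 * ∫ y : Plane, ((1 + ‖y‖) ^ 3)⁻¹)) := by
  have hM0 : 0 ≤ M := (abs_nonneg _).trans (hM 0)
  -- This scale makes the regularisation error, of order εW, bounded, at the cost of a factor log(W
  -- + 1) in the other part.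
  set ε := W⁻¹ with hεW
  have hε : 0 < ε := inv_pos.2 hW1
  have hlog : (1 + ε) / ε = W + 1 := by rw [hεW]; field_simp
  set F : Plane → ℝ := fun y => f (x - y) with hF
  have hfd : Differentiable ℝ f := h.contDiff.differentiable (by simp)
  have hFd : ∀ y, fderiv ℝ F y (basisVec i) = -partialDeriv i f (x - y) := fun y => by
    have h1 : HasFDerivAt F _ y :=
      (hfd (x - y)).hasFDerivAt.comp y ((hasFDerivAt_id y).const_sub x)
    rw [h1.fderiv]
    simp [partialDeriv]
  have hcf : Continuous f := h.contDiff.continuous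
  have hcd : Continuous (partialDeriv i f) := (contDiff_partialDeriv h.contDiff i).continuous
  have hcF : Continuous F := hcf.comp (continuous_const.sub continuous_id)
  have hcD : Continuous fun y => partialDeriv i f (x - y) :=
    hcd.comp (continuous_const.sub continuous_id)
  have hg : Differentiable ℝ (regKernel ε) := fun y => (hasFDerivAt_regKernel hε y).differentiableAt
  have hgc : Continuous (regKernel ε) := hg.continuous
  have hgpos : ∀ y, 0 ≤ regKernel ε y := fun y => by unfold regKernel; positivity
  have hgle : ∀ y : Plane, y ≠ 0 → regKernel ε y ≤ ‖y‖⁻¹ := fun y hy =>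
    inv_anti₀ (norm_pos_iff.2 hy) (Real.le_sqrt_of_sq_le (by nlinarith))
  have hgm : Measurable fun y => fderiv ℝ (regKernel ε) y (basisVec i) :=
    measurable_fderiv_apply_const ℝ _ _
  -- integrability
  have i0 : Integrable fun y : Plane => ‖y‖⁻¹ • partialDeriv i f (x - y) :=
    integrable_inv_smul hcd (h.norm_partialDeriv_le i) x
  have i0' : Integrable fun y : Plane => ‖y‖⁻¹ • f (x - y) :=
    integrable_inv_smul hcf h.norm_le x
  have i1 : Integrable fun y => partialDeriv i f (x - y) * regKernel ε y := by
    refine i0.mono (hcD.mul hgc).aestronglyMeasurable ?_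
    filter_upwards [ae_ne_zero_plane] with y hy
    rw [norm_mul, norm_smul, mul_comm, norm_inv, norm_norm, Real.norm_of_nonneg (hgpos y)]
    gcongr
    exact hgle y hy
  have i2 : Integrable fun y => F y * regKernel ε y := by
    refine i0'.mono (hcF.mul hgc).aestronglyMeasurable ?_
    filter_upwards [ae_ne_zero_plane] with y hy
    rw [norm_mul, norm_smul, mul_comm, norm_inv, norm_norm, Real.norm_of_nonneg (hgpos y)]
    gcongr
    exact hgle y hy
  have hk : ∀ y, |F y * fderiv ℝ (regKernel ε) y (basisVec i)| ≤
      |f (x - y)| * (‖y‖ * (√(‖y‖ ^ 2 + ε ^ 2) ^ 3)⁻¹) := fun y => by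
    rw [abs_mul]
    gcongr
    simpa using norm_fderiv_regKernel_le hε y (basisVec i)
  have i4 : Integrable fun y => f (x - y) ^ 2 := h.integrable_sq.comp_sub_left x
  have i5 := integrable_inv_one_add_cube
  have i6 : Integrable fun y : Plane => f (x - y) ^ 2 / 2 + 8 * ((1 + ‖y‖) ^ 3)⁻¹ :=
    (i4.div_const 2).add (i5.const_mul 8)
  have i7 : Integrable fun y : Plane => M * nearKernel ε ‖y‖ :=
    (integrable_nearKernel hε).const_mul M
  have hk' : ∀ y, ‖F y * fderiv ℝ (regKernel ε) y (basisVec i)‖ ≤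
      M * nearKernel ε ‖y‖ + (f (x - y) ^ 2 / 2 + 8 * ((1 + ‖y‖) ^ 3)⁻¹) := fun y =>
    (hk y).trans (abs_mul_kernel_le (hM _) hε y)
  have i3 : Integrable fun y => F y * fderiv ℝ (regKernel ε) y (basisVec i) :=
    (i7.add i6).mono' (hcF.aestronglyMeasurable.mul hgm.aestronglyMeasurable)
      (Filter.Eventually.of_forall hk')
  -- integration by parts
  have ibp : ∫ y, partialDeriv i f (x - y) * regKernel ε y =
      ∫ y, F y * fderiv ℝ (regKernel ε) y (basisVec i) := by
    rw [integral_mul_fderiv_eq_neg_fderiv_mul_of_integrable (f := F) (g := regKernel ε)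
      (v := basisVec i) (by simp only [hFd, neg_mul]; exact i1.neg) i3 i2
      (fun y _ => (hfd _).comp y (differentiableAt_id.const_sub x)) (fun y _ => hg y)]
    simp only [hFd, neg_mul, integral_neg, neg_neg]
  have b2 : |∫ y, partialDeriv i f (x - y) * regKernel ε y| ≤
      M * (2 * volume.real (Metric.ball (0 : Plane) 1) * (2 * Real.log (W + 1))) +
        (M ^ 2 / 2 + 8 * ∫ y : Plane, ((1 + ‖y‖) ^ 3)⁻¹) := by
    rw [ibp]
    refine (norm_integral_le_of_norm_le (i7.add i6) (Filter.Eventually.of_forall hk')).trans ?_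
    have hA := integral_nearKernel_le hε
    rw [hlog] at hA
    have hB : ∫ y, f (x - y) ^ 2 = ∫ y, f y ^ 2 :=
      integral_sub_left_eq_self (fun y => f y ^ 2) volume x
    rw [integral_add' i7 i6, integral_const_mul, integral_add (i4.div_const 2) (i5.const_mul 8),
      integral_const_mul, integral_div, hB]
    gcongr
  have b1 : |∫ y : Plane, (‖y‖⁻¹ - regKernel ε y) * partialDeriv i f (x - y)| ≤
      2 * ∫ y : Plane, baseKernel ‖y‖ := by
    have hb : ∀ᵐ y : Plane, ‖(‖y‖⁻¹ - regKernel ε y) * partialDeriv i f (x - y)‖ ≤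
        ε⁻¹ * (2 * baseKernel (ε⁻¹ * ‖y‖)) * W := by
      filter_upwards [ae_ne_zero_plane] with y hy
      rw [norm_mul]
      have := inv_sub_inv_sqrt_le (norm_pos_iff.2 hy) hε
      gcongr
      · exact (abs_nonneg _).trans this
      · exact this
      · exact hW _
    refine (norm_integral_le_of_norm_le ((integrable_baseKernel_comp hε).mul_const W) hb).trans ?_
    rw [integral_mul_const, integral_baseKernel_comp hε, hεW]
    apply le_of_eq
    field_simp
  have split : ∫ y : Plane, ‖y‖⁻¹ • partialDeriv i f (x - y) =
      (∫ y : Plane, (‖y‖⁻¹ - regKernel ε y) * partialDeriv i f (x - y)) +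
        ∫ y, partialDeriv i f (x - y) * regKernel ε y := by
    rw [← integral_add _ i1]
    · congr 1; ext y; simp only [smul_eq_mul]; ring
    · refine (i0.sub i1).congr (Filter.Eventually.of_forall fun y => ?_)
      simp only [Pi.sub_apply, smul_eq_mul]; ring
  rw [split]
  exact (abs_add_le _ _).trans (add_le_add b1 b2)

/-- The velocity grows at most like the logarithm of the maximal gradient. -/
theorem exists_norm_velocity_le_log (M b : ℝ) (hb : 1 < b) :
    ∃ C : ℝ, 0 < C ∧ ∀ (f : Plane → ℝ) (K W : ℝ), IsDecaying f K → (∀ x, |f x| ≤ M) →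
      ∫ x, f x ^ 2 ≤ M ^ 2 → (∀ i x, |partialDeriv i f x| ≤ W) → b ≤ W →
      ∀ x, ‖velocity f x‖ ≤ C * Real.log W := by
  set c := (2 * Real.pi)⁻¹
  have hc : 0 < c := by positivity
  set D := 2 * ∫ y : Plane, baseKernel ‖y‖
  have hD : 0 ≤ D :=
    mul_nonneg (by norm_num) (integral_nonneg fun y => by unfold baseKernel; positivity)
  set N := M ^ 2 / 2 + 8 * ∫ y : Plane, ((1 + ‖y‖) ^ 3)⁻¹
  have hN : 0 ≤ N := add_nonneg (by positivity)
    (mul_nonneg (by norm_num) (integral_nonneg fun y => by positivity))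
  -- The absolute value is needed because the constant is chosen before any function forces M ≥ 0.
  set B := |M| * (2 * volume.real (Metric.ball (0 : Plane) 1) * 2)
  have hB : 0 ≤ B := by positivity
  have hlb : 0 < Real.log b := Real.log_pos hb
  -- The bounded terms are absorbed through log W ≥ log b > 0, the factor 2 counts the two
  -- components, and the summand 1 makes the constant positive.
  set C := 2 * (c * ((D + N + B * Real.log 2) / Real.log b + B)) + 1
  have hl2 : 0 < Real.log 2 := Real.log_pos (by norm_num)
  refine ⟨C, by positivity, fun f K W h hM hL hW hbW x => ?_⟩
  have hM0 : 0 ≤ M := (abs_nonneg _).trans (hM 0)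
  have hW1 : 1 < W := hb.trans_le hbW
  have hlW : Real.log b ≤ Real.log W := Real.log_le_log (by linarith) hbW
  have hl : Real.log (W + 1) ≤ Real.log 2 + Real.log W := by
    rw [← Real.log_mul (by norm_num) (by linarith)]
    exact Real.log_le_log (by linarith) (by linarith)
  have key : ∀ i, |invSqrtNegLaplacian (partialDeriv i f) x| ≤
      c * ((D + N + B * Real.log 2) / Real.log b + B) * Real.log W := fun i => by
    rw [invSqrtNegLaplacian_eq, abs_mul, abs_of_pos hc, mul_assoc]
    gcongr
    refine (integral_inv_smul_partialDeriv_le h hM hL i (hW i) (by linarith) x).trans ?_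
    have e1 : (D + N + B * Real.log 2) ≤ (D + N + B * Real.log 2) / Real.log b * Real.log W := by
      rw [div_mul_eq_mul_div, le_div_iff₀ hlb]
      gcongr
    have e2 : M * (2 * volume.real (Metric.ball (0 : Plane) 1) * (2 * Real.log (W + 1))) =
        B * Real.log (W + 1) := by
      simp only [B, abs_of_nonneg hM0]; ring
    rw [e2]
    change D + (B * Real.log (W + 1) + N) ≤ _
    linarith [mul_le_mul_of_nonneg_left hl hB]
  rw [velocity_eq h]
  refine (norm_toLp_pair_le _ _).trans ?_
  rw [abs_neg]
  have k1 := key 1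
  have k0 := key 0
  have : 0 ≤ Real.log W := hlb.le.trans hlW
  simp only [C]
  nlinarith

/-! ### A priori bounds: maximum principle and conservation of the L² norm. -/

lemma timeIco_of_le {a r t : ℝ} {T : EReal} (ht : t ∈ timeIco a T) (har : a ≤ r) (hrt : r ≤ t) :
    r ∈ timeIco a T :=
  ⟨har, (EReal.coe_le_coe_iff.2 hrt).trans_lt ht.2⟩

lemma timeIco_mem_nhds {a t : ℝ} {T : EReal} (ht : t ∈ timeIco a T) (hat : a < t) :
    timeIco a T ∈ nhds t := by
  have h1 : ∀ᶠ r : ℝ in nhds t, (r : EReal) < T :=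
    continuous_coe_real_ereal.continuousAt.eventually_lt continuousAt_const ht.2
  filter_upwards [lt_mem_nhds hat, h1] with r hr1 hr2 using ⟨hr1.le, hr2⟩

lemma fderiv_eq_sum (f : Plane → ℝ) (x v : Plane) :
    fderiv ℝ f x v = v 0 * partialDeriv 0 f x + v 1 * partialDeriv 1 f x := by
  have h : v = v 0 • basisVec 0 + v 1 • basisVec 1 := by
    ext i; fin_cases i <;> simp
  conv_lhs => rw [h]
  simp [partialDeriv]

lemma integrable_of_abs_le_sq {g : Plane → ℝ} {C : ℝ} (hg : AEStronglyMeasurable g)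
    (h : ∀ x, |g x| ≤ C * ((1 + ‖x‖) ^ 3)⁻¹) : Integrable g :=
  (integrable_inv_one_add_cube.const_mul C).mono' hg (Filter.Eventually.of_forall h)

lemma decay_mul_decay_le {a c K : ℝ} {x : Plane} (ha : |a| ≤ K / (1 + ‖x‖) ^ 2)
    (hc : |c| ≤ K / (1 + ‖x‖) ^ 2) : |a * c| ≤ K ^ 2 * ((1 + ‖x‖) ^ 3)⁻¹ := by
  have hn : 0 ≤ ‖x‖ := norm_nonneg x
  rw [abs_mul]
  calc |a| * |c| ≤ (K / (1 + ‖x‖) ^ 2) * (K / (1 + ‖x‖) ^ 2) := by gcongr; exact (abs_nonneg _).trans ha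
    _ = K ^ 2 * ((1 + ‖x‖) ^ 4)⁻¹ := by field_simp
    _ ≤ _ := by
      gcongr
      · linarith
      · norm_num

/-- A bounded divergence free velocity transports the `L²` mass without loss. -/
lemma integral_mul_transport {f : Plane → ℝ} {K : ℝ} (h : IsDecaying f K) :
    ∫ x, f x * fderiv ℝ f x (velocity f x) = 0 := by
  set B := (2 * Real.pi)⁻¹ * (K * majorantMass)
  have hf : Differentiable ℝ f := h.contDiff.differentiable (by simp)
  have hu : ∀ i, Differentiable ℝ fun x => velocity f x i :=
    differentiable_euclidean.1 (differentiable_velocity h)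
  have hub : ∀ i x, |velocity f x i| ≤ 2 * B := fun i x =>
    (PiLp.norm_apply_le (velocity f x) i).trans (norm_velocity_le h x)
  have hB : 0 ≤ B := by have := h.nonneg; have := majorantMass_nonneg; positivity
  have hK := h.nonneg
  have hsq : ∀ x (i : Fin 2), fderiv ℝ (fun y => f y ^ 2) x (basisVec i) =
      2 * (f x * partialDeriv i f x) := fun x i => by
    have := ((hf x).hasFDerivAt.pow 2).fderiv
    rw [this]
    simp [partialDeriv]
    ring
  have hfc := h.contDiff.continuous
  have hpc : ∀ i, Continuous (partialDeriv i f) := fun i =>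
    (contDiff_partialDeriv h.contDiff i).continuous
  have j1 : ∀ i, Integrable fun x => partialDeriv i (fun y => velocity f y i) x * f x ^ 2 :=
    fun i => integrable_of_abs_le_sq (C := B * K ^ 2)
      ((measurable_fderiv_apply_const ℝ _ _).aestronglyMeasurable.mul
        (hfc.pow 2).aestronglyMeasurable) fun x => by
      rw [abs_mul, mul_assoc, sq (f x)]
      gcongr
      · exact abs_partialDeriv_velocity_le h i i x
      · exact decay_mul_decay_le (h.norm_le x) (h.norm_le x)
  have j2 : ∀ i, Integrable fun x => velocity f x i * (f x * partialDeriv i f x) :=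
    fun i => integrable_of_abs_le_sq (C := (2 * B) * K ^ 2)
      ((hu i).continuous.mul (hfc.mul (hpc i))).aestronglyMeasurable fun x => by
      rw [abs_mul, mul_assoc (2 * B)]
      gcongr
      · exact hub i x
      · exact decay_mul_decay_le (h.norm_le x) (h.norm_partialDeriv_le i x)
  have j3 : ∀ i, Integrable fun x => velocity f x i * f x ^ 2 :=
    fun i => integrable_of_abs_le_sq (C := (2 * B) * K ^ 2)
      ((hu i).continuous.mul (hfc.pow 2)).aestronglyMeasurable fun x => by
      rw [abs_mul, mul_assoc (2 * B), sq (f x)]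
      gcongr
      · exact hub i x
      · exact decay_mul_decay_le (h.norm_le x) (h.norm_le x)
  -- Here f ∂ᵢf is half of ∂ᵢ(f²); after summation over i the right-hand sides combine to the
  -- divergence of the velocity, which vanishes.
  have ibp : ∀ i, 2 * ∫ x, velocity f x i * (f x * partialDeriv i f x) =
      -∫ x, partialDeriv i (fun y => velocity f y i) x * f x ^ 2 := fun i => by
    have := integral_mul_fderiv_eq_neg_fderiv_mul_of_integrable (μ := volume)
      (f := fun x => velocity f x i) (g := fun x => f x ^ 2) (v := basisVec i) (j1 i)
      (by simp only [hsq]; exact ((j2 i).const_mul 2).congr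
            (Filter.Eventually.of_forall fun x => by simp only; ring)) (j3 i)
      (fun x _ => hu i x) (fun x _ => (hf x).pow 2)
    rw [← integral_const_mul]
    refine Eq.trans ?_ this
    congr 1
    ext x
    rw [hsq]; ring
  have hsum : ∫ x, f x * fderiv ℝ f x (velocity f x) =
      (∫ x, velocity f x 0 * (f x * partialDeriv 0 f x)) +
        ∫ x, velocity f x 1 * (f x * partialDeriv 1 f x) := by
    rw [← integral_add (j2 0) (j2 1)]
    congr 1
    ext x
    rw [fderiv_eq_sum]; ring
  have hdiv : (∫ x, partialDeriv 0 (fun y => velocity f y 0) x * f x ^ 2) +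
      ∫ x, partialDeriv 1 (fun y => velocity f y 1) x * f x ^ 2 = 0 := by
    rw [← integral_add (j1 0) (j1 1), ← integral_zero Plane ℝ]
    congr 1
    ext x
    rw [← add_mul, partialDeriv_velocity_add h, zero_mul]
  rw [hsum]
  linarith [ibp 0, ibp 1]

/-- A maximum principle. -/
lemma le_of_deriv_eq_zero_at_critical {g : ℝ → Plane → ℝ} {M K t₁ : ℝ} (ht₁ : 0 ≤ t₁) (hM : 0 ≤ M)
    (hc : ContinuousOn (fun p : ℝ × Plane => g p.1 p.2) (Icc 0 t₁ ×ˢ univ))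
    (hK : ∀ t ∈ Icc 0 t₁, ∀ x, g t x ≤ K / (1 + ‖x‖) ^ 2) (h0 : ∀ x, g 0 x ≤ M)
    (hcrit : ∀ t ∈ Ioc 0 t₁, ∀ x, fderiv ℝ (g t) x = 0 → HasDerivAt (fun r => g r x) 0 t)
    (x₁ : Plane) : g t₁ x₁ ≤ M := by
  by_contra! hlt
  -- Subtracting εt will make the time derivative strictly negative at a critical point; this ε uses
  -- up at most half of the excess over M.
  obtain ⟨ε, hε, hv⟩ : ∃ ε > 0, M < g t₁ x₁ - ε * t₁ := by
    refine ⟨(g t₁ x₁ - M) / (2 * (t₁ + 1)), div_pos (by linarith) (by positivity), ?_⟩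
    have : (g t₁ x₁ - M) / (2 * (t₁ + 1)) * t₁ ≤ (g t₁ x₁ - M) / 2 := by
      rw [div_mul_eq_mul_div, div_le_div_iff₀ (by positivity) (by norm_num)]
      nlinarith
    linarith
  set v := g t₁ x₁ - ε * t₁
  have hv0 : 0 < v := hM.trans_lt hv
  -- Beyond this radius the decay keeps g below v, so a maximum over the compact cylinder is also a
  -- maximum over all of space at its time.
  set R := max ‖x₁‖ (|K| / v)
  have hR0 : 0 ≤ R := (norm_nonneg _).trans (le_max_left _ _)
  have hout : ∀ t ∈ Icc 0 t₁, ∀ x : Plane, R ≤ ‖x‖ → g t x < v := fun t ht x hx => by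
    refine (hK t ht x).trans_lt ?_
    rw [div_lt_iff₀ (by positivity)]
    have h1 : |K| / v ≤ ‖x‖ := (le_max_right _ _).trans hx
    rw [div_le_iff₀ hv0] at h1
    have h2 := le_abs_self K
    nlinarith [norm_nonneg x, mul_nonneg (norm_nonneg x) (norm_nonneg x)]
  set S := Icc 0 t₁ ×ˢ Metric.closedBall (0 : Plane) R
  have hS : IsCompact S := isCompact_Icc.prod (isCompact_closedBall _ _)
  have hmem : (t₁, x₁) ∈ S :=
    ⟨⟨ht₁, le_rfl⟩, mem_closedBall_zero_iff.2 (le_max_left _ _)⟩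
  have hcont : ContinuousOn (fun p : ℝ × Plane => g p.1 p.2 - ε * p.1) S :=
    (hc.mono (prod_mono le_rfl (subset_univ _))).sub (by fun_prop)
  obtain ⟨⟨t, x⟩, ⟨ht, hx⟩, hmax⟩ := hS.exists_isMaxOn ⟨_, hmem⟩ hcont
  have hge : v ≤ g t x - ε * t := hmax hmem
  have hpos : 0 < t := by
    rcases ht.1.eq_or_lt with h | h
    · simp only at h
      subst h
      have := h0 x
      simp only [mul_zero, sub_zero] at hge
      linarith
    · exact h
  have hglob : ∀ y, g t y ≤ g t x := fun y => by
    by_cases hy : ‖y‖ ≤ R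
    · have := hmax (show (t, y) ∈ S from ⟨ht, mem_closedBall_zero_iff.2 hy⟩)
      simp only [mem_ofPred_eq] at this
      linarith
    · have h1 := hout t ht y (not_le.1 hy).le
      have : 0 ≤ ε * t := by positivity
      linarith
  have hder := hcrit t ⟨hpos, ht.2⟩ x
    (IsLocalMax.fderiv_eq_zero (Filter.Eventually.of_forall hglob))
  have hder2 : HasDerivAt (fun r => g r x - ε * r) (0 - ε * 1) t :=
    hder.sub ((hasDerivAt_id t).const_mul ε)
  have hsl := (hasDerivWithinAt_iff_tendsto_slope' (notMem_Iio.2 le_rfl)).1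
    (hder2.hasDerivWithinAt (s := Iio t))
  -- Difference quotients from the left are nonnegative at a maximum, while the derivative is −ε.
  -- Only the left side is available, since the maximum may occur at the final time.
  have hnn : (0 : ℝ) ≤ 0 - ε * 1 := by
    refine ge_of_tendsto hsl ?_
    filter_upwards [Ioo_mem_nhdsLT hpos] with r hr
    have h1 := hmax (show (r, x) ∈ S from ⟨⟨hr.1.le, hr.2.le.trans ht.2⟩, hx⟩)
    simp only [mem_ofPred_eq] at h1
    rw [slope_def_field]
    exact div_nonneg_of_nonpos (by linarith) (by linarith [hr.2])
  linarith

namespace IsSolution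

variable {T : EReal} {θ : ℝ → Plane → ℝ}

lemma contDiff_space (hs : IsSolution T θ) {t : ℝ} (ht : t ∈ timeIco 0 T) :
    ContDiff ℝ ∞ (θ t) := by
  rw [← contDiffOn_univ]
  exact hs.smooth.comp (f := fun x : Plane => (t, x)) (by fun_prop) fun x _ => ⟨ht, mem_univ _⟩

lemma exists_isDecaying (hs : IsSolution T θ) {t : ℝ} (ht : t ∈ timeIco 0 T) :
    ∃ K, ∀ r ∈ Icc 0 t, IsDecaying (θ r) K := by
  obtain ⟨K, hK⟩ := hs.decay t ht
  exact ⟨K, fun r hr => ⟨hs.contDiff_space (timeIco_of_le ht hr.1 hr.2),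
    fun k hk x => hK r hr k hk x⟩⟩

lemma isDecaying (hs : IsSolution T θ) {t : ℝ} (ht : t ∈ timeIco 0 T) :
    ∃ K, IsDecaying (θ t) K := by
  obtain ⟨K, hK⟩ := hs.exists_isDecaying ht
  exact ⟨K, hK t ⟨ht.1, le_rfl⟩⟩

lemma contDiffAt (hs : IsSolution T θ) {t : ℝ} (ht : t ∈ timeIco 0 T) (h0 : 0 < t) (x : Plane) :
    ContDiffAt ℝ ∞ (fun p : ℝ × Plane => θ p.1 p.2) (t, x) :=
  hs.smooth.contDiffAt (prod_mem_nhds (timeIco_mem_nhds ht h0) Filter.univ_mem)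

lemma hasDerivAt_time (hs : IsSolution T θ) {t : ℝ} (ht : t ∈ timeIco 0 T) (h0 : 0 < t)
    (x : Plane) :
    HasDerivAt (fun r => θ r x) (-fderiv ℝ (θ t) x (velocity (θ t) x)) t := by
  have h1 : DifferentiableAt ℝ (fun r => θ r x) t :=
    ((hs.contDiffAt ht h0 x).differentiableAt (by simp)).comp t
      (f := fun r : ℝ => (r, x)) (by fun_prop)
  have h2 := hs.transport t ht x
  rw [derivWithin_of_mem_nhds (timeIco_mem_nhds ht h0)] at h2
  rw [← eq_neg_of_add_eq_zero_left h2]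
  exact h1.hasDerivAt

lemma continuousOn_uncurry (hs : IsSolution T θ) {t : ℝ} (ht : t ∈ timeIco 0 T) :
    ContinuousOn (fun p : ℝ × Plane => θ p.1 p.2) (Icc 0 t ×ˢ univ) :=
  hs.smooth.continuousOn.mono
    (prod_mono (fun _ hr => timeIco_of_le ht hr.1 hr.2) le_rfl)

/-- The sup norm does not grow. -/
lemma abs_le_of_initial (hs : IsSolution T θ) {M : ℝ} (hM : ∀ x, |θ 0 x| ≤ M) {t : ℝ}
    (ht : t ∈ timeIco 0 T) (x : Plane) : |θ t x| ≤ M := by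
  have hM0 : 0 ≤ M := (abs_nonneg _).trans (hM 0)
  obtain ⟨K, hK⟩ := hs.exists_isDecaying ht
  have hc := hs.continuousOn_uncurry ht
  have hz : ∀ r ∈ Ioc 0 t, ∀ x, fderiv ℝ (θ r) x = 0 → HasDerivAt (fun r => θ r x) 0 r :=
    fun r hr x hx => by
      simpa [hx] using hs.hasDerivAt_time (timeIco_of_le ht hr.1.le hr.2) hr.1 x
  refine abs_le.2 ⟨?_, ?_⟩
  · have := le_of_deriv_eq_zero_at_critical (g := fun t x => -θ t x) (K := K) ht.1 hM0 hc.neg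
      (fun r hr x => (neg_le_abs _).trans ((hK r hr).norm_le x))
      (fun x => (neg_le_abs _).trans (hM x))
      (fun r hr x hx => by
        rw [fderiv_fun_neg, neg_eq_zero] at hx
        exact (hz r hr x hx).fun_neg.congr_deriv neg_zero) x
    linarith
  · exact le_of_deriv_eq_zero_at_critical (K := K) ht.1 hM0 hc
      (fun r hr x => (le_abs_self _).trans ((hK r hr).norm_le x))
      (fun x => (le_abs_self _).trans (hM x)) hz x

/-- Conservation of the `L²` norm. -/
lemma integral_sq_eq (hs : IsSolution T θ) {t : ℝ} (ht : t ∈ timeIco 0 T) :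
    ∫ x, θ t x ^ 2 = ∫ x, θ 0 x ^ 2 := by
  rcases ht.1.eq_or_lt with h | h0
  · rw [← h]
  obtain ⟨K, hK⟩ := hs.exists_isDecaying ht
  have hK0 : 0 ≤ K := (hK t ⟨ht.1, le_rfl⟩).nonneg
  set U := 2 * ((2 * Real.pi)⁻¹ * (K * majorantMass))
  have hU : 0 ≤ U := by have := majorantMass_nonneg; positivity
  have hint := integrable_inv_one_add_cube
  have hcont : ContinuousOn (fun r => ∫ x, θ r x ^ 2) (Icc 0 t) := by
    refine continuousOn_of_dominated (bound := fun x : Plane => K ^ 2 * ((1 + ‖x‖) ^ 3)⁻¹)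
      (fun r hr => ((hK r hr).contDiff.continuous.pow 2).aestronglyMeasurable)
      (fun r hr => Filter.Eventually.of_forall fun x => ?_) (hint.const_mul _)
      (Filter.Eventually.of_forall fun x => ?_)
    · rw [Real.norm_of_nonneg (sq_nonneg _)]; exact (hK r hr).sq_le x
    · exact (((hs.continuousOn_uncurry ht).comp (f := fun r : ℝ => (r, x)) (by fun_prop)
        fun r hr => ⟨hr, mem_univ _⟩).pow 2)
  have hder : ∀ r ∈ Ioo 0 t, HasDerivAt (fun r => ∫ x, θ r x ^ 2) 0 r := fun r hr => by
    have hd := hasDerivAt_integral_of_dominated_loc_of_deriv_le (μ := (volume : Measure Plane))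
      (F := fun r x => θ r x ^ 2)
      (F' := fun r x => -2 * (θ r x * fderiv ℝ (θ r) x (velocity (θ r) x)))
      (bound := fun x : Plane => 2 * (U * (K ^ 2 * ((1 + ‖x‖) ^ 3)⁻¹))) (s := Ioo 0 t) (x₀ := r)
      (Ioo_mem_nhds hr.1 hr.2)
      (by filter_upwards [Icc_mem_nhds hr.1 hr.2] with s hs'
          exact ((hK s hs').contDiff.continuous.pow 2).aestronglyMeasurable)
      (hK r ⟨hr.1.le, hr.2.le⟩).integrable_sq ?_ ?_
      ((hint.const_mul _).const_mul _ |>.const_mul _) ?_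
    · have := hd.2
      rwa [integral_const_mul, integral_mul_transport (hK r ⟨hr.1.le, hr.2.le⟩), mul_zero] at this
    · have hk := hK r ⟨hr.1.le, hr.2.le⟩
      have h1 : Continuous (fderiv ℝ (θ r)) := hk.contDiff.continuous_fderiv (by simp)
      have h2 : Continuous (velocity (θ r)) := (differentiable_velocity hk).continuous
      exact (continuous_const.mul (hk.contDiff.continuous.mul
        (h1.clm_apply h2))).aestronglyMeasurable
    · refine Filter.Eventually.of_forall fun x s hs' => ?_
      have hk := hK s ⟨hs'.1.le, hs'.2.le⟩
      have h1 := decay_mul_decay_le (c := ‖fderiv ℝ (θ s) x‖) (hk.norm_le x)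
        (by rw [abs_norm]; exact hk.norm_fderiv_le x)
      rw [abs_mul, abs_norm] at h1
      have h2 : |fderiv ℝ (θ s) x (velocity (θ s) x)| ≤ ‖fderiv ℝ (θ s) x‖ * U :=
        ((fderiv ℝ (θ s) x).le_opNorm _).trans (by gcongr; exact norm_velocity_le hk x)
      rw [norm_mul, norm_mul, norm_neg, Real.norm_ofNat, Real.norm_eq_abs, Real.norm_eq_abs]
      calc 2 * (|θ s x| * |fderiv ℝ (θ s) x (velocity (θ s) x)|)
          ≤ 2 * (|θ s x| * (‖fderiv ℝ (θ s) x‖ * U)) := by gcongr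
        _ = 2 * (U * (|θ s x| * ‖fderiv ℝ (θ s) x‖)) := by ring
        _ ≤ _ := by gcongr
    · refine Filter.Eventually.of_forall fun x s hs' => ?_
      have := (hs.hasDerivAt_time (timeIco_of_le ht hs'.1.le hs'.2.le) hs'.1 x).pow 2
      refine this.congr_deriv ?_
      push_cast
      ring
  -- The mean value theorem needs the vanishing derivative only at interior times, with continuity
  -- up to time 0.
  obtain ⟨c, hc, hc2⟩ := exists_hasDerivAt_eq_slope (fun r => ∫ x, θ r x ^ 2) (fun _ => 0) h0
    hcont hder
  rw [eq_comm, div_eq_zero_iff] at hc2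
  rcases hc2 with h | h <;> linarith

lemma integral_sq_le (hs : IsSolution T θ) {M : ℝ} (hM : 0 ≤ M)
    (hL : eLpNorm (θ 0) 2 volume ≤ ENNReal.ofReal M) {t : ℝ} (ht : t ∈ timeIco 0 T) :
    ∫ x, θ t x ^ 2 ≤ M ^ 2 := by
  have h0 : (0 : ℝ) ∈ timeIco 0 T := timeIco_of_le ht le_rfl ht.1
  obtain ⟨K, hK⟩ := hs.isDecaying h0
  rw [hs.integral_sq_eq ht]
  have hmem : MemLp (θ 0) 2 volume :=
    (memLp_two_iff_integrable_sq hK.contDiff.continuous.aestronglyMeasurable).2 hK.integrable_sq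
  rw [hmem.eLpNorm_eq_integral_rpow_norm (by simp) (by simp)] at hL
  simp only [ENNReal.toReal_ofNat, Real.rpow_ofNat, Real.norm_eq_abs, sq_abs] at hL
  rw [ENNReal.ofReal_le_ofReal_iff hM] at hL
  have hn : 0 ≤ ∫ x, θ 0 x ^ 2 := integral_nonneg fun x => sq_nonneg _
  calc ∫ x, θ 0 x ^ 2 = ((∫ x, θ 0 x ^ 2) ^ (2 : ℝ)⁻¹) ^ 2 := by
        rw [← Real.rpow_natCast, ← Real.rpow_mul hn]; simp
    _ ≤ M ^ 2 := by gcongr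

end IsSolution

/-! ### The perpendicular gradient and the velocity bound along a solution. -/

lemma norm_gradPerp_sq (f : Plane → ℝ) (x : Plane) :
    ‖gradPerp f x‖ ^ 2 = partialDeriv 0 f x ^ 2 + partialDeriv 1 f x ^ 2 := by
  rw [EuclideanSpace.norm_sq_eq, Fin.sum_univ_two]
  simp [gradPerp]
  ring

lemma abs_partialDeriv_le_norm_gradPerp (i : Fin 2) (f : Plane → ℝ) (x : Plane) :
    |partialDeriv i f x| ≤ ‖gradPerp f x‖ := by
  apply abs_le_of_sq_le_sq _ (norm_nonneg _)
  rw [norm_gradPerp_sq]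
  fin_cases i <;> simp [sq_nonneg]

lemma bddAbove_norm_gradPerp {f : Plane → ℝ} {K : ℝ} (h : IsDecaying f K) :
    BddAbove (range fun x => ‖gradPerp f x‖) := by
  refine ⟨2 * K, ?_⟩
  rintro _ ⟨x, rfl⟩
  have hk : ∀ i, |partialDeriv i f x| ≤ K := fun i => (h.norm_partialDeriv_le i x).trans
    (div_le_self h.nonneg (by nlinarith [norm_nonneg x]))
  refine (norm_toLp_pair_le _ _).trans ?_
  rw [abs_neg]
  linarith [hk 0, hk 1]

lemma norm_gradPerp_le_max {f : Plane → ℝ} {K : ℝ} (h : IsDecaying f K) (x : Plane) :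
    ‖gradPerp f x‖ ≤ maxGradPerp f :=
  le_ciSup (bddAbove_norm_gradPerp h) x

/-- The velocity bound along a solution. -/
theorem exists_velocity_le_log_maxGradPerp (M b : ℝ) (hb : 1 < b) :
    ∃ C : ℝ, 0 < C ∧ ∀ (T : EReal) (θ : ℝ → Plane → ℝ), IsSolution T θ →
      (∀ x, |θ 0 x| ≤ M) → eLpNorm (θ 0) 2 volume ≤ ENNReal.ofReal M →
      ∀ t ∈ timeIco 0 T, b ≤ maxGradPerp (θ t) →
        ∀ x, ‖velocity (θ t) x‖ ≤ C * Real.log (maxGradPerp (θ t)) := by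
  obtain ⟨C, hC, h⟩ := exists_norm_velocity_le_log M b hb
  refine ⟨C, hC, fun T θ hs hM hL t ht hbt => ?_⟩
  obtain ⟨K, hK⟩ := hs.isDecaying ht
  exact h (θ t) K _ hK (hs.abs_le_of_initial hM ht)
    (hs.integral_sq_le ((abs_nonneg _).trans (hM 0)) hL ht)
    (fun i x => (abs_partialDeriv_le_norm_gradPerp i _ x).trans (norm_gradPerp_le_max hK x)) hbt

/-! ### Geometry of level sets and evolution of the gradient. -/

lemma convex_timeIco (a : ℝ) (T : EReal) : Convex ℝ (timeIco a T) := by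
  have : OrdConnected (timeIco a T) :=
    ⟨fun _ hx _ hy _ hz => timeIco_of_le hy (hx.1.trans hz.1) hz.2⟩
  exact this.convex

lemma exists_gt_mem_timeIco {a t : ℝ} {T : EReal} (ht : t ∈ timeIco a T) :
    ∃ t' ∈ timeIco a T, t < t' := by
  obtain ⟨c, h1, h2⟩ := EReal.exists_rat_btwn_of_lt ht.2
  have h1' : t < (c : ℝ) := EReal.coe_lt_coe_iff.1 h1
  exact ⟨c, ⟨ht.1.trans h1'.le, h2⟩, h1'⟩

lemma uniqueDiffOn_timeIco (a : ℝ) (T : EReal) : UniqueDiffOn ℝ (timeIco a T) := by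
  intro t ht
  obtain ⟨t', ht', hlt⟩ := exists_gt_mem_timeIco ht
  refine uniqueDiffOn_convex (convex_timeIco a T) ⟨(t + t') / 2, ?_⟩ t ht
  rw [mem_interior]
  exact ⟨Ioo t t', fun r hr => timeIco_of_le ht' (ht.1.trans hr.1.le) hr.2.le, isOpen_Ioo,
    ⟨by linarith, by linarith⟩⟩

/-- In the plane the kernel of a nonzero differential is a line, and ξ spans it. -/
lemma eq_inner_smul_unitTangent {f : Plane → ℝ} {x v : Plane} (hne : gradPerp f x ≠ 0)
    (hv : fderiv ℝ f x v = 0) : v = inner ℝ v (unitTangent f x) • unitTangent f x := by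
  have hw : ‖gradPerp f x‖ ≠ 0 := norm_ne_zero_iff.2 hne
  have hsq := norm_gradPerp_sq f x
  rw [fderiv_eq_sum] at hv
  have hi : inner ℝ v (unitTangent f x) =
      ‖gradPerp f x‖⁻¹ * (v 1 * partialDeriv 0 f x - v 0 * partialDeriv 1 f x) := by
    rw [PiLp.inner_apply, Fin.sum_univ_two]
    simp [unitTangent, gradPerp]
    ring
  rw [hi]
  ext i
  set w := ‖gradPerp f x‖
  set p := partialDeriv 0 f x
  set q := partialDeriv 1 f x
  fin_cases i
  · have e : (unitTangent f x) 0 = w⁻¹ * -q := rfl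
    simp only [Fin.zero_eta, PiLp.smul_apply, smul_eq_mul, e]
    field_simp
    linear_combination (v 0) * hsq + p * hv
  · have e : (unitTangent f x) 1 = w⁻¹ * p := rfl
    simp only [Fin.mk_one, PiLp.smul_apply, smul_eq_mul, e]
    field_simp
    linear_combination (v 1) * hsq + q * hv

lemma norm_unitTangent {f : Plane → ℝ} {x : Plane} (hne : gradPerp f x ≠ 0) :
    ‖unitTangent f x‖ = 1 := by
  rw [unitTangent, norm_smul, norm_inv, norm_norm, inv_mul_cancel₀ (norm_ne_zero_iff.2 hne)]

lemma contDiff_gradPerp {f : Plane → ℝ} (hf : ContDiff ℝ ∞ f) : ContDiff ℝ ∞ (gradPerp f) := by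
  rw [contDiff_euclidean]
  intro i
  fin_cases i
  · exact (contDiff_partialDeriv hf 1).neg
  · exact contDiff_partialDeriv hf 0

lemma contDiffAt_unitTangent {f : Plane → ℝ} (hf : ContDiff ℝ ∞ f) {x : Plane}
    (hne : gradPerp f x ≠ 0) : ContDiffAt ℝ ∞ (unitTangent f) x :=
  have h := (contDiff_gradPerp hf).contDiffAt (x := x)
  ((h.norm ℝ hne).inv (norm_ne_zero_iff.2 hne)).smul h

/-- Along the tangent direction, the logarithmic derivative of `|∇^⊥ f|` is minus the divergence
of the tangent field. -/
lemma fderiv_norm_gradPerp_unitTangent {f : Plane → ℝ} (hf : ContDiff ℝ ∞ f) {x : Plane}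
    (hne : gradPerp f x ≠ 0) :
    fderiv ℝ (fun y => ‖gradPerp f y‖) x (unitTangent f x) =
      -(‖gradPerp f x‖ * divTangent f x) := by
  have hw : ‖gradPerp f x‖ ≠ 0 := norm_ne_zero_iff.2 hne
  have hG : DifferentiableAt ℝ (gradPerp f) x := (contDiff_gradPerp hf).differentiable (by simp) x
  have hN : DifferentiableAt ℝ (fun y => ‖gradPerp f y‖) x := hG.norm ℝ hne
  have hU : DifferentiableAt ℝ (unitTangent f) x :=
    (contDiffAt_unitTangent hf hne).differentiableAt (by simp)
  -- The field |∇^⊥f| ξ is divergence free because mixed partial derivatives commute; the product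
  -- rule for its divergence is the claim.
  have hev : gradPerp f =ᶠ[nhds x] fun y => ‖gradPerp f y‖ • unitTangent f y := by
    filter_upwards [hG.continuousAt.eventually_ne hne] with y hy
    rw [unitTangent, smul_inv_smul₀ (norm_ne_zero_iff.2 hy)]
  have hder : ∀ i : Fin 2, fderiv ℝ (gradPerp f) x (basisVec i) i =
      ‖gradPerp f x‖ * fderiv ℝ (unitTangent f) x (basisVec i) i +
        fderiv ℝ (fun y => ‖gradPerp f y‖) x (basisVec i) * unitTangent f x i := fun i => by
    rw [hev.fderiv_eq, fderiv_fun_smul hN hU]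
    simp
  have htr : fderiv ℝ (gradPerp f) x (basisVec 0) 0 + fderiv ℝ (gradPerp f) x (basisVec 1) 1 = 0 := by
    rw [← fderiv_coord hG, ← fderiv_coord hG]
    have e0 : (fun y => gradPerp f y 0) = fun y => -partialDeriv 1 f y := rfl
    have e1 : (fun y => gradPerp f y 1) = partialDeriv 0 f := rfl
    have hc := partialDeriv_comm hf 0 1 x
    rw [partialDeriv_def, partialDeriv_def] at hc
    rw [e0, e1, fderiv_fun_neg, neg_apply, hc]
    ring
  rw [fderiv_eq_sum, divTangent, Fin.sum_univ_two, partialDeriv_def, partialDeriv_def]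
  linear_combination htr - hder 0 - hder 1

namespace IsSolution

variable {T : EReal} {θ : ℝ → Plane → ℝ}

/-- Reading the space derivative off the derivative within the space-time slab transfers the joint
smoothness of `θ`, including the initial time, to its partial derivatives. -/
lemma partialDeriv_eq (hs : IsSolution T θ) {t : ℝ} (ht : t ∈ timeIco 0 T) (i : Fin 2)
    (x : Plane) : partialDeriv i (θ t) x =
      fderivWithin ℝ (fun p : ℝ × Plane => θ p.1 p.2) (timeIco 0 T ×ˢ univ) (t, x)
        (0, basisVec i) := by
  have h1 := (hs.smooth.differentiableOn (by simp) (t, x) ⟨ht, mem_univ _⟩).hasFDerivWithinAt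
  have h2 : HasFDerivAt (fun y : Plane => (t, y)) (ContinuousLinearMap.inr ℝ ℝ Plane) x :=
    hasFDerivAt_prodMk_right t x
  have h3 := h1.comp x (h2.hasFDerivWithinAt (s := univ)) (fun y _ => ⟨ht, mem_univ _⟩)
  have h4 : HasFDerivAt (θ t) _ x := hasFDerivWithinAt_univ.1 h3
  rw [partialDeriv, h4.fderiv]
  simp

lemma contDiffOn_partialDeriv (hs : IsSolution T θ) (i : Fin 2) :
    ContDiffOn ℝ ∞ (fun p : ℝ × Plane => partialDeriv i (θ p.1) p.2) (timeIco 0 T ×ˢ univ) := by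
  have hu : UniqueDiffOn ℝ (timeIco 0 T ×ˢ (univ : Set Plane)) :=
    (uniqueDiffOn_timeIco 0 T).prod uniqueDiffOn_univ
  refine ContDiffOn.congr ((hs.smooth.fderivWithin hu (m := ∞) (by simp)).clm_apply
    contDiffOn_const) fun p hp => hs.partialDeriv_eq hp.1 i p.2

lemma contDiffOn_gradPerp (hs : IsSolution T θ) :
    ContDiffOn ℝ ∞ (fun p : ℝ × Plane => gradPerp (θ p.1) p.2) (timeIco 0 T ×ˢ univ) := by
  rw [contDiffOn_euclidean]
  intro i
  fin_cases i
  · exact (hs.contDiffOn_partialDeriv 1).neg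
  · exact hs.contDiffOn_partialDeriv 0

/-- This is the transport equation differentiated in xᵢ. At positive times (t, x) is an interior
point, so symmetry of the second space-time derivative exchanges ∂ₜ and ∂ᵢ. -/
lemma hasDerivAt_partialDeriv (hs : IsSolution T θ) {t : ℝ} (ht : t ∈ timeIco 0 T) (h0 : 0 < t)
    (i : Fin 2) (x : Plane) :
    HasDerivAt (fun r => partialDeriv i (θ r) x)
      (-(fderiv ℝ (partialDeriv i (θ t)) x (velocity (θ t) x) +
        fderiv ℝ (θ t) x (fderiv ℝ (velocity (θ t)) x (basisVec i)))) t := by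
  obtain ⟨K, hK⟩ := hs.isDecaying ht
  set Θ : ℝ × Plane → ℝ := fun p => θ p.1 p.2
  have hsm := hs.contDiffAt ht h0
  have hF : DifferentiableAt ℝ (fderiv ℝ Θ) (t, x) :=
    ((hsm x).fderiv_right (m := ∞) (by simp)).differentiableAt (by simp)
  have hsym : IsSymmSndFDerivAt ℝ Θ (t, x) := (hsm x).isSymmSndFDerivAt
    (by rw [minSmoothness_of_isRCLikeNormedField]; exact WithTop.coe_le_coe.2 (le_top : (2 : ℕ∞) ≤ ⊤))
  have h1 : HasDerivAt (fun r => fderiv ℝ Θ (r, x) (0, basisVec i))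
      (fderiv ℝ (fderiv ℝ Θ) (t, x) (1, 0) (0, basisVec i)) t := by
    have h := hF.hasFDerivAt.clm_apply (hasFDerivAt_const ((0 : ℝ), basisVec i) (t, x))
    have h' := h.comp_hasDerivAt t ((hasDerivAt_id t).prodMk (hasDerivAt_const t x))
    refine HasDerivAt.congr_deriv (f := fun r => fderiv ℝ Θ (r, x) (0, basisVec i)) h' ?_
    simp
  have h2 : (fun r => partialDeriv i (θ r) x) =ᶠ[nhds t]
      fun r => fderiv ℝ Θ (r, x) (0, basisVec i) := by
    filter_upwards [timeIco_mem_nhds ht h0, lt_mem_nhds h0] with r hr hr0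
    rw [hs.partialDeriv_eq hr, fderivWithin_of_mem_nhds]
    exact prod_mem_nhds (timeIco_mem_nhds hr hr0) Filter.univ_mem
  have h3 : HasFDerivAt (fun y => fderiv ℝ Θ (t, y) (1, 0)) _ x :=
    (hF.hasFDerivAt.clm_apply (hasFDerivAt_const ((1 : ℝ), (0 : Plane)) (t, x))).comp x
      (hasFDerivAt_prodMk_right t x)
  have h4 : (fun y => fderiv ℝ Θ (t, y) (1, 0)) =
      fun y => -fderiv ℝ (θ t) y (velocity (θ t) y) := by
    ext y
    have h5 := ((hsm y).differentiableAt (by simp)).hasFDerivAt.comp_hasDerivAt t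
      ((hasDerivAt_id t).prodMk (hasDerivAt_const t y))
    exact h5.unique (hs.hasDerivAt_time ht h0 y)
  rw [h4] at h3
  have hd : DifferentiableAt ℝ (fderiv ℝ (θ t)) x :=
    (hK.contDiff.fderiv_right (m := ∞) (by simp)).differentiable (by simp) x
  have h6 := (hd.hasFDerivAt.clm_apply (differentiable_velocity hK x).hasFDerivAt).neg
  have h7 := DFunLike.congr_fun (h3.unique h6) (basisVec i)
  refine (h1.congr_of_eventuallyEq h2).congr_deriv ?_
  rw [hsym.eq]
  simp at h7
  rw [h7, fderiv_partialDeriv hK.contDiff]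
  have hsym2 : IsSymmSndFDerivAt ℝ (θ t) x := hK.contDiff.contDiffAt.isSymmSndFDerivAt
    (by rw [minSmoothness_of_isRCLikeNormedField]; exact WithTop.coe_le_coe.2 (le_top : (2 : ℕ∞) ≤ ⊤))
  rw [hsym2.eq]
  ring

end IsSolution

/-! ### Calculus for C¹ maps on a rectangle. -/

/-- The rectangle `[a, b] × [0, 1]`. -/
def strip (a b : ℝ) : Set (ℝ × ℝ) := Icc a b ×ˢ Icc 0 1

lemma isCompact_strip (a b : ℝ) : IsCompact (strip a b) := isCompact_Icc.prod isCompact_Icc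

lemma uniqueDiffOn_strip {a b : ℝ} (hab : a < b) : UniqueDiffOn ℝ (strip a b) :=
  (uniqueDiffOn_Icc hab).prod (uniqueDiffOn_Icc one_pos)

lemma continuousOn_slice {E : Type*} [TopologicalSpace E] {g : ℝ × ℝ → E} {a b : ℝ}
    (hg : ContinuousOn g (strip a b)) {t : ℝ} (ht : t ∈ Icc a b) :
    ContinuousOn (fun r => g (t, r)) (Icc 0 1) :=
  hg.comp (f := fun r : ℝ => (t, r)) (by fun_prop) fun _ hr => ⟨ht, hr⟩

section Strip

variable {E : Type*} [NormedAddCommGroup E] [NormedSpace ℝ E] {g : ℝ × ℝ → E} {a b : ℝ}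

/-- The derivative with respect to the first variable, on `strip a b`. -/
noncomputable def timeDeriv (a b : ℝ) (g : ℝ × ℝ → E) (p : ℝ × ℝ) : E :=
  fderivWithin ℝ g (strip a b) p (1, 0)

/-- The derivative with respect to the second variable, on `strip a b`. -/
noncomputable def paramDeriv (a b : ℝ) (g : ℝ × ℝ → E) (p : ℝ × ℝ) : E :=
  fderivWithin ℝ g (strip a b) p (0, 1)

lemma continuousOn_timeDeriv (hab : a < b) (hg : ContDiffOn ℝ 1 g (strip a b)) :
    ContinuousOn (timeDeriv a b g) (strip a b) :=
  (hg.continuousOn_fderivWithin (uniqueDiffOn_strip hab) le_rfl).clm_apply continuousOn_const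

lemma continuousOn_paramDeriv (hab : a < b) (hg : ContDiffOn ℝ 1 g (strip a b)) :
    ContinuousOn (paramDeriv a b g) (strip a b) :=
  (hg.continuousOn_fderivWithin (uniqueDiffOn_strip hab) le_rfl).clm_apply continuousOn_const

lemma hasDerivAt_timeDeriv (hg : ContDiffOn ℝ 1 g (strip a b)) {t r : ℝ} (ht : t ∈ Ioo a b)
    (hr : r ∈ Icc (0 : ℝ) 1) :
    HasDerivAt (fun s => g (s, r)) (timeDeriv a b g (t, r)) t := by
  have hm : (t, r) ∈ strip a b := ⟨Ioo_subset_Icc_self ht, hr⟩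
  have h1 := (hg.differentiableOn one_ne_zero _ hm).hasFDerivWithinAt
  have h2 : HasDerivWithinAt (fun s : ℝ => (s, r)) ((1 : ℝ), (0 : ℝ)) (Icc a b) t :=
    ((hasDerivAt_id t).prodMk (hasDerivAt_const t r)).hasDerivWithinAt
  have h3 : MapsTo (fun s : ℝ => (s, r)) (Icc a b) (strip a b) := fun s hs => ⟨hs, hr⟩
  exact (h1.comp_hasDerivWithinAt t h2 h3).hasDerivAt (Icc_mem_nhds ht.1 ht.2)

lemma hasDerivWithinAt_paramDeriv (hg : ContDiffOn ℝ 1 g (strip a b)) {t r : ℝ}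
    (ht : t ∈ Icc a b) (hr : r ∈ Icc (0 : ℝ) 1) :
    HasDerivWithinAt (fun s => g (t, s)) (paramDeriv a b g (t, r)) (Icc 0 1) r := by
  have hm : (t, r) ∈ strip a b := ⟨ht, hr⟩
  have h1 := (hg.differentiableOn one_ne_zero _ hm).hasFDerivWithinAt
  have h2 : HasDerivWithinAt (fun s : ℝ => (t, s)) ((0 : ℝ), (1 : ℝ)) (Icc 0 1) r :=
    ((hasDerivAt_const r t).prodMk (hasDerivAt_id r)).hasDerivWithinAt
  have h3 : MapsTo (fun s : ℝ => (t, s)) (Icc 0 1) (strip a b) := fun s hs => ⟨ht, hs⟩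
  exact h1.comp_hasDerivWithinAt r h2 h3

lemma hasDerivAt_integral_strip (hab : a < b) (hg : ContDiffOn ℝ 1 g (strip a b))
    {t ρ : ℝ} (ht : t ∈ Ioo a b) (hρ : ρ ∈ Icc (0 : ℝ) 1) :
    HasDerivAt (fun s => ∫ r in (0 : ℝ)..ρ, g (s, r))
      (∫ r in (0 : ℝ)..ρ, timeDeriv a b g (t, r)) t := by
  have hc := continuousOn_timeDeriv hab hg
  obtain ⟨C, hC⟩ := (isCompact_strip a b).exists_bound_of_continuousOn hc
  have hsub : Icc 0 ρ ⊆ Icc (0 : ℝ) 1 := Icc_subset_Icc_right hρ.2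
  have hii : ∀ {h : ℝ × ℝ → E}, ContinuousOn h (strip a b) → ∀ s ∈ Icc a b,
      IntervalIntegrable (fun r => h (s, r)) volume 0 ρ := fun hh s hs =>
    ((continuousOn_slice hh hs).mono (by rwa [uIcc_of_le hρ.1])).intervalIntegrable
  have hio : uIoc 0 ρ ⊆ Icc (0 : ℝ) 1 := by
    rw [uIoc_of_le hρ.1]; exact Ioc_subset_Icc_self.trans hsub
  refine (intervalIntegral.hasDerivAt_integral_of_dominated_loc_of_deriv_le
    (F' := fun s r => timeDeriv a b g (s, r)) (bound := fun _ => C) (s := Ioo a b)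
    (Ioo_mem_nhds ht.1 ht.2) ?_ (hii hg.continuousOn t (Ioo_subset_Icc_self ht))
    (hii hc t (Ioo_subset_Icc_self ht)).aestronglyMeasurable_restrict_uIoc ?_ (by simp) ?_).2
  · filter_upwards [Icc_mem_nhds ht.1 ht.2] with s hs
    exact (hii hg.continuousOn s hs).aestronglyMeasurable_restrict_uIoc
  · exact Filter.Eventually.of_forall fun r hr s hs =>
      hC (s, r) ⟨Ioo_subset_Icc_self hs, hio hr⟩
  · exact Filter.Eventually.of_forall fun r hr s hs => hasDerivAt_timeDeriv hg hs (hio hr)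

/-- If `∂_r g` is again continuously differentiable, then `∂_t g` is differentiable in `r` and
the mixed derivatives agree. -/
lemma hasDerivAt_timeDeriv_param [CompleteSpace E] (hab : a < b)
    (hg : ContDiffOn ℝ 1 g (strip a b))
    {h : ℝ × ℝ → E} (hh : ContDiffOn ℝ 1 h (strip a b))
    (heq : ∀ p ∈ strip a b, paramDeriv a b g p = h p) {t r : ℝ} (ht : t ∈ Ioo a b)
    (hr : r ∈ Ioo (0 : ℝ) 1) :
    HasDerivAt (fun s => timeDeriv a b g (t, s)) (timeDeriv a b h (t, r)) r := by
  have hc := continuousOn_slice (continuousOn_timeDeriv hab hh) (Ioo_subset_Icc_self ht)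
  -- As g is only C¹, symmetry of second derivatives is not available. Instead g is recovered from h
  -- by integration in r, and the integral is then differentiated in time.
  have hI : ∀ s ∈ Icc (0 : ℝ) 1, ∀ τ ∈ Icc a b, ∫ r in (0 : ℝ)..s, h (τ, r) = g (τ, s) - g (τ, 0) :=
    fun s hs τ hτ => by
      have hsub : Icc 0 s ⊆ Icc (0 : ℝ) 1 := Icc_subset_Icc_right hs.2
      refine intervalIntegral.integral_eq_sub_of_hasDerivAt_of_le (f := fun r => g (τ, r)) hs.1
        ((continuousOn_slice hg.continuousOn hτ).mono hsub) (fun x hx => ?_)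
        (((continuousOn_slice hh.continuousOn hτ).mono
          (by rwa [uIcc_of_le hs.1])).intervalIntegrable)
      have hx' : x ∈ Icc (0 : ℝ) 1 := hsub (Ioo_subset_Icc_self hx)
      have h1 := hasDerivWithinAt_paramDeriv hg hτ hx'
      rw [heq _ ⟨hτ, hx'⟩] at h1
      exact h1.hasDerivAt (Icc_mem_nhds hx.1 (hx.2.trans_le hs.2))
  have hV : ∀ s ∈ Icc (0 : ℝ) 1, timeDeriv a b g (t, s) =
      (∫ r in (0 : ℝ)..s, timeDeriv a b h (t, r)) + timeDeriv a b g (t, 0) := fun s hs => by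
    have h1 := hasDerivAt_integral_strip hab hh ht hs
    have h2 := (hasDerivAt_timeDeriv hg ht hs).sub
      (hasDerivAt_timeDeriv hg ht (left_mem_Icc.2 zero_le_one))
    have h3 : (fun τ => g (τ, s) - g (τ, 0)) =ᶠ[nhds t] fun τ => ∫ r in (0 : ℝ)..s, h (τ, r) := by
      filter_upwards [Icc_mem_nhds ht.1 ht.2] with τ hτ using (hI s hs τ hτ).symm
    rw [(h1.congr_of_eventuallyEq h3).unique h2]
    abel
  have hca : ContinuousAt (fun r => timeDeriv a b h (t, r)) r :=
    hc.continuousAt (Icc_mem_nhds hr.1 hr.2)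
  have hd := intervalIntegral.integral_hasDerivAt_right (a := 0) (b := r)
    ((hc.mono (by rw [uIcc_of_le hr.1.le]; exact Icc_subset_Icc_right hr.2.le)).intervalIntegrable)
    (ContinuousOn.stronglyMeasurableAtFilter isOpen_Ioo (hc.mono Ioo_subset_Icc_self) r hr) hca
  refine (hd.add_const (timeDeriv a b g (t, 0))).congr_of_eventuallyEq ?_
  filter_upwards [Icc_mem_nhds hr.1 hr.2] with s hs using hV s hs

end Strip

lemma hasDerivAt_comp_moving {E : Type*} [NormedAddCommGroup E] [NormedSpace ℝ E]
    {g : ℝ × Plane → E} {y : ℝ → Plane} {v : Plane} {d : E} {t : ℝ}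
    (hg : DifferentiableAt ℝ g (t, y t)) (hy : HasDerivAt y v t)
    (hd : HasDerivAt (fun s => g (s, y t)) d t) :
    HasDerivAt (fun s => g (s, y s)) (d + fderiv ℝ (fun x => g (t, x)) (y t) v) t := by
  have h1 := hg.hasFDerivAt.comp_hasDerivAt t ((hasDerivAt_id t).prodMk hy)
  have h2 := hg.hasFDerivAt.comp_hasDerivAt t ((hasDerivAt_id t).prodMk (hasDerivAt_const t (y t)))
  have h3 : HasFDerivAt (fun x => g (t, x)) _ (y t) :=
    hg.hasFDerivAt.comp (y t) (hasFDerivAt_prodMk_right t (y t))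
  refine HasDerivAt.congr_deriv (f := fun s => g (s, y s)) h1 ?_
  rw [← h2.unique hd, h3.fderiv]
  simp only [ContinuousLinearMap.comp_apply, ContinuousLinearMap.inr_apply, ← map_add]
  simp

lemma hasDerivAt_inv_norm_pair {p q : ℝ → ℝ} {p' q' t : ℝ} (hp : HasDerivAt p p' t)
    (hq : HasDerivAt q q' t) (hne : p t ^ 2 + q t ^ 2 ≠ 0) :
    HasDerivAt (fun s => (√(p s ^ 2 + q s ^ 2))⁻¹)
      (-(p t * p' + q t * q') / √(p t ^ 2 + q t ^ 2) ^ 3) t := by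
  have h0 : 0 < p t ^ 2 + q t ^ 2 := lt_of_le_of_ne (by positivity) hne.symm
  have h4 := Real.sqrt_pos.2 h0
  have h1 := (((hp.pow 2).add (hq.pow 2)).sqrt hne).inv h4.ne'
  refine HasDerivAt.congr_deriv (f := fun s => (√(p s ^ 2 + q s ^ 2))⁻¹) h1 ?_
  simp only [Pi.add_apply, Pi.pow_apply]
  field_simp
  push_cast
  ring

lemma norm_gradPerp_eq_sqrt (f : Plane → ℝ) (x : Plane) :
    ‖gradPerp f x‖ = √(partialDeriv 0 f x ^ 2 + partialDeriv 1 f x ^ 2) := by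
  rw [← norm_gradPerp_sq, Real.sqrt_sq (norm_nonneg _)]

/-! ### Moving level curves and the conservation law for 1/|∇^⊥θ|. -/

/-- A family of curves `r ↦ Y (t, r)`, `r ∈ [0, 1]`, `t ∈ [a, b]`, of constant speed `ℓ t`, inside
one and the same level set of `θ`, on which `∇^⊥ θ` does not vanish. -/
structure IsSlidingCurve (T : EReal) (θ : ℝ → Plane → ℝ) (a b : ℝ) (ℓ : ℝ → ℝ)
    (Y : ℝ × ℝ → Plane) : Prop where
  lt : a < b
  subset : Icc a b ⊆ timeIco 0 T
  length_pos : ∀ t ∈ Icc a b, 0 < ℓ t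
  contDiffOn_length : ContDiffOn ℝ 1 ℓ (Icc a b)
  contDiffOn_curve : ContDiffOn ℝ 1 Y (strip a b)
  speed : ∀ p ∈ strip a b, ‖paramDeriv a b Y p‖ = ℓ p.1
  level : ∃ c, ∀ p ∈ strip a b, θ p.1 (Y p) = c
  ne_zero : ∀ p ∈ strip a b, gradPerp (θ p.1) (Y p) ≠ 0

/-- The tangent field along a family of curves. -/
noncomputable def tangentAlong (θ : ℝ → Plane → ℝ) (Y : ℝ × ℝ → Plane) (p : ℝ × ℝ) : Plane :=
  unitTangent (θ p.1) (Y p)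

/-- The reciprocal of `|∇^⊥ θ|` along a family of curves. -/
noncomputable def weightAlong (θ : ℝ → Plane → ℝ) (Y : ℝ × ℝ → Plane) (p : ℝ × ℝ) : ℝ :=
  ‖gradPerp (θ p.1) (Y p)‖⁻¹

lemma inner_fderiv_unitTangent {f : Plane → ℝ} (hf : ContDiff ℝ ∞ f) {x : Plane}
    (hne : gradPerp f x ≠ 0) (v : Plane) :
    inner ℝ (unitTangent f x) (fderiv ℝ (unitTangent f) x v) = 0 := by
  have hU : DifferentiableAt ℝ (unitTangent f) x :=
    (contDiffAt_unitTangent hf hne).differentiableAt (by simp)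
  have h1 := hU.hasFDerivAt.norm_sq
  have h2 : (fun y => ‖unitTangent f y‖ ^ 2) =ᶠ[nhds x] fun _ => (1 : ℝ) := by
    filter_upwards [(contDiff_gradPerp hf).continuous.continuousAt.eventually_ne hne] with y hy
    rw [norm_unitTangent hy, one_pow]
  have h3 := h1.unique ((hasFDerivAt_const (1 : ℝ) x).congr_of_eventuallyEq h2)
  have h4 := DFunLike.congr_fun h3 v
  simpa using h4

namespace IsSlidingCurve

variable {T : EReal} {θ : ℝ → Plane → ℝ} {a b : ℝ} {ℓ : ℝ → ℝ} {Y : ℝ × ℝ → Plane}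

lemma contDiffOn_gradAlong (hc : IsSlidingCurve T θ a b ℓ Y) (hs : IsSolution T θ) :
    ContDiffOn ℝ 1 (fun p => gradPerp (θ p.1) (Y p)) (strip a b) :=
  (hs.contDiffOn_gradPerp.of_le (by simp)).comp (f := fun p : ℝ × ℝ => (p.1, Y p))
    (contDiffOn_fst.prodMk hc.contDiffOn_curve) fun _ hp => ⟨hc.subset hp.1, mem_univ _⟩

lemma contDiffOn_weight (hc : IsSlidingCurve T θ a b ℓ Y) (hs : IsSolution T θ) :
    ContDiffOn ℝ 1 (weightAlong θ Y) (strip a b) :=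
  ((hc.contDiffOn_gradAlong hs).norm ℝ hc.ne_zero).inv
    fun p hp => norm_ne_zero_iff.2 (hc.ne_zero p hp)

lemma contDiffOn_tangent (hc : IsSlidingCurve T θ a b ℓ Y) (hs : IsSolution T θ) :
    ContDiffOn ℝ 1 (tangentAlong θ Y) (strip a b) :=
  (hc.contDiffOn_weight hs).smul (hc.contDiffOn_gradAlong hs)

lemma fderiv_paramDeriv (hc : IsSlidingCurve T θ a b ℓ Y) (hs : IsSolution T θ)
    {t r : ℝ} (ht : t ∈ Icc a b) (hr : r ∈ Icc (0 : ℝ) 1) :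
    fderiv ℝ (θ t) (Y (t, r)) (paramDeriv a b Y (t, r)) = 0 := by
  have h1 := hasDerivWithinAt_paramDeriv hc.contDiffOn_curve ht hr
  have h2 := (((hs.contDiff_space (hc.subset ht)).differentiable (by simp)
    (Y (t, r))).hasFDerivAt).comp_hasDerivWithinAt r h1
  obtain ⟨c, hcc⟩ := hc.level
  have h3 := (hasDerivWithinAt_const r (Icc 0 1) c).congr (fun s hs' => hcc (t, s) ⟨ht, hs'⟩)
    (hcc (t, r) ⟨ht, hr⟩)
  exact (uniqueDiffOn_Icc one_pos r hr).eq_deriv _ h2 h3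

/-- The parametrisation may run with ξ or against it. The sign is continuous on the connected
rectangle, so one σ serves for all points and times. -/
lemma exists_sign (hc : IsSlidingCurve T θ a b ℓ Y) (hs : IsSolution T θ) :
    ∃ σ : ℝ, σ ^ 2 = 1 ∧
      ∀ p ∈ strip a b, paramDeriv a b Y p = (σ * ℓ p.1) • tangentAlong θ Y p := by
  set f : ℝ × ℝ → ℝ := fun p => inner ℝ (paramDeriv a b Y p) (tangentAlong θ Y p) / ℓ p.1
  have hℓ : ∀ p ∈ strip a b, ℓ p.1 ≠ 0 := fun p hp => (hc.length_pos p.1 hp.1).ne'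
  have hpar : ∀ p ∈ strip a b, paramDeriv a b Y p = (f p * ℓ p.1) • tangentAlong θ Y p :=
    fun p hp => by
      simp only [f, div_mul_cancel₀ _ (hℓ p hp)]
      exact eq_inner_smul_unitTangent (hc.ne_zero p hp) (hc.fderiv_paramDeriv hs hp.1 hp.2)
  have hf : ContinuousOn f (strip a b) :=
    (((continuousOn_paramDeriv hc.lt hc.contDiffOn_curve).inner
      (hc.contDiffOn_tangent hs).continuousOn)).div
      (hc.contDiffOn_length.continuousOn.comp continuousOn_fst fun p hp => hp.1) hℓ
  have hsq : EqOn (f ^ 2) 1 (strip a b) := fun p hp => by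
    have h1 := hc.speed p hp
    rw [hpar p hp, norm_smul, tangentAlong, norm_unitTangent (hc.ne_zero p hp), mul_one,
      Real.norm_eq_abs, abs_mul, abs_of_pos (hc.length_pos p.1 hp.1)] at h1
    have h2 : |f p| = 1 := mul_right_cancel₀ (hℓ p hp) (by rw [h1, one_mul])
    simp [← sq_abs, h2]
  have hpre : IsPreconnected (strip a b) := (isPreconnected_Icc).prod isPreconnected_Icc
  rcases hpre.eq_one_or_eq_neg_one_of_sq_eq hf hsq with h | h
  · exact ⟨1, by norm_num, fun p hp => by rw [hpar p hp, h hp]; rfl⟩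
  · exact ⟨-1, by norm_num, fun p hp => by rw [hpar p hp, h hp]; rfl⟩

section FixedTime

variable {t : ℝ}

lemma pos_of_mem (hc : IsSlidingCurve T θ a b ℓ Y) (ht : t ∈ Ioo a b) : 0 < t :=
  ((hc.subset (left_mem_Icc.2 hc.lt.le)).1).trans_lt ht.1

/-- The velocity of the curve relative to the flow is tangent to the level set. -/
lemma timeDeriv_curve (hc : IsSlidingCurve T θ a b ℓ Y) (hs : IsSolution T θ) (ht : t ∈ Ioo a b)
    {r : ℝ} (hr : r ∈ Icc (0 : ℝ) 1) :
    timeDeriv a b Y (t, r) - velocity (θ t) (Y (t, r)) =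
      inner ℝ (timeDeriv a b Y (t, r) - velocity (θ t) (Y (t, r))) (tangentAlong θ Y (t, r)) •
        tangentAlong θ Y (t, r) := by
  have ht' := Ioo_subset_Icc_self ht
  have hm : (t, r) ∈ strip a b := ⟨ht', hr⟩
  refine eq_inner_smul_unitTangent (hc.ne_zero _ hm) ?_
  have h0 := hc.pos_of_mem ht
  have hT := hc.subset ht'
  have h1 := hasDerivAt_comp_moving (y := fun s => Y (s, r))
    ((hs.contDiffAt hT h0 _).differentiableAt (by simp))
    (hasDerivAt_timeDeriv hc.contDiffOn_curve ht hr) (hs.hasDerivAt_time hT h0 _)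
  -- Both the fluid and the curve preserve the value of `θ`, so their relative velocity annihilates
  -- its differential.
  obtain ⟨c, hcc⟩ := hc.level
  have h2 : (fun s => θ s (Y (s, r))) =ᶠ[nhds t] fun _ => c := by
    filter_upwards [Icc_mem_nhds ht.1 ht.2] with s hs' using hcc (s, r) ⟨hs', hr⟩
  have h3 := h1.unique ((hasDerivAt_const t c).congr_of_eventuallyEq h2)
  rw [map_sub]
  linarith

/-- The tangential velocity of the curve relative to the flow. -/
noncomputable def slip (a b : ℝ) (θ : ℝ → Plane → ℝ) (Y : ℝ × ℝ → Plane) (p : ℝ × ℝ) : ℝ :=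
  inner ℝ (timeDeriv a b Y p - velocity (θ p.1) (Y p)) (tangentAlong θ Y p)

lemma contDiffAt_partialDeriv (hs : IsSolution T θ) (ht : t ∈ timeIco 0 T) (h0 : 0 < t)
    (i : Fin 2) (x : Plane) :
    ContDiffAt ℝ ∞ (fun p : ℝ × Plane => partialDeriv i (θ p.1) p.2) (t, x) :=
  (hs.contDiffOn_partialDeriv i).contDiffAt
    (prod_mem_nhds (timeIco_mem_nhds ht h0) Filter.univ_mem)

/-- Following the curve rather than the fluid leaves transport by the slip along ξ, besides the
stretching of ∇^⊥θ by the velocity gradient. -/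
lemma timeDeriv_weight (hc : IsSlidingCurve T θ a b ℓ Y) (hs : IsSolution T θ) (ht : t ∈ Ioo a b)
    {r : ℝ} (hr : r ∈ Icc (0 : ℝ) 1) :
    let f := θ t
    let x := Y (t, r)
    let D := fun i => slip a b θ Y (t, r) * fderiv ℝ (partialDeriv i f) x (unitTangent f x) -
      fderiv ℝ f x (fderiv ℝ (velocity f) x (basisVec i))
    timeDeriv a b (weightAlong θ Y) (t, r) =
      -(partialDeriv 0 f x * D 0 + partialDeriv 1 f x * D 1) / ‖gradPerp f x‖ ^ 3 := by
  intro f x D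
  have ht' := Ioo_subset_Icc_self ht
  have hm : (t, r) ∈ strip a b := ⟨ht', hr⟩
  have h0 := hc.pos_of_mem ht
  have hT := hc.subset ht'
  have hp : ∀ i, HasDerivAt (fun s => partialDeriv i (θ s) (Y (s, r))) (D i) t := fun i => by
    have h1 := hasDerivAt_comp_moving (y := fun s => Y (s, r))
      (g := fun p : ℝ × Plane => partialDeriv i (θ p.1) p.2)
      ((contDiffAt_partialDeriv hs hT h0 i _).differentiableAt (by simp))
      (hasDerivAt_timeDeriv hc.contDiffOn_curve ht hr) (hs.hasDerivAt_partialDeriv hT h0 i _)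
    refine h1.congr_deriv ?_
    have h2 := congrArg (fderiv ℝ (partialDeriv i f) x) (hc.timeDeriv_curve hs ht hr)
    rw [map_sub, map_smul, smul_eq_mul] at h2
    change _ = slip a b θ Y (t, r) * fderiv ℝ (partialDeriv i f) x (tangentAlong θ Y (t, r)) -
      fderiv ℝ f x (fderiv ℝ (velocity f) x (basisVec i))
    rw [slip, ← h2]
    ring
  have hne : partialDeriv 0 f x ^ 2 + partialDeriv 1 f x ^ 2 ≠ 0 := by
    rw [← norm_gradPerp_sq]
    exact pow_ne_zero _ (norm_ne_zero_iff.2 (hc.ne_zero _ hm))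
  have h3 := hasDerivAt_inv_norm_pair (hp 0) (hp 1) hne
  have h4 := hasDerivAt_timeDeriv (hc.contDiffOn_weight hs) ht hr
  simp only [weightAlong, norm_gradPerp_eq_sqrt] at h4 ⊢
  exact h4.unique h3

lemma hasDerivAt_curve (hc : IsSlidingCurve T θ a b ℓ Y) (ht : t ∈ Ioo a b) {σ : ℝ}
    (hσ : ∀ p ∈ strip a b, paramDeriv a b Y p = (σ * ℓ p.1) • tangentAlong θ Y p)
    {r : ℝ} (hr : r ∈ Ioo (0 : ℝ) 1) :
    HasDerivAt (fun s => Y (t, s)) ((σ * ℓ t) • tangentAlong θ Y (t, r)) r := by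
  have ht' := Ioo_subset_Icc_self ht
  have hr' := Ioo_subset_Icc_self hr
  rw [← hσ (t, r) ⟨ht', hr'⟩]
  exact (hasDerivWithinAt_paramDeriv hc.contDiffOn_curve ht' hr').hasDerivAt
    (Icc_mem_nhds hr.1 hr.2)

lemma hasDerivAt_weight (hc : IsSlidingCurve T θ a b ℓ Y) (hs : IsSolution T θ) (ht : t ∈ Ioo a b)
    {σ : ℝ} (hσ : ∀ p ∈ strip a b, paramDeriv a b Y p = (σ * ℓ p.1) • tangentAlong θ Y p)
    {r : ℝ} (hr : r ∈ Ioo (0 : ℝ) 1) :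
    let f := θ t
    let x := Y (t, r)
    let D := fun i => (σ * ℓ t) * fderiv ℝ (partialDeriv i f) x (unitTangent f x)
    HasDerivAt (fun s => weightAlong θ Y (t, s))
      (-(partialDeriv 0 f x * D 0 + partialDeriv 1 f x * D 1) / ‖gradPerp f x‖ ^ 3) r := by
  intro f x D
  have ht' := Ioo_subset_Icc_self ht
  have hm : (t, r) ∈ strip a b := ⟨ht', Ioo_subset_Icc_self hr⟩
  have hf := hs.contDiff_space (hc.subset ht')
  have hp : ∀ i, HasDerivAt (fun s => partialDeriv i f (Y (t, s))) (D i) r := fun i => by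
    have h1 := (((contDiff_partialDeriv hf i).differentiable (by simp)
      (Y (t, r))).hasFDerivAt).comp_hasDerivAt r (hc.hasDerivAt_curve ht hσ hr)
    refine HasDerivAt.congr_deriv (f := fun s => partialDeriv i f (Y (t, s))) h1 ?_
    rw [map_smul, smul_eq_mul]
    rfl
  have hne : partialDeriv 0 f x ^ 2 + partialDeriv 1 f x ^ 2 ≠ 0 := by
    rw [← norm_gradPerp_sq]
    exact pow_ne_zero _ (norm_ne_zero_iff.2 (hc.ne_zero _ hm))
  have h3 := hasDerivAt_inv_norm_pair (hp 0) (hp 1) hne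
  simp only [weightAlong, norm_gradPerp_eq_sqrt]
  exact h3

lemma hasDerivAt_tangent (hc : IsSlidingCurve T θ a b ℓ Y) (hs : IsSolution T θ) (ht : t ∈ Ioo a b)
    {σ : ℝ} (hσ : ∀ p ∈ strip a b, paramDeriv a b Y p = (σ * ℓ p.1) • tangentAlong θ Y p)
    {r : ℝ} (hr : r ∈ Ioo (0 : ℝ) 1) :
    HasDerivAt (fun s => tangentAlong θ Y (t, s))
      ((σ * ℓ t) • fderiv ℝ (unitTangent (θ t)) (Y (t, r)) (unitTangent (θ t) (Y (t, r)))) r := by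
  have ht' := Ioo_subset_Icc_self ht
  have hm : (t, r) ∈ strip a b := ⟨ht', Ioo_subset_Icc_self hr⟩
  have hU : DifferentiableAt ℝ (unitTangent (θ t)) (Y (t, r)) :=
    (contDiffAt_unitTangent (hs.contDiff_space (hc.subset ht'))
      (hc.ne_zero _ hm)).differentiableAt (by simp)
  have h1 := hU.hasFDerivAt.comp_hasDerivAt r (hc.hasDerivAt_curve ht hσ hr)
  refine HasDerivAt.congr_deriv (f := fun s => tangentAlong θ Y (t, s)) h1 ?_
  rw [map_smul]
  rfl

lemma hasDerivAt_length (hc : IsSlidingCurve T θ a b ℓ Y) (ht : t ∈ Ioo a b) :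
    HasDerivAt ℓ (deriv ℓ t) t :=
  ((hc.contDiffOn_length.contDiffAt (Icc_mem_nhds ht.1 ht.2)).differentiableAt
    one_ne_zero).hasDerivAt

/-- The tangential component of the velocity of the curve, differentiated along the curve. -/
lemma hasDerivAt_inner_timeDeriv (hc : IsSlidingCurve T θ a b ℓ Y) (hs : IsSolution T θ)
    (ht : t ∈ Ioo a b) {σ : ℝ} (hσ2 : σ ^ 2 = 1)
    (hσ : ∀ p ∈ strip a b, paramDeriv a b Y p = (σ * ℓ p.1) • tangentAlong θ Y p)
    {r : ℝ} (hr : r ∈ Ioo (0 : ℝ) 1) :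
    HasDerivAt (fun s => inner ℝ (timeDeriv a b Y (t, s)) (tangentAlong θ Y (t, s)))
      (σ * (deriv ℓ t + ℓ t * inner ℝ (velocity (θ t) (Y (t, r)))
        (fderiv ℝ (unitTangent (θ t)) (Y (t, r)) (unitTangent (θ t) (Y (t, r)))))) r := by
  have ht' := Ioo_subset_Icc_self ht
  have hr' := Ioo_subset_Icc_self hr
  have hm : (t, r) ∈ strip a b := ⟨ht', hr'⟩
  set Φ : ℝ × ℝ → Plane := fun p => (σ * ℓ p.1) • tangentAlong θ Y p
  have hΦ : ContDiffOn ℝ 1 Φ (strip a b) :=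
    (contDiffOn_const.mul (hc.contDiffOn_length.comp contDiffOn_fst fun p hp => hp.1)).smul
      (hc.contDiffOn_tangent hs)
  have hV := hasDerivAt_timeDeriv_param hc.lt hc.contDiffOn_curve hΦ hσ ht hr
  have hpos := hc.length_pos t ht'
  -- the speed is independent of the point of the curve
  have hsp : inner ℝ (timeDeriv a b Φ (t, r)) (tangentAlong θ Y (t, r)) = σ * deriv ℓ t := by
    have h1 := (hasDerivAt_timeDeriv hΦ ht hr').norm_sq
    have h2 : (fun s => ‖Φ (s, r)‖ ^ 2) =ᶠ[nhds t] fun s => ℓ s ^ 2 := by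
      filter_upwards [Icc_mem_nhds ht.1 ht.2] with s hs'
      simp only [Φ]
      rw [norm_smul, tangentAlong, norm_unitTangent (hc.ne_zero (s, r) ⟨hs', hr'⟩), mul_one,
        Real.norm_eq_abs, sq_abs, mul_pow, hσ2, one_mul]
    have h3 := h1.unique (((hc.hasDerivAt_length ht).pow 2).congr_of_eventuallyEq h2)
    simp only [Φ, inner_smul_left, Nat.cast_ofNat] at h3
    rw [real_inner_comm]
    have hσ0 : σ ≠ 0 := fun h => by simp [h] at hσ2
    have h4 : (σ * ℓ t) * inner ℝ (tangentAlong θ Y (t, r)) (timeDeriv a b Φ (t, r)) =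
        (σ * ℓ t) * (σ * deriv ℓ t) := by
      simp only [conj_trivial] at h3
      linear_combination h3 / 2 - ℓ t * deriv ℓ t * hσ2
    exact mul_left_cancel₀ (mul_ne_zero hσ0 hpos.ne') h4
  refine (hV.inner ℝ (hc.hasDerivAt_tangent hs ht hσ hr)).congr_deriv ?_
  rw [hsp, inner_smul_right]
  -- The relative velocity is parallel to ξ while ξ·∇ξ is orthogonal to it, so against the curvature
  -- vector the velocity of the curve may be replaced by u.
  have h5 := hc.timeDeriv_curve hs ht hr'
  have h6 := inner_fderiv_unitTangent (hs.contDiff_space (hc.subset ht')) (hc.ne_zero _ hm)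
    (unitTangent (θ t) (Y (t, r)))
  have h7 : inner ℝ (timeDeriv a b Y (t, r)) (fderiv ℝ (unitTangent (θ t)) (Y (t, r))
      (unitTangent (θ t) (Y (t, r)))) = inner ℝ (velocity (θ t) (Y (t, r)))
        (fderiv ℝ (unitTangent (θ t)) (Y (t, r)) (unitTangent (θ t) (Y (t, r)))) := by
    rw [← sub_eq_zero, ← inner_sub_left, h5, inner_smul_left]
    simp only [tangentAlong]
    rw [h6, mul_zero]
  rw [h7]
  ring

lemma hasDerivAt_inner_velocity (hc : IsSlidingCurve T θ a b ℓ Y) (hs : IsSolution T θ)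
    (ht : t ∈ Ioo a b) {σ : ℝ}
    (hσ : ∀ p ∈ strip a b, paramDeriv a b Y p = (σ * ℓ p.1) • tangentAlong θ Y p)
    {r : ℝ} (hr : r ∈ Ioo (0 : ℝ) 1) :
    HasDerivAt (fun s => inner ℝ (velocity (θ t) (Y (t, s))) (tangentAlong θ Y (t, s)))
      (σ * ℓ t * (inner ℝ (fderiv ℝ (velocity (θ t)) (Y (t, r)) (unitTangent (θ t) (Y (t, r))))
        (unitTangent (θ t) (Y (t, r))) + inner ℝ (velocity (θ t) (Y (t, r)))
        (fderiv ℝ (unitTangent (θ t)) (Y (t, r)) (unitTangent (θ t) (Y (t, r)))))) r := by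
  have ht' := Ioo_subset_Icc_self ht
  obtain ⟨K, hK⟩ := hs.isDecaying (hc.subset ht')
  have h1 := ((differentiable_velocity hK (Y (t, r))).hasFDerivAt).comp_hasDerivAt r
    (hc.hasDerivAt_curve ht hσ hr)
  refine HasDerivAt.congr_deriv
    (f := fun s => inner ℝ (velocity (θ t) (Y (t, s))) (tangentAlong θ Y (t, s)))
    (h1.inner ℝ (hc.hasDerivAt_tangent hs ht hσ hr)) ?_
  rw [map_smul, inner_smul_right, inner_smul_left]
  simp only [tangentAlong, conj_trivial, Function.comp_apply]
  ring

/-- The tangential stretching, expressed through the gradient; this uses that the velocity is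
divergence free. -/
lemma inner_fderiv_velocity_unitTangent {f : Plane → ℝ} {K : ℝ} (h : IsDecaying f K) {x : Plane}
    (hne : gradPerp f x ≠ 0) :
    ‖gradPerp f x‖ ^ 2 *
      inner ℝ (fderiv ℝ (velocity f) x (unitTangent f x)) (unitTangent f x) =
      -(partialDeriv 0 f x * fderiv ℝ f x (fderiv ℝ (velocity f) x (basisVec 0)) +
        partialDeriv 1 f x * fderiv ℝ f x (fderiv ℝ (velocity f) x (basisVec 1))) := by
  have hw : ‖gradPerp f x‖ ≠ 0 := norm_ne_zero_iff.2 hne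
  have htr := fderiv_velocity_trace h x
  set L := fderiv ℝ (velocity f) x
  have h1 : unitTangent f x = ‖gradPerp f x‖⁻¹ •
      (-partialDeriv 1 f x • basisVec 0 + partialDeriv 0 f x • basisVec 1) := by
    ext i
    fin_cases i <;> simp [unitTangent, gradPerp]
  have h2 : ∀ v : Plane, inner ℝ v (unitTangent f x) =
      ‖gradPerp f x‖⁻¹ * (v 1 * partialDeriv 0 f x - v 0 * partialDeriv 1 f x) := fun v => by
    rw [PiLp.inner_apply, Fin.sum_univ_two]
    simp [unitTangent, gradPerp]
    ring
  rw [h2, fderiv_eq_sum f x (L (basisVec 0)), fderiv_eq_sum f x (L (basisVec 1)), h1, map_smul,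
    map_add, map_smul, map_smul]
  simp only [PiLp.smul_apply, PiLp.add_apply, smul_eq_mul]
  field_simp
  linear_combination (partialDeriv 0 f x ^ 2 + partialDeriv 1 f x ^ 2) * htr

/-- The key identity: the slip velocity divided by `|∇^⊥ θ|` is a primitive of the time derivative
of `ℓ / |∇^⊥ θ|`. -/
lemma hasDerivAt_slip_mul_weight (hc : IsSlidingCurve T θ a b ℓ Y) (hs : IsSolution T θ)
    (ht : t ∈ Ioo a b) {σ : ℝ} (hσ2 : σ ^ 2 = 1)
    (hσ : ∀ p ∈ strip a b, paramDeriv a b Y p = (σ * ℓ p.1) • tangentAlong θ Y p)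
    {r : ℝ} (hr : r ∈ Ioo (0 : ℝ) 1) :
    HasDerivAt (fun s => slip a b θ Y (t, s) * weightAlong θ Y (t, s))
      (σ * (ℓ t * timeDeriv a b (weightAlong θ Y) (t, r) + deriv ℓ t * weightAlong θ Y (t, r)))
      r := by
  have ht' := Ioo_subset_Icc_self ht
  have hr' := Ioo_subset_Icc_self hr
  have hm : (t, r) ∈ strip a b := ⟨ht', hr'⟩
  obtain ⟨K, hK⟩ := hs.isDecaying (hc.subset ht')
  -- In the difference the two curvature terms cancel, and the slip has derivative σ(ℓ' − ℓ S) with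
  -- S the tangential stretching ξ·(∇u)ξ. The same S enters the time derivative of the weight, which
  -- is what makes the product exact.
  have h1 := ((hc.hasDerivAt_inner_timeDeriv hs ht hσ2 hσ hr).sub
    (hc.hasDerivAt_inner_velocity hs ht hσ hr))
  have e1 : (fun s => slip a b θ Y (t, s)) = fun s =>
      inner ℝ (timeDeriv a b Y (t, s)) (tangentAlong θ Y (t, s)) -
        inner ℝ (velocity (θ t) (Y (t, s))) (tangentAlong θ Y (t, s)) := by
    ext s
    rw [slip, inner_sub_left]
  have h2 := h1.congr_of_eventuallyEq (Filter.EventuallyEq.of_eq e1)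
  refine (h2.mul (hc.hasDerivAt_weight hs ht hσ hr)).congr_deriv ?_
  rw [hc.timeDeriv_weight hs ht hr']
  have h3 := inner_fderiv_velocity_unitTangent hK (hc.ne_zero _ hm)
  have hw : ‖gradPerp (θ t) (Y (t, r))‖ ≠ 0 := norm_ne_zero_iff.2 (hc.ne_zero _ hm)
  simp only [weightAlong]
  field_simp
  linear_combination (-ℓ t * σ) * h3

end FixedTime

end IsSlidingCurve

/-! ### Evolution of the mean of 1/|∇^⊥θ|. -/

lemma curvature_nonneg (f : Plane → ℝ) (x : Plane) : 0 ≤ curvature f x := norm_nonneg _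

lemma continuousAt_fderiv_unitTangent {f : Plane → ℝ} (hf : ContDiff ℝ ∞ f) {x : Plane}
    (hne : gradPerp f x ≠ 0) :
    ContinuousAt (fderiv ℝ (unitTangent f)) x :=
  ((contDiffAt_unitTangent hf hne).fderiv_right (m := ∞) (by simp)).continuousAt

lemma continuousAt_curvatureVector {f : Plane → ℝ} (hf : ContDiff ℝ ∞ f) {x : Plane}
    (hne : gradPerp f x ≠ 0) :
    ContinuousAt (fun y => fderiv ℝ (unitTangent f) y (unitTangent f y)) x :=
  (continuousAt_fderiv_unitTangent hf hne).clm_apply (contDiffAt_unitTangent hf hne).continuousAt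

/-- The mean of `1 / |∇^⊥ θ|` over the curve at time `t`. -/
noncomputable def meanWeight (θ : ℝ → Plane → ℝ) (Y : ℝ × ℝ → Plane) (t : ℝ) : ℝ :=
  ∫ r in (0 : ℝ)..1, weightAlong θ Y (t, r)

/-- Everything is compared with the minimum of g, which does not exceed its mean. -/
lemma sub_le_of_comparable {g : ℝ → ℝ} {C₁ : ℝ} (hg : ContinuousOn g (Icc 0 1))
    (hC : 1 ≤ C₁) (hpos : ∀ r ∈ Icc (0 : ℝ) 1, 0 < g r)
    (hcmp : ∀ r ∈ Icc (0 : ℝ) 1, ∀ r' ∈ Icc (0 : ℝ) 1, g r ≤ C₁ * g r') :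
    (∀ r ∈ Icc (0 : ℝ) 1, g r ≤ C₁ * ∫ s in (0 : ℝ)..1, g s) ∧
      (∀ r ∈ Icc (0 : ℝ) 1, ∀ r' ∈ Icc (0 : ℝ) 1, g r - g r' ≤ (C₁ - 1) * ∫ s in (0 : ℝ)..1, g s) ∧
      0 < ∫ s in (0 : ℝ)..1, g s := by
  obtain ⟨r₀, hr₀, hmin⟩ := isCompact_Icc.exists_isMinOn (nonempty_Icc.2 zero_le_one) hg
  have hint : IntervalIntegrable g volume 0 1 :=
    (hg.mono (by rw [uIcc_of_le zero_le_one])).intervalIntegrable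
  have h1 : g r₀ ≤ ∫ s in (0 : ℝ)..1, g s := by
    have := intervalIntegral.integral_mono_on zero_le_one
      (intervalIntegrable_const (c := g r₀) (μ := volume)) hint fun s hs => hmin hs
    simpa using this
  have h0 := hpos r₀ hr₀
  refine ⟨fun r hr => ?_, fun r hr r' hr' => ?_, h0.trans_le h1⟩
  · have := hcmp r hr r₀ hr₀
    nlinarith
  · have h2 := hcmp r hr r₀ hr₀
    have h3 : g r₀ ≤ g r' := hmin hr'
    nlinarith

namespace IsSlidingCurve

variable {T : EReal} {θ : ℝ → Plane → ℝ} {a b : ℝ} {ℓ : ℝ → ℝ} {Y : ℝ × ℝ → Plane} {t : ℝ}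

lemma hasDerivAt_meanWeight (hc : IsSlidingCurve T θ a b ℓ Y) (hs : IsSolution T θ)
    (ht : t ∈ Ioo a b) :
    HasDerivAt (meanWeight θ Y) (∫ r in (0 : ℝ)..1, timeDeriv a b (weightAlong θ Y) (t, r)) t :=
  hasDerivAt_integral_strip hc.lt (hc.contDiffOn_weight hs) ht (right_mem_Icc.2 zero_le_one)

lemma continuousOn_velocity_slice (hc : IsSlidingCurve T θ a b ℓ Y) (hs : IsSolution T θ)
    (ht : t ∈ Ioo a b) : ContinuousOn (fun r => velocity (θ t) (Y (t, r))) (Icc 0 1) := by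
  have ht' := Ioo_subset_Icc_self ht
  obtain ⟨K, hK⟩ := hs.isDecaying (hc.subset ht')
  exact (differentiable_velocity hK).continuous.comp_continuousOn
    (continuousOn_slice hc.contDiffOn_curve.continuousOn ht')

lemma continuousOn_tangent_slice (hc : IsSlidingCurve T θ a b ℓ Y) (hs : IsSolution T θ)
    (ht : t ∈ Ioo a b) : ContinuousOn (fun r => tangentAlong θ Y (t, r)) (Icc 0 1) :=
  continuousOn_slice (hc.contDiffOn_tangent hs).continuousOn (Ioo_subset_Icc_self ht)

lemma continuousOn_timeDeriv_slice (hc : IsSlidingCurve T θ a b ℓ Y)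
    (ht : t ∈ Ioo a b) : ContinuousOn (fun r => timeDeriv a b Y (t, r)) (Icc 0 1) :=
  continuousOn_slice (continuousOn_timeDeriv hc.lt hc.contDiffOn_curve) (Ioo_subset_Icc_self ht)

lemma continuousOn_weight_slice (hc : IsSlidingCurve T θ a b ℓ Y) (hs : IsSolution T θ)
    (ht : t ∈ Icc a b) : ContinuousOn (fun r => weightAlong θ Y (t, r)) (Icc 0 1) :=
  continuousOn_slice (hc.contDiffOn_weight hs).continuousOn ht

lemma continuousOn_curvatureVector_slice (hc : IsSlidingCurve T θ a b ℓ Y) (hs : IsSolution T θ)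
    (ht : t ∈ Ioo a b) : ContinuousOn (fun r => fderiv ℝ (unitTangent (θ t)) (Y (t, r))
      (unitTangent (θ t) (Y (t, r)))) (Icc 0 1) := by
  have ht' := Ioo_subset_Icc_self ht
  intro r hr
  exact ContinuousAt.comp_continuousWithinAt (f := fun r => Y (t, r))
    (continuousAt_curvatureVector (hs.contDiff_space (hc.subset ht'))
      (hc.ne_zero (t, r) ⟨ht', hr⟩))
    (continuousOn_slice hc.contDiffOn_curve.continuousOn ht' r hr)

/-- The conservation law integrated over the curve: the bracket on the right is the time derivative
of ℓ times the mean weight. -/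
lemma slip_mul_weight_sub (hc : IsSlidingCurve T θ a b ℓ Y) (hs : IsSolution T θ)
    (ht : t ∈ Ioo a b) {σ : ℝ} (hσ2 : σ ^ 2 = 1)
    (hσ : ∀ p ∈ strip a b, paramDeriv a b Y p = (σ * ℓ p.1) • tangentAlong θ Y p) :
    slip a b θ Y (t, 1) * weightAlong θ Y (t, 1) - slip a b θ Y (t, 0) * weightAlong θ Y (t, 0) =
      σ * (ℓ t * (∫ r in (0 : ℝ)..1, timeDeriv a b (weightAlong θ Y) (t, r)) +
        deriv ℓ t * meanWeight θ Y t) := by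
  have ht' := Ioo_subset_Icc_self ht
  have hslip : ContinuousOn (fun r => slip a b θ Y (t, r)) (Icc 0 1) :=
    ((hc.continuousOn_timeDeriv_slice ht).sub (hc.continuousOn_velocity_slice hs ht)).inner
      (hc.continuousOn_tangent_slice hs ht)
  have hw := hc.continuousOn_weight_slice hs ht'
  have hdw := continuousOn_slice (continuousOn_timeDeriv hc.lt (hc.contDiffOn_weight hs)) ht'
  have i1 : IntervalIntegrable (fun r => ℓ t * timeDeriv a b (weightAlong θ Y) (t, r))
      volume 0 1 :=
    ((hdw.const_smul (ℓ t)).mono (by rw [uIcc_of_le zero_le_one])).intervalIntegrable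
  have i2 : IntervalIntegrable (fun r => deriv ℓ t * weightAlong θ Y (t, r)) volume 0 1 :=
    ((hw.const_smul (deriv ℓ t)).mono (by rw [uIcc_of_le zero_le_one])).intervalIntegrable
  have := intervalIntegral.integral_eq_sub_of_hasDerivAt_of_le zero_le_one (hslip.mul hw)
    (fun r hr => hc.hasDerivAt_slip_mul_weight hs ht hσ2 hσ hr) ((i1.add i2).const_mul σ)
  refine this.symm.trans ?_
  rw [intervalIntegral.integral_const_mul, intervalIntegral.integral_add i1 i2,
    intervalIntegral.integral_const_mul, intervalIntegral.integral_const_mul, meanWeight]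

/-- Determines the tangential motion of the endpoint r = 1 from that of r = 0, the change of length
and the curvature; no assumption controls that endpoint directly. -/
lemma inner_timeDeriv_sub (hc : IsSlidingCurve T θ a b ℓ Y) (hs : IsSolution T θ)
    (ht : t ∈ Ioo a b) {σ : ℝ} (hσ2 : σ ^ 2 = 1)
    (hσ : ∀ p ∈ strip a b, paramDeriv a b Y p = (σ * ℓ p.1) • tangentAlong θ Y p) :
    inner ℝ (timeDeriv a b Y (t, 1)) (tangentAlong θ Y (t, 1)) -
      inner ℝ (timeDeriv a b Y (t, 0)) (tangentAlong θ Y (t, 0)) =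
      σ * (deriv ℓ t + ∫ r in (0 : ℝ)..1, ℓ t * inner ℝ (velocity (θ t) (Y (t, r)))
        (fderiv ℝ (unitTangent (θ t)) (Y (t, r)) (unitTangent (θ t) (Y (t, r))))) := by
  have hI : IntervalIntegrable (fun r => ℓ t * inner ℝ (velocity (θ t) (Y (t, r)))
      (fderiv ℝ (unitTangent (θ t)) (Y (t, r)) (unitTangent (θ t) (Y (t, r))))) volume 0 1 :=
    ((((hc.continuousOn_velocity_slice hs ht).inner
      (hc.continuousOn_curvatureVector_slice hs ht)).const_smul (ℓ t)).mono
      (by rw [uIcc_of_le zero_le_one])).intervalIntegrable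
  have := intervalIntegral.integral_eq_sub_of_hasDerivAt_of_le zero_le_one
    ((hc.continuousOn_timeDeriv_slice ht).inner (hc.continuousOn_tangent_slice hs ht))
    (fun r hr => hc.hasDerivAt_inner_timeDeriv hs ht hσ2 hσ hr)
    ((intervalIntegrable_const.add hI).const_mul σ)
  rw [← this, intervalIntegral.integral_const_mul,
    intervalIntegral.integral_add intervalIntegrable_const hI]
  simp

lemma abs_integral_inner_curvatureVector_le (hc : IsSlidingCurve T θ a b ℓ Y)
    (hs : IsSolution T θ) (ht : t ∈ Ioo a b) {U C₀ : ℝ} (hU : ∀ x, ‖velocity (θ t) x‖ ≤ U)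
    (hκ : ∫ r in (0 : ℝ)..1, ℓ t * curvature (θ t) (Y (t, r)) ≤ C₀) :
    |∫ r in (0 : ℝ)..1, ℓ t * inner ℝ (velocity (θ t) (Y (t, r)))
        (fderiv ℝ (unitTangent (θ t)) (Y (t, r)) (unitTangent (θ t) (Y (t, r))))| ≤ U * C₀ := by
  have hU0 : 0 ≤ U := (norm_nonneg _).trans (hU 0)
  have hℓ := (hc.length_pos t (Ioo_subset_Icc_self ht)).le
  have hI : IntervalIntegrable (fun r => U * (ℓ t * curvature (θ t) (Y (t, r)))) volume 0 1 :=
    ((((hc.continuousOn_curvatureVector_slice hs ht).norm.const_smul (ℓ t)).const_smul U).mono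
      (by rw [uIcc_of_le zero_le_one])).intervalIntegrable
  rw [← Real.norm_eq_abs]
  refine (intervalIntegral.norm_integral_le_of_norm_le zero_le_one
    (Filter.Eventually.of_forall fun r _ => ?_) hI).trans ?_
  · rw [norm_mul, Real.norm_of_nonneg hℓ]
    have h1 := (abs_real_inner_le_norm (velocity (θ t) (Y (t, r)))
      (fderiv ℝ (unitTangent (θ t)) (Y (t, r)) (unitTangent (θ t) (Y (t, r))))).trans
      (mul_le_mul_of_nonneg_right (hU _) (norm_nonneg _))
    rw [mul_left_comm]
    exact mul_le_mul_of_nonneg_left h1 hℓ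
  · rw [intervalIntegral.integral_const_mul]
    gcongr

/-- The mean of `1 / |∇^⊥ θ|` cannot decrease quickly. -/
theorem neg_length_mul_deriv_le (hc : IsSlidingCurve T θ a b ℓ Y) (hs : IsSolution T θ)
    (ht : t ∈ Ioo a b) {U V C₀ Cl : ℝ} (hC₀ : 0 ≤ C₀) (hCl : 0 ≤ Cl) (hVU : V ≤ U)
    (hU : ∀ x, ‖velocity (θ t) x‖ ≤ U)
    (hκ : ∫ r in (0 : ℝ)..1, ℓ t * curvature (θ t) (Y (t, r)) ≤ C₀)
    (hV : ∀ r ∈ Icc (0 : ℝ) 1,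
      |inner ℝ (velocity (θ t) (Y (t, r))) (unitTangent (θ t) (Y (t, r)))| ≤ V)
    (hend : |inner ℝ (timeDeriv a b Y (t, 0)) (unitTangent (θ t) (Y (t, 0)))| ≤ Cl * V)
    (hcmp : ∀ r ∈ Icc (0 : ℝ) 1, ∀ r' ∈ Icc (0 : ℝ) 1,
      weightAlong θ Y (t, r) ≤ constOne C₀ * weightAlong θ Y (t, r')) :
    -(ℓ t * ∫ r in (0 : ℝ)..1, timeDeriv a b (weightAlong θ Y) (t, r)) ≤
      deriv ℓ t * (meanWeight θ Y t - weightAlong θ Y (t, 1)) +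
        2 * max (constU C₀) (constV C₀ Cl) * U * meanWeight θ Y t := by
  obtain ⟨σ, hσ2, hσ⟩ := hc.exists_sign hs
  have ht' := Ioo_subset_Icc_self ht
  have m0 : (0 : ℝ) ∈ Icc (0 : ℝ) 1 := left_mem_Icc.2 zero_le_one
  have m1 : (1 : ℝ) ∈ Icc (0 : ℝ) 1 := right_mem_Icc.2 zero_le_one
  have hC₁ : 1 ≤ constOne C₀ := Real.one_le_exp hC₀
  have k1 := hc.slip_mul_weight_sub hs ht hσ2 hσ
  have k2 := hc.inner_timeDeriv_sub hs ht hσ2 hσ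
  have k3 := hc.abs_integral_inner_curvatureVector_le hs ht hU hκ
  have hwpos : ∀ r ∈ Icc (0 : ℝ) 1, 0 < weightAlong θ Y (t, r) := fun r hr =>
    inv_pos.2 (norm_pos_iff.2 (hc.ne_zero (t, r) ⟨ht', hr⟩))
  obtain ⟨q1, q2, q3⟩ := sub_le_of_comparable (hc.continuousOn_weight_slice hs ht') hC₁ hwpos hcmp
  have q1 := q1 1 m1
  have q2a := q2 1 m1 0 m0
  have q2b := q2 0 m0 1 m1
  have hw1 := hwpos 1 m1
  have v0 := hV 0 m0
  have v1 := hV 1 m1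
  have hV0 : 0 ≤ V := (abs_nonneg _).trans v0
  change |inner ℝ (velocity (θ t) (Y (t, 0))) (tangentAlong θ Y (t, 0))| ≤ V at v0
  change |inner ℝ (velocity (θ t) (Y (t, 1))) (tangentAlong θ Y (t, 1))| ≤ V at v1
  change |inner ℝ (timeDeriv a b Y (t, 0)) (tangentAlong θ Y (t, 0))| ≤ Cl * V at hend
  change _ ≤ constOne C₀ * meanWeight θ Y t at q1
  change _ ≤ (constOne C₀ - 1) * meanWeight θ Y t at q2a
  change _ ≤ (constOne C₀ - 1) * meanWeight θ Y t at q2b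
  change 0 < meanWeight θ Y t at q3
  simp only [slip, inner_sub_left] at k1
  set F := meanWeight θ Y t
  set J := ∫ r in (0 : ℝ)..1, timeDeriv a b (weightAlong θ Y) (t, r)
  set I := ∫ r in (0 : ℝ)..1, ℓ t * inner ℝ (velocity (θ t) (Y (t, r)))
        (fderiv ℝ (unitTangent (θ t)) (Y (t, r)) (unitTangent (θ t) (Y (t, r))))
  set w0 := weightAlong θ Y (t, 0)
  set w1 := weightAlong θ Y (t, 1)
  set u0 := inner ℝ (velocity (θ t) (Y (t, 0))) (tangentAlong θ Y (t, 0))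
  set u1 := inner ℝ (velocity (θ t) (Y (t, 1))) (tangentAlong θ Y (t, 1))
  set β0 := inner ℝ (timeDeriv a b Y (t, 0)) (tangentAlong θ Y (t, 0))
  set β1 := inner ℝ (timeDeriv a b Y (t, 1)) (tangentAlong θ Y (t, 1))
  set C₁ := constOne C₀ with hC1
  have hσa : |σ| = 1 := by rwa [← sq_eq_sq₀ (abs_nonneg _) zero_le_one, sq_abs, one_pow]
  -- The unknown β1 is eliminated between `k1` and `k2`. The terms in β0 and u0 combine with the
  -- difference w1 − w0, which is small relative to F when C₁ is near 1.
  have e1 : -(ℓ t * J) = deriv ℓ t * (F - w1) - (I - σ * (u1 - u0)) * w1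
      - σ * (β0 - u0) * (w1 - w0) := by
    linear_combination σ * k1 - (σ * w1) * k2 +
      (ℓ t * J + deriv ℓ t * F - (deriv ℓ t + I) * w1) * hσ2
  have hU0 : 0 ≤ U := (norm_nonneg _).trans (hU 0)
  have b1 : -((I - σ * (u1 - u0)) * w1) ≤ (U * C₀ + 2 * V) * (C₁ * F) := by
    have h1 : |I - σ * (u1 - u0)| ≤ U * C₀ + 2 * V := by
      refine (abs_sub _ _).trans ?_
      rw [abs_mul, hσa, one_mul]
      have := abs_sub u1 u0
      linarith
    calc -((I - σ * (u1 - u0)) * w1) ≤ |(I - σ * (u1 - u0)) * w1| := neg_le_abs _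
      _ = |I - σ * (u1 - u0)| * w1 := by rw [abs_mul, abs_of_pos hw1]
      _ ≤ _ := by gcongr
  have b2 : -(σ * (β0 - u0) * (w1 - w0)) ≤ (Cl + 1) * V * ((C₁ - 1) * F) := by
    have h1 : |β0 - u0| ≤ (Cl + 1) * V := by
      have := abs_sub β0 u0
      linarith
    have h2 : |w1 - w0| ≤ (C₁ - 1) * F := abs_le.2 ⟨by linarith, q2a⟩
    calc -(σ * (β0 - u0) * (w1 - w0)) ≤ |σ * (β0 - u0) * (w1 - w0)| := neg_le_abs _
      _ = |β0 - u0| * |w1 - w0| := by rw [abs_mul, abs_mul, hσa, one_mul]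
      _ ≤ _ := by gcongr
  -- The curvature term is charged to C_U and the endpoint terms to C_V; adding the two bounds
  -- produces the factor 2.
  have c1 : U * C₀ * C₁ ≤ max (constU C₀) (constV C₀ Cl) * U := by
    have h1 : C₀ * C₁ ≤ constU C₀ := by
      rw [constU, ← hC1]; gcongr; linarith
    calc U * C₀ * C₁ = (C₀ * C₁) * U := by ring
      _ ≤ _ := by gcongr; exact h1.trans (le_max_left _ _)
  have c2 : 2 * V * C₁ + (Cl + 1) * V * (C₁ - 1) ≤ max (constU C₀) (constV C₀ Cl) * U := by
    have h1 : 2 * C₁ + (Cl + 1) * (C₁ - 1) ≤ constV C₀ Cl := by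
      rw [constV, ← hC1]
      have : 0 ≤ 2 * C₀ * C₁ := by positivity
      linarith
    have h0 : 0 ≤ 2 * C₁ + (Cl + 1) * (C₁ - 1) := by
      have : 0 ≤ C₁ - 1 := by linarith
      positivity
    calc 2 * V * C₁ + (Cl + 1) * V * (C₁ - 1) = (2 * C₁ + (Cl + 1) * (C₁ - 1)) * V := by ring
      _ ≤ max (constU C₀) (constV C₀ Cl) * U := by
        have := h1.trans (le_max_right (constU C₀) (constV C₀ Cl))
        exact mul_le_mul this hVU hV0 (h0.trans this)
  have c3 := mul_le_mul_of_nonneg_right (add_le_add c1 c2) q3.le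
  rw [e1]
  linarith

end IsSlidingCurve

/-! ### Level set segments and their initial pieces. -/

lemma continuousAt_divTangent {f : Plane → ℝ} (hf : ContDiff ℝ ∞ f) {x : Plane}
    (hne : gradPerp f x ≠ 0) : ContinuousAt (divTangent f) x := by
  unfold divTangent
  refine tendsto_finsetSum _ fun i _ => ?_
  have h1 : ContinuousAt (fun y => fderiv ℝ (unitTangent f) y (EuclideanSpace.single i 1)) x :=
    (continuousAt_fderiv_unitTangent hf hne).clm_apply continuousAt_const
  exact ((EuclideanSpace.proj i : Plane →L[ℝ] ℝ).continuous.continuousAt).comp h1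

lemma timeIco_subset {a c : ℝ} {T : EReal} (h : a ≤ c) : timeIco c T ⊆ timeIco a T :=
  fun _ ht => ⟨h.trans ht.1, ht.2⟩

namespace IsLevelSetSegmentFamily

variable {T : EReal} {θ : ℝ → Plane → ℝ} {T₀ : ℝ} {X : ℝ → ℝ → Plane} {L : ℝ → ℝ} {t : ℝ}

lemma contDiffOn_slice (h : IsLevelSetSegmentFamily θ T₀ T X L) (ht : t ∈ timeIco T₀ T) :
    ContDiffOn ℝ 1 (X t) (Icc 0 (L t)) :=
  h.contDiffOn_curve.comp (f := fun s : ℝ => (t, s)) (by fun_prop) fun _ hs => ⟨ht, hs⟩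

lemma hasDerivWithinAt_slice (h : IsLevelSetSegmentFamily θ T₀ T X L) (ht : t ∈ timeIco T₀ T)
    {s : ℝ} (hs : s ∈ Icc 0 (L t)) :
    HasDerivWithinAt (X t) (derivWithin (X t) (Icc 0 (L t)) s) (Icc 0 (L t)) s :=
  ((h.contDiffOn_slice ht).differentiableOn one_ne_zero s hs).hasDerivWithinAt

lemma continuousOn_slice (h : IsLevelSetSegmentFamily θ T₀ T X L) (ht : t ∈ timeIco T₀ T) :
    ContinuousOn (X t) (Icc 0 (L t)) := (h.contDiffOn_slice ht).continuousOn

lemma exists_derivWithin_eq (h : IsLevelSetSegmentFamily θ T₀ T X L) (hs : IsSolution T θ)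
    (hT₀ : 0 ≤ T₀) (ht : t ∈ timeIco T₀ T) {s : ℝ} (hs' : s ∈ Icc 0 (L t)) :
    ∃ c : ℝ, |c| = 1 ∧
      derivWithin (X t) (Icc 0 (L t)) s = c • unitTangent (θ t) (X t s) := by
  have hne := h.gradPerp_ne_zero t ht s hs'
  have h1 := h.hasDerivWithinAt_slice ht hs'
  have hf := hs.contDiff_space (timeIco_subset hT₀ ht)
  obtain ⟨c, hc⟩ := h.same_level
  have h2 := ((hf.differentiable (by simp) (X t s)).hasFDerivAt).comp_hasDerivWithinAt s h1
  have h3 := (hasDerivWithinAt_const s (Icc 0 (L t)) c).congr (fun r hr => hc t ht r hr)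
    (hc t ht s hs')
  have h4 := eq_inner_smul_unitTangent hne
    ((uniqueDiffOn_Icc (h.length_pos t ht) s hs').eq_deriv _ h2 h3)
  refine ⟨_, ?_, h4⟩
  have h5 := h.arclength t ht s hs'
  rw [h4, norm_smul, norm_unitTangent hne, mul_one] at h5
  exact h5

lemma continuousOn_norm_gradPerp (h : IsLevelSetSegmentFamily θ T₀ T X L) (hs : IsSolution T θ)
    (hT₀ : 0 ≤ T₀) (ht : t ∈ timeIco T₀ T) :
    ContinuousOn (fun s => ‖gradPerp (θ t) (X t s)‖) (Icc 0 (L t)) :=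
  ((contDiff_gradPerp (hs.contDiff_space (timeIco_subset hT₀ ht))).continuous.comp_continuousOn
    (h.continuousOn_slice ht)).norm

lemma norm_gradPerp_pos (h : IsLevelSetSegmentFamily θ T₀ T X L) (ht : t ∈ timeIco T₀ T) {s : ℝ}
    (hs' : s ∈ Icc 0 (L t)) : 0 < ‖gradPerp (θ t) (X t s)‖ :=
  norm_pos_iff.2 (h.gradPerp_ne_zero t ht s hs')

/-- The arclength derivative of log|∇^⊥θ| is τ up to sign, so its oscillation is at most the
integral of |τ|. -/
lemma abs_log_sub_log_le (h : IsLevelSetSegmentFamily θ T₀ T X L) (hs : IsSolution T θ)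
    (hT₀ : 0 ≤ T₀) (ht : t ∈ timeIco T₀ T) {C₀ : ℝ}
    (hτ : ∫ s in (0 : ℝ)..(L t), |divTangent (θ t) (X t s)| ≤ C₀) {s₁ s₂ : ℝ} (h12 : s₁ ≤ s₂)
    (hs₁ : s₁ ∈ Icc 0 (L t)) (hs₂ : s₂ ∈ Icc 0 (L t)) :
    |Real.log ‖gradPerp (θ t) (X t s₂)‖ - Real.log ‖gradPerp (θ t) (X t s₁)‖| ≤ C₀ := by
  have hf := hs.contDiff_space (timeIco_subset hT₀ ht)
  have hsub : Icc s₁ s₂ ⊆ Icc 0 (L t) := Icc_subset_Icc hs₁.1 hs₂.2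
  have hne := h.gradPerp_ne_zero t ht
  have hτc : ContinuousOn (fun s => |divTangent (θ t) (X t s)|) (Icc 0 (L t)) := fun s hs' =>
    (ContinuousAt.comp_continuousWithinAt (f := X t) (continuousAt_divTangent hf (hne s hs'))
      (h.continuousOn_slice ht s hs')).abs
  have hlog : ContinuousOn (fun s => Real.log ‖gradPerp (θ t) (X t s)‖) (Icc s₁ s₂) :=
    ((h.continuousOn_norm_gradPerp hs hT₀ ht).log
      fun s hs' => (h.norm_gradPerp_pos ht hs').ne').mono hsub
  have hder : ∀ s ∈ Ioo s₁ s₂, ∃ d, |d| ≤ |divTangent (θ t) (X t s)| ∧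
      HasDerivAt (fun s => Real.log ‖gradPerp (θ t) (X t s)‖) d s := fun s hs' => by
    have hm := hsub (Ioo_subset_Icc_self hs')
    obtain ⟨c, hc1, hc2⟩ := h.exists_derivWithin_eq hs hT₀ ht hm
    have h1 := h.hasDerivWithinAt_slice ht hm
    rw [hc2] at h1
    have h2 := h1.hasDerivAt (Icc_mem_nhds (hs₁.1.trans_lt hs'.1) (hs'.2.trans_le hs₂.2))
    have hN : DifferentiableAt ℝ (fun y => ‖gradPerp (θ t) y‖) (X t s) :=
      ((contDiff_gradPerp hf).differentiable (by simp) _).norm ℝ (hne s hm)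
    have h3 := (hN.hasFDerivAt.comp_hasDerivAt s h2).log (h.norm_gradPerp_pos ht hm).ne'
    refine ⟨_, ?_, h3⟩
    rw [map_smul, fderiv_norm_gradPerp_unitTangent hf (hne s hm), smul_eq_mul, abs_div, abs_mul,
      hc1, one_mul, abs_neg, abs_mul, Function.comp_apply, abs_norm,
      mul_div_cancel_left₀ _ (h.norm_gradPerp_pos ht hm).ne']
  choose! d hd1 hd2 using hder
  have hint : IntervalIntegrable (fun s => |divTangent (θ t) (X t s)|) volume s₁ s₂ :=
    (hτc.mono (by rwa [uIcc_of_le h12])).intervalIntegrable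
  have hint' : IntervalIntegrable (fun s => |divTangent (θ t) (X t s)|) volume 0 (L t) :=
    (hτc.mono (by rw [uIcc_of_le (h.length_pos t ht).le])).intervalIntegrable
  have key : ∫ s in s₁..s₂, |divTangent (θ t) (X t s)| ≤ C₀ :=
    (intervalIntegral.integral_mono_interval hs₁.1 h12 hs₂.2
      (Filter.Eventually.of_forall fun s => abs_nonneg _) hint').trans hτ
  refine le_trans ?_ key
  -- The sign in the derivative was obtained point by point, without continuity; integrability
  -- follows from measurability of `deriv` and the bound by |τ|.
  have hup : ∀ s ∈ Ioo s₁ s₂, deriv (fun s => Real.log ‖gradPerp (θ t) (X t s)‖) s = d s :=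
    fun s hs' => (hd2 s hs').deriv
  have hii : IntervalIntegrable (deriv fun s => Real.log ‖gradPerp (θ t) (X t s)‖) volume s₁ s₂ := by
    refine hint.mono_fun (measurable_deriv _).aestronglyMeasurable ?_
    rw [uIoc_of_le h12, ← restrict_Ioo_eq_restrict_Ioc]
    refine (ae_restrict_iff' measurableSet_Ioo).2 (Filter.Eventually.of_forall fun s hs' => ?_)
    simp only
    rw [hup s hs', Real.norm_eq_abs, Real.norm_eq_abs, abs_abs]
    exact hd1 s hs'
  rw [← intervalIntegral.integral_eq_sub_of_hasDerivAt_of_le h12 hlog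
    (fun s hs' => (hup s hs').symm ▸ hd2 s hs') hii, ← Real.norm_eq_abs]
  refine (intervalIntegral.norm_integral_le_integral_norm h12).trans ?_
  rw [intervalIntegral.integral_of_le h12, intervalIntegral.integral_of_le h12,
    ← restrict_Ioo_eq_restrict_Ioc]
  refine setIntegral_mono_on ?_ ?_ measurableSet_Ioo fun s hs' => ?_
  · exact (((intervalIntegrable_iff_integrableOn_Ioo_of_le h12).1 hii)).norm
  · exact (intervalIntegrable_iff_integrableOn_Ioo_of_le h12).1 hint
  · rw [hup s hs', Real.norm_eq_abs]
    exact hd1 s hs'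

/-- Along the segment `|∇^⊥ θ|` varies at most by the factor `C₁`. -/
lemma norm_gradPerp_le_mul (h : IsLevelSetSegmentFamily θ T₀ T X L) (hs : IsSolution T θ)
    (hT₀ : 0 ≤ T₀) (ht : t ∈ timeIco T₀ T) {C₀ : ℝ}
    (hτ : ∫ s in (0 : ℝ)..(L t), |divTangent (θ t) (X t s)| ≤ C₀) {s₁ s₂ : ℝ}
    (hs₁ : s₁ ∈ Icc 0 (L t)) (hs₂ : s₂ ∈ Icc 0 (L t)) :
    ‖gradPerp (θ t) (X t s₁)‖ ≤ constOne C₀ * ‖gradPerp (θ t) (X t s₂)‖ := by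
  have key : Real.log ‖gradPerp (θ t) (X t s₁)‖ ≤ C₀ + Real.log ‖gradPerp (θ t) (X t s₂)‖ := by
    rcases le_total s₁ s₂ with h12 | h12
    · have := (abs_le.1 (h.abs_log_sub_log_le hs hT₀ ht hτ h12 hs₁ hs₂)).1
      linarith
    · have := (abs_le.1 (h.abs_log_sub_log_le hs hT₀ ht hτ h12 hs₂ hs₁)).2
      linarith
  have p1 := h.norm_gradPerp_pos ht hs₁
  have p2 := h.norm_gradPerp_pos ht hs₂
  have := Real.exp_le_exp.2 key
  rwa [Real.exp_add, Real.exp_log p1, Real.exp_log p2] at this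

/-- Segments of length `ℓ t ≤ L t`, parametrised by the unit interval. -/
def rescale (X : ℝ → ℝ → Plane) (ℓ : ℝ → ℝ) (p : ℝ × ℝ) : Plane := X p.1 (ℓ p.1 * p.2)

lemma isSlidingCurve (h : IsLevelSetSegmentFamily θ T₀ T X L)
    (hT₀ : 0 ≤ T₀) {a b : ℝ} (hab : a < b) (hsub : Icc a b ⊆ timeIco T₀ T) {ℓ : ℝ → ℝ}
    (hℓ : ContDiffOn ℝ 1 ℓ (Icc a b)) (hpos : ∀ t ∈ Icc a b, 0 < ℓ t)
    (hle : ∀ t ∈ Icc a b, ℓ t ≤ L t) : IsSlidingCurve T θ a b ℓ (rescale X ℓ) := by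
  have hmem : ∀ p ∈ strip a b, ℓ p.1 * p.2 ∈ Icc 0 (L p.1) := fun p hp =>
    ⟨mul_nonneg (hpos p.1 hp.1).le hp.2.1,
      (mul_le_of_le_one_right (hpos p.1 hp.1).le hp.2.2).trans (hle p.1 hp.1)⟩
  have hY : ContDiffOn ℝ 1 (rescale X ℓ) (strip a b) :=
    h.contDiffOn_curve.comp (f := fun p : ℝ × ℝ => (p.1, ℓ p.1 * p.2))
      (contDiffOn_fst.prodMk ((hℓ.comp contDiffOn_fst fun p hp => hp.1).mul contDiffOn_snd))
      fun p hp => ⟨hsub hp.1, hmem p hp⟩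
  obtain ⟨c, hc⟩ := h.same_level
  refine ⟨hab, hsub.trans (timeIco_subset hT₀), hpos, hℓ, hY, ?_, ⟨c, fun p hp => hc _ (hsub hp.1) _ (hmem p hp)⟩,
    fun p hp => h.gradPerp_ne_zero _ (hsub hp.1) _ (hmem p hp)⟩
  rintro ⟨t, r⟩ ⟨ht, hr⟩
  simp only at ht hr
  have h1 := hasDerivWithinAt_paramDeriv hY ht hr
  have hm := hmem (t, r) ⟨ht, hr⟩
  have h2 := h.hasDerivWithinAt_slice (hsub ht) hm
  have h3 : HasDerivWithinAt (fun r => ℓ t * r) (ℓ t * 1) (Icc 0 1) r :=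
    ((hasDerivAt_id r).const_mul (ℓ t)).hasDerivWithinAt
  have h4 := h2.scomp r h3 fun r' hr' => hmem (t, r') ⟨ht, hr'⟩
  rw [(uniqueDiffOn_Icc one_pos r hr).eq_deriv _ h1 h4, norm_smul,
    h.arclength t (hsub ht) _ hm, mul_one, mul_one, Real.norm_of_nonneg (hpos t ht).le]

lemma integral_curvature_le (h : IsLevelSetSegmentFamily θ T₀ T X L) (hs : IsSolution T θ)
    (hT₀ : 0 ≤ T₀) (ht : t ∈ timeIco T₀ T) {C₀ : ℝ}
    (hκ : ∫ s in (0 : ℝ)..(L t), |curvature (θ t) (X t s)| ≤ C₀) {ℓ : ℝ → ℝ}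
    (hpos : 0 < ℓ t) (hle : ℓ t ≤ L t) :
    ∫ r in (0 : ℝ)..1, ℓ t * curvature (θ t) (rescale X ℓ (t, r)) ≤ C₀ := by
  have hf := hs.contDiff_space (timeIco_subset hT₀ ht)
  have hc : ContinuousOn (fun s => |curvature (θ t) (X t s)|) (Icc 0 (L t)) := fun s hs' =>
    (ContinuousAt.comp_continuousWithinAt (f := X t) (continuousAt_curvatureVector hf
      (h.gradPerp_ne_zero t ht s hs')).norm (h.continuousOn_slice ht s hs')).abs
  have hint : IntervalIntegrable (fun s => |curvature (θ t) (X t s)|) volume 0 (L t) :=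
    (hc.mono (by rw [uIcc_of_le (h.length_pos t ht).le])).intervalIntegrable
  refine le_trans ?_ hκ
  refine le_trans (le_of_eq ?_) (intervalIntegral.integral_mono_interval le_rfl hpos.le hle
    (Filter.Eventually.of_forall fun s => abs_nonneg _) hint)
  have := intervalIntegral.integral_comp_mul_left (fun s => |curvature (θ t) (X t s)|) (a := 0)
    (b := 1) hpos.ne'
  rw [mul_zero, mul_one, smul_eq_mul] at this
  rw [intervalIntegral.integral_const_mul, ← mul_inv_cancel_left₀ hpos.ne'
    (∫ s in (0 : ℝ)..ℓ t, |curvature (θ t) (X t s)|), ← this]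
  simp only [rescale, abs_of_nonneg (curvature_nonneg _ _)]

/-- The parameter r = 0 is the endpoint s = 0 whatever the length ℓ, so the hypothesis on that
endpoint applies to every initial piece. -/
lemma timeDeriv_rescale_zero {a b : ℝ} (hsub : Icc a b ⊆ timeIco T₀ T) {ℓ : ℝ → ℝ}
    (hY : ContDiffOn ℝ 1 (rescale X ℓ) (strip a b)) (ht : t ∈ Ioo a b) :
    timeDeriv a b (rescale X ℓ) (t, 0) = derivWithin (fun r => X r 0) (timeIco T₀ T) t := by
  have h1 := hasDerivAt_timeDeriv hY ht (left_mem_Icc.2 zero_le_one)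
  simp only [rescale, mul_zero] at h1
  have hn : timeIco T₀ T ∈ nhds t := Filter.mem_of_superset (Icc_mem_nhds ht.1 ht.2) hsub
  rw [derivWithin_of_mem_nhds hn]
  exact h1.deriv.symm

lemma norm_gradPerp_le_segmentMax (h : IsLevelSetSegmentFamily θ T₀ T X L) (hs : IsSolution T θ)
    (hT₀ : 0 ≤ T₀) (ht : t ∈ timeIco T₀ T) {s : ℝ} (hs' : s ∈ Icc 0 (L t)) :
    ‖gradPerp (θ t) (X t s)‖ ≤ segmentMax θ X L t :=
  le_csSup (isCompact_Icc.bddAbove_image (h.continuousOn_norm_gradPerp hs hT₀ ht))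
    (mem_image_of_mem _ hs')

lemma abs_inner_velocity_le (h : IsLevelSetSegmentFamily θ T₀ T X L) (ht : t ∈ timeIco T₀ T)
    {U : ℝ} (hU : ∀ x, ‖velocity (θ t) x‖ ≤ U) :
    (∀ s ∈ Icc 0 (L t), |inner ℝ (velocity (θ t) (X t s)) (unitTangent (θ t) (X t s))| ≤
      maxTangentialSpeed θ X L t) ∧ maxTangentialSpeed θ X L t ≤ U := by
  have hb : ∀ s ∈ Icc 0 (L t),
      |inner ℝ (velocity (θ t) (X t s)) (unitTangent (θ t) (X t s))| ≤ U := fun s hs' => by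
    refine (abs_real_inner_le_norm _ _).trans ?_
    rw [norm_unitTangent (h.gradPerp_ne_zero t ht s hs'), mul_one]
    exact hU _
  constructor
  · intro s hs'
    refine le_csSup ⟨U, ?_⟩ (mem_image_of_mem _ hs')
    rintro _ ⟨s, hs', rfl⟩
    exact hb s hs'
  · refine csSup_le ((nonempty_Icc.2 (h.length_pos t ht).le).image _) ?_
    rintro _ ⟨s, hs', rfl⟩
    exact hb s hs'

end IsLevelSetSegmentFamily

/-! ### Continuity of means and a comparison lemma. -/

lemma continuousOn_integral_unit {A : Type*} [TopologicalSpace A] [FirstCountableTopology A]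
    {s : Set A} (hs : IsCompact s) {g : A × ℝ → ℝ} (hg : ContinuousOn g (s ×ˢ Icc 0 1)) :
    ContinuousOn (fun a => ∫ r in (0 : ℝ)..1, g (a, r)) s := by
  obtain ⟨C, hC⟩ := (hs.prod isCompact_Icc).exists_bound_of_continuousOn hg
  have hsub : uIoc (0 : ℝ) 1 ⊆ Icc 0 1 := by
    rw [uIoc_of_le zero_le_one]; exact Ioc_subset_Icc_self
  intro a ha
  refine intervalIntegral.continuousWithinAt_of_dominated_interval (bound := fun _ => C) ?_ ?_
    (by simp) ?_
  · filter_upwards [self_mem_nhdsWithin] with a' ha'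
    have : ContinuousOn (fun r => g (a', r)) (uIoc 0 1) :=
      hg.comp (f := fun r : ℝ => (a', r)) (by fun_prop) fun r hr => ⟨ha', hsub hr⟩
    exact this.aestronglyMeasurable measurableSet_uIoc
  · filter_upwards [self_mem_nhdsWithin] with a' ha'
    exact Filter.Eventually.of_forall fun r hr => hC (a', r) ⟨ha', hsub hr⟩
  · refine Filter.Eventually.of_forall fun r hr => ?_
    exact (hg.comp (f := fun a : A => (a, r)) (by fun_prop) fun a' ha' => ⟨ha', hsub hr⟩) a ha

/-- A function that starts below a solution of `E' = k E`, and whose derivative is below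
`K φ + e` with `K < k` and `e a ≤ 0`, stays below `E` for a short time. -/
lemma exists_le_of_deriv_le {φ e E : ℝ → ℝ} {a b K k : ℝ} (hab : a < b)
    (hφ : ContinuousOn φ (Icc a b)) (he : ContinuousOn e (Icc a b)) (hea : e a ≤ 0)
    (hK : 0 ≤ K) (hk : K < k) (hEa : 0 < E a) (hE : ∀ t, HasDerivAt E (k * E t) t)
    (hφ' : ∀ t ∈ Ioo a b, ∃ d, HasDerivAt φ d t ∧ d ≤ K * φ t + e t) (h0 : φ a ≤ E a) :
    ∃ c ∈ Ioc a b, ∀ t ∈ Icc a c, φ t ≤ E t := by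
  have hEc : Continuous E := continuous_iff_continuousAt.2 fun t => (hE t).continuousAt
  have hc : ContinuousOn (fun t => K * φ t + e t - k * E t) (Icc a b) :=
    ((hφ.const_smul K).add he).sub (continuous_const.mul hEc).continuousOn
  -- The gap between K and k makes the inequality strict at a. It persists on a short interval by
  -- continuity, even if e becomes positive there, and on it φ − E is nonincreasing.
  have hneg : K * φ a + e a - k * E a < 0 := by nlinarith
  have hev := (hc a (left_mem_Icc.2 hab.le)).eventually_lt continuousWithinAt_const hneg
  rw [nhdsWithin_Icc_eq_nhdsGE hab] at hev
  obtain ⟨c, hac, hcs⟩ := mem_nhdsGE_iff_exists_Icc_subset.1 hev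
  set d := min c b
  have hd : a < d := lt_min hac hab
  have hdb : d ≤ b := min_le_right _ _
  refine ⟨d, ⟨hd, hdb⟩, fun t ht => ?_⟩
  have hanti : AntitoneOn (fun t => φ t - E t) (Icc a d) := by
    have hder : ∀ t ∈ Ioo a d, ∃ y, HasDerivAt (fun t => φ t - E t) y t ∧ y ≤ 0 := fun t ht => by
      obtain ⟨y, hy1, hy2⟩ := hφ' t ⟨ht.1, ht.2.trans_le hdb⟩
      have h1 : K * φ t + e t - k * E t < 0 := hcs ⟨ht.1.le, ht.2.le.trans (min_le_left _ _)⟩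
      exact ⟨_, hy1.sub (hE t), by linarith⟩
    refine antitoneOn_of_deriv_nonpos (convex_Icc _ _)
      ((hφ.mono (Icc_subset_Icc_right hdb)).sub hEc.continuousOn) ?_ ?_
    · rw [interior_Icc]
      intro t ht
      obtain ⟨y, hy1, -⟩ := hder t ht
      exact hy1.differentiableAt.differentiableWithinAt
    · rw [interior_Icc]
      intro t ht
      obtain ⟨y, hy1, hy2⟩ := hder t ht
      rwa [hy1.deriv]
  have := hanti (left_mem_Icc.2 hd.le) ht ht.1
  simp only at this
  linarith

/-! ### The differential inequality for initial pieces of the segment. -/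

/-- The mean of `1 / |∇^⊥ θ|` over the first `ℓ` units of arclength of the segment at time `t`. -/
noncomputable def segmentInvMean (θ : ℝ → Plane → ℝ) (X : ℝ → ℝ → Plane) (t ℓ : ℝ) : ℝ :=
  ∫ r in (0 : ℝ)..1, ‖gradPerp (θ t) (X t (ℓ * r))‖⁻¹

/-- The standing assumptions on a family of level set segments, together with the logarithmic
velocity bound. -/
structure IsControlledFamily (T : EReal) (θ : ℝ → Plane → ℝ) (T₀ : ℝ) (X : ℝ → ℝ → Plane)
    (L : ℝ → ℝ) (c₀ C₀ Cl L₀ Cv : ℝ) : Prop where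
  solution : IsSolution T θ
  T₀_nonneg : 0 ≤ T₀
  c₀_pos : 0 < c₀
  C₀_pos : 0 < C₀
  Cl_pos : 0 < Cl
  L₀_pos : 0 < L₀
  Cv_pos : 0 < Cv
  family : IsLevelSetSegmentFamily θ T₀ T X L
  one_lt : ∀ t ∈ timeIco T₀ T, 1 < maxGradPerp (θ t)
  velocity_le : ∀ t ∈ timeIco T₀ T, ∀ x, ‖velocity (θ t) x‖ ≤ Cv * Real.log (maxGradPerp (θ t))
  max_le : ∀ t ∈ timeIco T₀ T, c₀ * maxGradPerp (θ t) ≤ segmentMax θ X L t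
  eq_max : ∀ t ∈ timeIco T₀ T, ‖gradPerp (θ t) (X t (L t))‖ = segmentMax θ X L t
  curvature_le : ∀ t ∈ timeIco T₀ T, ∫ s in (0 : ℝ)..(L t), |curvature (θ t) (X t s)| ≤ C₀
  divTangent_le : ∀ t ∈ timeIco T₀ T, ∫ s in (0 : ℝ)..(L t), |divTangent (θ t) (X t s)| ≤ C₀
  endpoint_le : ∀ t ∈ timeIco T₀ T,
    |inner ℝ (derivWithin (fun r => X r 0) (timeIco T₀ T) t) (unitTangent (θ t) (X t 0))| ≤
      Cl * maxTangentialSpeed θ X L t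
  length_le : ∀ t ∈ timeIco T₀ T, L₀ ≤ L t

namespace IsControlledFamily

variable {T : EReal} {θ : ℝ → Plane → ℝ} {T₀ : ℝ} {X : ℝ → ℝ → Plane} {L : ℝ → ℝ}
  {c₀ C₀ Cl L₀ Cv : ℝ}

lemma mul_mem (h : IsControlledFamily T θ T₀ X L c₀ C₀ Cl L₀ Cv) {t ℓ r : ℝ} (h0 : L₀ ≤ ℓ)
    (hle : ℓ ≤ L t) (hr : r ∈ Icc (0 : ℝ) 1) : ℓ * r ∈ Icc 0 (L t) :=
  have hℓ : 0 ≤ ℓ := h.L₀_pos.le.trans h0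
  ⟨mul_nonneg hℓ hr.1, (mul_le_of_le_one_right hℓ hr.2).trans hle⟩

lemma continuousOn_inv (h : IsControlledFamily T θ T₀ X L c₀ C₀ Cl L₀ Cv) :
    ContinuousOn (fun p : ℝ × ℝ => ‖gradPerp (θ p.1) (X p.1 p.2)‖⁻¹)
      {p : ℝ × ℝ | p.1 ∈ timeIco T₀ T ∧ p.2 ∈ Icc 0 (L p.1)} := by
  have h1 := h.solution.contDiffOn_gradPerp.continuousOn.comp
    (f := fun p : ℝ × ℝ => (p.1, X p.1 p.2))
    (continuousOn_fst.prodMk h.family.contDiffOn_curve.continuousOn)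
    fun p hp => ⟨timeIco_subset h.T₀_nonneg hp.1, mem_univ _⟩
  exact h1.norm.inv₀ fun p hp => norm_ne_zero_iff.2 (h.family.gradPerp_ne_zero _ hp.1 _ hp.2)

lemma continuousOn_inv_slice (h : IsControlledFamily T θ T₀ X L c₀ C₀ Cl L₀ Cv) {t ℓ : ℝ}
    (ht : t ∈ timeIco T₀ T) (h0 : L₀ ≤ ℓ) (hle : ℓ ≤ L t) :
    ContinuousOn (fun r => ‖gradPerp (θ t) (X t (ℓ * r))‖⁻¹) (Icc 0 1) :=
  h.continuousOn_inv.comp (f := fun r : ℝ => (t, ℓ * r)) (by fun_prop)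
    fun _ hr => ⟨ht, h.mul_mem h0 hle hr⟩

lemma comparable (h : IsControlledFamily T θ T₀ X L c₀ C₀ Cl L₀ Cv) {t s₁ s₂ : ℝ}
    (ht : t ∈ timeIco T₀ T) (h1 : s₁ ∈ Icc 0 (L t)) (h2 : s₂ ∈ Icc 0 (L t)) :
    ‖gradPerp (θ t) (X t s₁)‖⁻¹ ≤ constOne C₀ * ‖gradPerp (θ t) (X t s₂)‖⁻¹ := by
  have p1 := h.family.norm_gradPerp_pos ht h1
  have p2 := h.family.norm_gradPerp_pos ht h2
  have := h.family.norm_gradPerp_le_mul h.solution h.T₀_nonneg ht (h.divTangent_le t ht) h2 h1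
  rw [inv_le_iff_one_le_mul₀ p1, mul_assoc, mul_comm, mul_assoc,
    ← div_eq_inv_mul, one_le_div p2]
  rwa [mul_comm]

lemma segmentInvMean_pos (h : IsControlledFamily T θ T₀ X L c₀ C₀ Cl L₀ Cv) {t ℓ : ℝ}
    (ht : t ∈ timeIco T₀ T) (h0 : L₀ ≤ ℓ) (hle : ℓ ≤ L t) : 0 < segmentInvMean θ X t ℓ :=
  (sub_le_of_comparable (h.continuousOn_inv_slice ht h0 hle) (Real.one_le_exp h.C₀_pos.le)
    (fun _ hr => inv_pos.2 (h.family.norm_gradPerp_pos ht (h.mul_mem h0 hle hr)))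
    fun _ hr _ hr' => h.comparable ht (h.mul_mem h0 hle hr) (h.mul_mem h0 hle hr')).2.2

lemma segmentMax_inv_le (h : IsControlledFamily T θ T₀ X L c₀ C₀ Cl L₀ Cv) {t ℓ : ℝ}
    (ht : t ∈ timeIco T₀ T) (h0 : L₀ ≤ ℓ) (hle : ℓ ≤ L t) :
    (segmentMax θ X L t)⁻¹ ≤ segmentInvMean θ X t ℓ := by
  have hint : IntervalIntegrable (fun r => ‖gradPerp (θ t) (X t (ℓ * r))‖⁻¹) volume 0 1 :=
    ((h.continuousOn_inv_slice ht h0 hle).mono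
      (by rw [uIcc_of_le zero_le_one])).intervalIntegrable
  have := intervalIntegral.integral_mono_on zero_le_one
    (intervalIntegrable_const (c := (segmentMax θ X L t)⁻¹) (μ := volume)) hint fun r hr =>
      inv_anti₀ (h.family.norm_gradPerp_pos ht (h.mul_mem h0 hle hr))
        (h.family.norm_gradPerp_le_segmentMax h.solution h.T₀_nonneg ht (h.mul_mem h0 hle hr))
  simpa [segmentInvMean] using this

/-- The maximal gradient is controlled by the harmonic mean over any initial piece. -/
lemma maxGradPerp_le (h : IsControlledFamily T θ T₀ X L c₀ C₀ Cl L₀ Cv) {t ℓ : ℝ}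
    (ht : t ∈ timeIco T₀ T) (h0 : L₀ ≤ ℓ) (hle : ℓ ≤ L t) :
    maxGradPerp (θ t) ≤ constOne C₀ / c₀ / segmentInvMean θ X t ℓ := by
  have hL := h.family.length_pos t ht
  have mL : L t ∈ Icc 0 (L t) := right_mem_Icc.2 hL.le
  have hw := h.family.norm_gradPerp_pos ht mL
  have hint : IntervalIntegrable (fun r => ‖gradPerp (θ t) (X t (ℓ * r))‖⁻¹) volume 0 1 :=
    ((h.continuousOn_inv_slice ht h0 hle).mono
      (by rw [uIcc_of_le zero_le_one])).intervalIntegrable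
  have h1 := intervalIntegral.integral_mono_on zero_le_one hint
    -- The comparison point is the far end of the whole segment, where the gradient is maximal, even
    -- if the piece of length ℓ does not reach it.
    (intervalIntegrable_const (c := constOne C₀ * ‖gradPerp (θ t) (X t (L t))‖⁻¹) (μ := volume))
    fun r hr => h.comparable ht (h.mul_mem h0 hle hr) mL
  have h2 : segmentInvMean θ X t ℓ ≤ constOne C₀ * ‖gradPerp (θ t) (X t (L t))‖⁻¹ := by
    simpa [segmentInvMean] using h1
  have h3 := h.segmentInvMean_pos ht h0 hle
  have h4 := h.max_le t ht
  rw [← h.eq_max t ht] at h4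
  rw [← div_eq_mul_inv, le_div_iff₀ hw] at h2
  rw [le_div_iff₀ h3, le_div_iff₀ h.c₀_pos]
  nlinarith [mul_le_mul_of_nonneg_left h4 h3.le]

/-- The growth rate. -/
noncomputable def rate (C₀ Cl L₀ Cv : ℝ) : ℝ := 2 * Cv * max (constU C₀) (constV C₀ Cl) / L₀

lemma max_const_pos (h : IsControlledFamily T θ T₀ X L c₀ C₀ Cl L₀ Cv) :
    0 < max (constU C₀) (constV C₀ Cl) := by
  have hC₁ : 1 ≤ constOne C₀ := Real.one_le_exp h.C₀_pos.le
  have h0 := h.C₀_pos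
  refine lt_max_of_lt_left ?_
  unfold constU
  have : 0 < 2 * constOne C₀ - 1 := by linarith
  positivity

lemma rate_pos (h : IsControlledFamily T θ T₀ X L c₀ C₀ Cl L₀ Cv) : 0 < rate C₀ Cl L₀ Cv := by
  have := h.max_const_pos
  have := h.L₀_pos
  have := h.Cv_pos
  unfold rate
  positivity

/-- The logarithm of the bound for the maximal gradient which comes from the first `ℓ` units of
the segment. -/
noncomputable def logBound (θ : ℝ → Plane → ℝ) (X : ℝ → ℝ → Plane) (c₀ C₀ : ℝ) (t ℓ : ℝ) : ℝ :=
  Real.log (constOne C₀ / c₀ / segmentInvMean θ X t ℓ)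

lemma log_maxGradPerp_le (h : IsControlledFamily T θ T₀ X L c₀ C₀ Cl L₀ Cv) {t ℓ : ℝ}
    (ht : t ∈ timeIco T₀ T) (h0 : L₀ ≤ ℓ) (hle : ℓ ≤ L t) :
    Real.log (maxGradPerp (θ t)) ≤ logBound θ X c₀ C₀ t ℓ :=
  Real.log_le_log (zero_lt_one.trans (h.one_lt t ht)) (h.maxGradPerp_le ht h0 hle)

section Evolution

variable {a b : ℝ} {ℓ : ℝ → ℝ}

lemma isSlidingCurve (h : IsControlledFamily T θ T₀ X L c₀ C₀ Cl L₀ Cv) (hab : a < b)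
    (hsub : Icc a b ⊆ timeIco T₀ T) (hℓ : ContDiffOn ℝ 1 ℓ (Icc a b))
    (h0 : ∀ t ∈ Icc a b, L₀ ≤ ℓ t) (hle : ∀ t ∈ Icc a b, ℓ t ≤ L t) :
    IsSlidingCurve T θ a b ℓ (IsLevelSetSegmentFamily.rescale X ℓ) :=
  h.family.isSlidingCurve h.T₀_nonneg hab hsub hℓ (fun t ht => h.L₀_pos.trans_le (h0 t ht)) hle

lemma continuousOn_logBound (h : IsControlledFamily T θ T₀ X L c₀ C₀ Cl L₀ Cv) (hab : a < b)
    (hsub : Icc a b ⊆ timeIco T₀ T) (hℓ : ContDiffOn ℝ 1 ℓ (Icc a b))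
    (h0 : ∀ t ∈ Icc a b, L₀ ≤ ℓ t) (hle : ∀ t ∈ Icc a b, ℓ t ≤ L t) :
    ContinuousOn (fun t => logBound θ X c₀ C₀ t (ℓ t)) (Icc a b) := by
  have hc := h.isSlidingCurve hab hsub hℓ h0 hle
  have hF : ContinuousOn (fun t => segmentInvMean θ X t (ℓ t)) (Icc a b) :=
    continuousOn_integral_unit isCompact_Icc (hc.contDiffOn_weight h.solution).continuousOn
  have hpos : ∀ t ∈ Icc a b, segmentInvMean θ X t (ℓ t) ≠ 0 := fun t ht =>
    (h.segmentInvMean_pos (hsub ht) (h0 t ht) (hle t ht)).ne'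
  have hc₁ : constOne C₀ / c₀ ≠ 0 := (div_pos (Real.exp_pos _) h.c₀_pos).ne'
  exact (continuousOn_const.div hF hpos).log fun t ht => div_ne_zero hc₁ (hpos t ht)

/-- The differential inequality for the logarithmic bound. -/
lemma exists_hasDerivAt_logBound (h : IsControlledFamily T θ T₀ X L c₀ C₀ Cl L₀ Cv) (hab : a < b)
    (hsub : Icc a b ⊆ timeIco T₀ T) (hℓ : ContDiffOn ℝ 1 ℓ (Icc a b))
    (h0 : ∀ t ∈ Icc a b, L₀ ≤ ℓ t) (hle : ∀ t ∈ Icc a b, ℓ t ≤ L t)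
    (hor : ∀ t ∈ Ioo a b, ℓ t = L t ∨ deriv ℓ t = 0) {t : ℝ} (ht : t ∈ Ioo a b) :
    ∃ d, HasDerivAt (fun t => logBound θ X c₀ C₀ t (ℓ t)) d t ∧
      d ≤ rate C₀ Cl L₀ Cv * logBound θ X c₀ C₀ t (ℓ t) +
        max (derivWithin ℓ (Icc a b) t) 0 / L₀ := by
  have hc := h.isSlidingCurve hab hsub hℓ h0 hle
  have ht' := Ioo_subset_Icc_self ht
  have htT := hsub ht'
  have hℓL₀ := h0 t ht'
  have hℓL := hle t ht'
  have hℓpos : 0 < ℓ t := h.L₀_pos.trans_le hℓL₀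
  have hFpos := h.segmentInvMean_pos htT hℓL₀ hℓL
  have hc₁ : 0 < constOne C₀ / c₀ := div_pos (Real.exp_pos _) h.c₀_pos
  set Y := IsLevelSetSegmentFamily.rescale X ℓ with hYdef
  set U := Cv * Real.log (maxGradPerp (θ t))
  have hU := h.velocity_le t htT
  obtain ⟨hV, hVU⟩ := h.family.abs_inner_velocity_le htT hU
  have hmain := hc.neg_length_mul_deriv_le h.solution ht h.C₀_pos.le h.Cl_pos.le hVU hU
    (h.family.integral_curvature_le h.solution h.T₀_nonneg htT (h.curvature_le t htT) hℓpos hℓL)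
    (fun r hr => hV _ (h.mul_mem hℓL₀ hℓL hr))
    (by
      rw [IsLevelSetSegmentFamily.timeDeriv_rescale_zero hsub hc.contDiffOn_curve ht]
      simpa [hYdef, IsLevelSetSegmentFamily.rescale] using h.endpoint_le t htT)
    (fun r hr r' hr' => h.comparable htT (h.mul_mem hℓL₀ hℓL hr) (h.mul_mem hℓL₀ hℓL hr'))
  set J := ∫ r in (0 : ℝ)..1, timeDeriv a b (weightAlong θ Y) (t, r)
  have hder : HasDerivAt (fun t => segmentInvMean θ X t (ℓ t)) J t :=
    hc.hasDerivAt_meanWeight h.solution ht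
  have hlog : HasDerivAt (fun t => logBound θ X c₀ C₀ t (ℓ t))
      (-(J / segmentInvMean θ X t (ℓ t))) t := by
    have h1 := (hder.log hFpos.ne').const_sub (Real.log (constOne C₀ / c₀))
    refine h1.congr_of_eventuallyEq ?_
    filter_upwards [Icc_mem_nhds ht.1 ht.2] with s hs
    exact Real.log_div hc₁.ne' (h.segmentInvMean_pos (hsub hs) (h0 s hs) (hle s hs)).ne'
  refine ⟨_, hlog, ?_⟩
  rw [derivWithin_of_mem_nhds (Icc_mem_nhds ht.1 ht.2)]
  change -(ℓ t * J) ≤ deriv ℓ t * (segmentInvMean θ X t (ℓ t) - weightAlong θ Y (t, 1)) +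
    2 * max (constU C₀) (constV C₀ Cl) * U * segmentInvMean θ X t (ℓ t) at hmain
  have hw1 : 0 < weightAlong θ Y (t, 1) :=
    inv_pos.2 (h.family.norm_gradPerp_pos htT
      (h.mul_mem hℓL₀ hℓL (right_mem_Icc.2 zero_le_one)))
  set F := segmentInvMean θ X t (ℓ t)
  set w := weightAlong θ Y (t, 1)
  -- If the piece is the whole segment, w is the smallest weight, so F − w lies between 0 and F and
  -- a negative ℓ' only helps. Otherwise the length is stationary.
  have hend : deriv ℓ t * (F - w) ≤ max (deriv ℓ t) 0 * F := by
    rcases hor t ht with hL | hz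
    · have hwF : w ≤ F := by
        have h1 := h.segmentMax_inv_le htT hℓL₀ hℓL
        rw [← h.eq_max t htT] at h1
        simpa [F, w, hYdef, weightAlong, IsLevelSetSegmentFamily.rescale, hL] using h1
      exact (mul_le_mul_of_nonneg_right (le_max_left _ 0) (by linarith)).trans
        (mul_le_mul_of_nonneg_left (by linarith) (le_max_right _ _))
    · simp [hz]
  have hlogb := h.log_maxGradPerp_le htT hℓL₀ hℓL
  set φ := logBound θ X c₀ C₀ t (ℓ t)
  set m := max (constU C₀) (constV C₀ Cl)
  have hm : 0 < m := h.max_const_pos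
  have hCv := h.Cv_pos
  have hφ : 0 < φ := (Real.log_pos (h.one_lt t htT)).trans_le hlogb
  -- The inequality closes here: log Ω, which bounds the velocity, is itself bounded by φ.
  have hU' : U ≤ Cv * φ := by simp only [U]; gcongr
  have hM : 0 ≤ max (deriv ℓ t) 0 := le_max_right _ _
  have h5 : -(J / F) * ℓ t ≤ max (deriv ℓ t) 0 + 2 * m * (Cv * φ) := by
    have h6 : -(J / F) * ℓ t = -(ℓ t * J) / F := by field_simp
    rw [h6, div_le_iff₀ hFpos]
    calc -(ℓ t * J) ≤ max (deriv ℓ t) 0 * F + 2 * m * (Cv * φ) * F :=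
          hmain.trans (add_le_add hend (by gcongr))
      _ = _ := by ring
  have h7 : -(J / F) ≤ (max (deriv ℓ t) 0 + 2 * m * (Cv * φ)) / ℓ t := by
    rwa [le_div_iff₀ hℓpos]
  have hL₀ := h.L₀_pos
  calc -(J / F) ≤ (max (deriv ℓ t) 0 + 2 * m * (Cv * φ)) / ℓ t := h7
    _ ≤ (max (deriv ℓ t) 0 + 2 * m * (Cv * φ)) / L₀ := by gcongr
    _ = _ := by rw [rate]; ring

/-- Forward continuation of the bound for a short time. -/
lemma exists_forward (h : IsControlledFamily T θ T₀ X L c₀ C₀ Cl L₀ Cv) {E : ℝ → ℝ} {k : ℝ}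
    (hk : rate C₀ Cl L₀ Cv < k) (hE : ∀ t, HasDerivAt E (k * E t) t) (hab : a < b)
    (hsub : Icc a b ⊆ timeIco T₀ T) (hEa : 0 < E a) {l : ℝ} (h0 : L₀ ≤ l) (hle : l ≤ L a)
    (hφ : logBound θ X c₀ C₀ a l ≤ E a) :
    ∃ c ∈ Ioc a b, ∀ t ∈ Icc a c, ∃ l, L₀ ≤ l ∧ l ≤ L t ∧ logBound θ X c₀ C₀ t l ≤ E t := by
  have ma : a ∈ Icc a b := left_mem_Icc.2 hab.le
  have hLc : ContDiffOn ℝ 1 L (Icc a b) := h.family.contDiffOn_length.mono hsub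
  -- Only if the piece is the whole segment and L does not increase to first order must the length
  -- follow L. Then the error max(L', 0)/L₀ vanishes at a, and the margin between k and the rate
  -- absorbs it for a short time.
  by_cases hcase : l = L a ∧ derivWithin L (Icc a b) a ≤ 0
  · obtain ⟨rfl, hd⟩ := hcase
    have hL0 : ∀ t ∈ Icc a b, L₀ ≤ L t := fun t ht => h.length_le t (hsub ht)
    have hLL : ∀ t ∈ Icc a b, L t ≤ L t := fun t _ => le_rfl
    have he : ContinuousOn (fun t => max (derivWithin L (Icc a b) t) 0 / L₀) (Icc a b) :=
      ((hLc.continuousOn_derivWithin (uniqueDiffOn_Icc hab) le_rfl).sup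
        continuousOn_const).div_const _
    obtain ⟨c, hc, hc2⟩ := exists_le_of_deriv_le hab
      (h.continuousOn_logBound hab hsub hLc hL0 hLL) he (by simp [max_eq_right hd]) h.rate_pos.le
      hk hEa hE (fun t ht => h.exists_hasDerivAt_logBound hab hsub hLc hL0 hLL
        (fun t _ => Or.inl rfl) ht) hφ
    exact ⟨c, hc, fun t ht => ⟨L t, hL0 t ⟨ht.1, ht.2.trans hc.2⟩, le_rfl, hc2 t ht⟩⟩
  · -- the length `l` stays admissible for a short time
    obtain ⟨b', hb', hlb⟩ : ∃ b' ∈ Ioc a b, ∀ t ∈ Icc a b', l ≤ L t := by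
      have hev : ∀ᶠ t in nhdsWithin a (Ici a), l ≤ L t := by
        rcases hle.lt_or_eq with hlt | heq
        · have := (hLc.continuousOn a ma).eventually_const_lt hlt
          rw [nhdsWithin_Icc_eq_nhdsGE hab] at this
          exact this.mono fun t ht => ht.le
        · have hpos : 0 < derivWithin L (Icc a b) a := by
            by_contra hn
            exact hcase ⟨heq, not_lt.1 hn⟩
          have h1 : HasDerivWithinAt L (derivWithin L (Icc a b) a) (Ici a) a := by
            rw [← hasDerivWithinAt_congr_set' a
              (show Icc a b =ᶠ[nhdsWithin a {a}ᶜ] Ici a from ?_)]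
            · exact (hLc.differentiableOn one_ne_zero a ma).hasDerivWithinAt
            · filter_upwards [mem_nhdsWithin_of_mem_nhds (Iic_mem_nhds hab)] with t ht
              exact propext ⟨fun h => h.1, fun h => ⟨h, ht⟩⟩
          have h2 := ((hasDerivWithinAt_iff_tendsto_slope' (notMem_Ioi.2 le_rfl)).1
            (h1.mono Ioi_subset_Ici_self)).eventually_const_lt hpos
          have h3 : ∀ᶠ t in nhdsWithin a (Ioi a), l ≤ L t := by
            filter_upwards [h2, self_mem_nhdsWithin] with t ht1 ht2
            rw [slope_def_field, div_pos_iff_of_pos_right (sub_pos.2 ht2)] at ht1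
            linarith
          rw [← Ioi_insert, nhdsWithin_insert, Filter.eventually_sup]
          exact ⟨by simpa using hle, h3⟩
      obtain ⟨c, hac, hcs⟩ := mem_nhdsGE_iff_exists_Icc_subset.1 hev
      exact ⟨min c b, ⟨lt_min hac hab, min_le_right _ _⟩, fun t ht =>
        hcs ⟨ht.1, ht.2.trans (min_le_left _ _)⟩⟩
    have hsub' : Icc a b' ⊆ timeIco T₀ T := (Icc_subset_Icc_right hb'.2).trans hsub
    have hdz : ∀ t, derivWithin (fun _ : ℝ => l) (Icc a b') t = 0 := fun t => by simp
    obtain ⟨c, hc, hc2⟩ := exists_le_of_deriv_le (e := fun _ => 0) hb'.1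
      (h.continuousOn_logBound hb'.1 hsub' contDiffOn_const (fun _ _ => h0) hlb)
      continuousOn_const le_rfl h.rate_pos.le hk hEa hE (fun t ht => by
        have := h.exists_hasDerivAt_logBound hb'.1 hsub' (contDiffOn_const (c := l))
          (fun _ _ => h0) hlb (fun t _ => Or.inr (by simp)) ht
        simpa [hdz] using this) hφ
    exact ⟨c, ⟨hc.1, hc.2.trans hb'.2⟩, fun t ht =>
      ⟨l, h0, hlb t ⟨ht.1, ht.2.trans hc.2⟩, hc2 t ht⟩⟩

end Evolution

end IsControlledFamily

/-! ### Continuation in time and the double exponential bound. -/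

namespace IsControlledFamily

variable {T : EReal} {θ : ℝ → Plane → ℝ} {T₀ : ℝ} {X : ℝ → ℝ → Plane} {L : ℝ → ℝ}
  {c₀ C₀ Cl L₀ Cv : ℝ}

/-- Admissible pairs (t, l) form a compact set, since L is bounded on [T₀, t₁] and φ is jointly
continuous in t and l; the set in question is its projection to the time axis. -/
lemma isClosed_setOf_exists_le (h : IsControlledFamily T θ T₀ X L c₀ C₀ Cl L₀ Cv) {t₁ : ℝ}
    (ht₁ : t₁ ∈ timeIco T₀ T) {E : ℝ → ℝ} (hE : Continuous E) :
    IsClosed ({t | ∃ l, L₀ ≤ l ∧ l ≤ L t ∧ logBound θ X c₀ C₀ t l ≤ E t} ∩ Icc T₀ t₁) := by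
  have hsub : Icc T₀ t₁ ⊆ timeIco T₀ T := fun t ht => timeIco_of_le ht₁ ht.1 ht.2
  have hLc : ContinuousOn L (Icc T₀ t₁) := h.family.contDiffOn_length.continuousOn.mono hsub
  obtain ⟨B, hB⟩ := isCompact_Icc.exists_bound_of_continuousOn hLc
  set R := Icc T₀ t₁ ×ˢ Icc L₀ B
  have hR : IsCompact R := isCompact_Icc.prod isCompact_Icc
  set D := R ∩ (fun p : ℝ × ℝ => L p.1 - p.2) ⁻¹' Ici 0
  have hD : IsCompact D := by
    refine hR.of_isClosed_subset ?_ inter_subset_left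
    exact ((hLc.comp continuousOn_fst fun p hp => hp.1).sub
      continuousOn_snd).preimage_isClosed_of_isClosed hR.isClosed isClosed_Ici
  have hDle : ∀ p ∈ D, L₀ ≤ p.2 ∧ p.2 ≤ L p.1 := fun p hp =>
    ⟨hp.1.2.1, sub_nonneg.1 hp.2⟩
  have hF : ContinuousOn (fun p : ℝ × ℝ => segmentInvMean θ X p.1 p.2) D := by
    refine continuousOn_integral_unit
      (g := fun q : (ℝ × ℝ) × ℝ => ‖gradPerp (θ q.1.1) (X q.1.1 (q.1.2 * q.2))‖⁻¹) hD ?_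
    refine h.continuousOn_inv.comp (f := fun q : (ℝ × ℝ) × ℝ => (q.1.1, q.1.2 * q.2))
      (by fun_prop) fun q hq => ⟨hsub hq.1.1.1, ?_⟩
    exact h.mul_mem (hDle _ hq.1).1 (hDle _ hq.1).2 hq.2
  have hpos : ∀ p ∈ D, segmentInvMean θ X p.1 p.2 ≠ 0 := fun p hp =>
    (h.segmentInvMean_pos (hsub hp.1.1) (hDle p hp).1 (hDle p hp).2).ne'
  have hc₁ : constOne C₀ / c₀ ≠ 0 := (div_pos (Real.exp_pos _) h.c₀_pos).ne'
  have hφ : ContinuousOn (fun p : ℝ × ℝ => logBound θ X c₀ C₀ p.1 p.2) D :=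
    (continuousOn_const.div hF hpos).log fun p hp => div_ne_zero hc₁ (hpos p hp)
  have hG : IsCompact (D ∩ (fun p : ℝ × ℝ => E p.1 - logBound θ X c₀ C₀ p.1 p.2) ⁻¹' Ici 0) := by
    refine hD.of_isClosed_subset ?_ inter_subset_left
    exact ((hE.comp continuous_fst).continuousOn.sub hφ).preimage_isClosed_of_isClosed
      hD.isClosed isClosed_Ici
  convert (hG.image continuous_fst).isClosed using 1
  ext t
  constructor
  · rintro ⟨⟨l, h1, h2, h3⟩, ht⟩
    exact ⟨(t, l), ⟨⟨⟨ht, h1, h2.trans ((le_abs_self _).trans (hB t ht))⟩, sub_nonneg.2 h2⟩,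
      sub_nonneg.2 h3⟩, rfl⟩
  · rintro ⟨⟨t', l⟩, ⟨hp, h3⟩, rfl⟩
    exact ⟨⟨l, (hDle _ hp).1, (hDle _ hp).2, sub_nonneg.1 h3⟩, hp.1.1⟩

/-- Real induction on [T₀, t₁]. The length l may jump from one time to another; only the existence
of a good l is propagated. -/
lemma exists_logBound_le (h : IsControlledFamily T θ T₀ X L c₀ C₀ Cl L₀ Cv) {t₁ : ℝ}
    (ht₁ : t₁ ∈ timeIco T₀ T) {E : ℝ → ℝ} {k : ℝ} (hk : rate C₀ Cl L₀ Cv < k)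
    (hE : ∀ t, HasDerivAt E (k * E t) t) (hEpos : ∀ t, 0 < E t)
    (hinit : logBound θ X c₀ C₀ T₀ (L T₀) ≤ E T₀) :
    ∃ l, L₀ ≤ l ∧ l ≤ L t₁ ∧ logBound θ X c₀ C₀ t₁ l ≤ E t₁ := by
  have hsub : Icc T₀ t₁ ⊆ timeIco T₀ T := fun t ht => timeIco_of_le ht₁ ht.1 ht.2
  have hT₀ : T₀ ∈ timeIco T₀ T := hsub (left_mem_Icc.2 ht₁.1)
  have hEc : Continuous E := continuous_iff_continuousAt.2 fun t => (hE t).continuousAt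
  refine (h.isClosed_setOf_exists_le ht₁ hEc).Icc_subset_of_forall_mem_nhdsWithin
    ⟨L T₀, h.length_le _ hT₀, le_rfl, hinit⟩ ?_ (right_mem_Icc.2 ht₁.1)
  rintro a ⟨⟨l, h1, h2, h3⟩, ha⟩
  obtain ⟨c, hc, hc2⟩ := h.exists_forward hk hE ha.2
    ((Icc_subset_Icc_left ha.1).trans hsub) (hEpos a) h1 h2 h3
  filter_upwards [Ioc_mem_nhdsGT hc.1] with t ht
  exact hc2 t ⟨ht.1.le, ht.2⟩

/-- The harmonic mean is at most the arithmetic mean. -/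
lemma one_le_segmentInvMean_mul (h : IsControlledFamily T θ T₀ X L c₀ C₀ Cl L₀ Cv) {t : ℝ}
    (ht : t ∈ timeIco T₀ T) :
    0 < segmentMean θ X L t ∧ 1 ≤ segmentInvMean θ X t (L t) * segmentMean θ X L t := by
  have hL := h.family.length_pos t ht
  have hL₀ := h.length_le t ht
  have hinv := h.continuousOn_inv_slice ht hL₀ le_rfl
  have hpos : ∀ r ∈ Icc (0 : ℝ) 1, 0 < ‖gradPerp (θ t) (X t (L t * r))‖ := fun r hr =>
    h.family.norm_gradPerp_pos ht (h.mul_mem hL₀ le_rfl hr)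
  have hcont : ContinuousOn (fun r => ‖gradPerp (θ t) (X t (L t * r))‖) (Icc 0 1) :=
    (h.family.continuousOn_norm_gradPerp h.solution h.T₀_nonneg ht).comp
      (f := fun r : ℝ => L t * r) (by fun_prop) fun r hr => h.mul_mem hL₀ le_rfl hr
  have hQ : segmentMean θ X L t = ∫ r in (0 : ℝ)..1, ‖gradPerp (θ t) (X t (L t * r))‖ := by
    have := intervalIntegral.integral_comp_mul_left (fun s => ‖gradPerp (θ t) (X t s)‖) (a := 0)
      (b := 1) hL.ne'
    rw [mul_zero, mul_one, smul_eq_mul] at this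
    rw [this, segmentMean]
  have i1 : IntervalIntegrable (fun r => ‖gradPerp (θ t) (X t (L t * r))‖) volume 0 1 :=
    (hcont.mono (by rw [uIcc_of_le zero_le_one])).intervalIntegrable
  have i2 : IntervalIntegrable (fun r => ‖gradPerp (θ t) (X t (L t * r))‖⁻¹) volume 0 1 :=
    (hinv.mono (by rw [uIcc_of_le zero_le_one])).intervalIntegrable
  have hQpos : 0 < segmentMean θ X L t := by
    rw [hQ]
    exact intervalIntegral.intervalIntegral_pos_of_pos_on i1
      (fun r hr => hpos r (Ioo_subset_Icc_self hr)) one_pos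
  refine ⟨hQpos, ?_⟩
  set Q := segmentMean θ X L t
  -- The convex function 1/w lies above its tangent at Q, that is 2/Q − w/Q²; the mean of this
  -- tangent is 1/Q because Q is the mean of w.
  have key := intervalIntegral.integral_mono_on zero_le_one
    ((intervalIntegrable_const (c := 2 * Q⁻¹) (μ := volume)).sub (i1.const_mul (Q⁻¹ ^ 2))) i2
    fun r hr => by
      have hw := hpos r hr
      set w := ‖gradPerp (θ t) (X t (L t * r))‖
      have : w⁻¹ - (2 * Q⁻¹ - Q⁻¹ ^ 2 * w) = (w - Q) ^ 2 / (w * Q ^ 2) := by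
        field_simp; ring
      have h0 : 0 ≤ (w - Q) ^ 2 / (w * Q ^ 2) := by positivity
      linarith
  rw [intervalIntegral.integral_sub intervalIntegrable_const (i1.const_mul _),
    intervalIntegral.integral_const_mul (Q⁻¹ ^ 2), ← hQ] at key
  have e : (∫ _ in (0 : ℝ)..1, 2 * Q⁻¹) - Q⁻¹ ^ 2 * Q = Q⁻¹ := by
    rw [intervalIntegral.integral_const]
    simp only [sub_zero, one_smul]
    field_simp
    norm_num
  rw [e] at key
  rw [← inv_le_iff_one_le_mul₀ hQpos]
  exact key

/-- The double exponential growth estimate. -/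
theorem maxGradPerp_le_exp_exp (h : IsControlledFamily T θ T₀ X L c₀ C₀ Cl L₀ Cv) {t : ℝ}
    (ht : t ∈ timeIco T₀ T) :
    maxGradPerp (θ t) ≤ Real.exp (Real.log (constOne C₀ / c₀ * segmentMean θ X L T₀) *
      Real.exp (rate C₀ Cl L₀ Cv * (t - T₀))) := by
  have hT₀ : T₀ ∈ timeIco T₀ T := timeIco_of_le ht le_rfl ht.1
  have hL₀ := h.length_le T₀ hT₀
  have hc₁ : 0 < constOne C₀ / c₀ := div_pos (Real.exp_pos _) h.c₀_pos
  have hF := h.segmentInvMean_pos hT₀ hL₀ le_rfl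
  obtain ⟨hQ, hFQ⟩ := h.one_le_segmentInvMean_mul hT₀
  set δ := Real.log (constOne C₀ / c₀ * segmentMean θ X L T₀)
  set K := rate C₀ Cl L₀ Cv
  have hinit : logBound θ X c₀ C₀ T₀ (L T₀) ≤ δ := by
    refine Real.log_le_log (div_pos hc₁ hF) ?_
    rw [div_le_iff₀ hF, mul_assoc]
    exact le_mul_of_one_le_right hc₁.le (by rwa [mul_comm])
  have hδ : 0 < δ := (Real.log_pos (h.one_lt T₀ hT₀)).trans_le
    ((h.log_maxGradPerp_le hT₀ hL₀ le_rfl).trans hinit)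
  have hΩ : 0 < maxGradPerp (θ t) := zero_lt_one.trans (h.one_lt t ht)
  rw [← Real.log_le_iff_le_exp hΩ]
  -- The comparison needs a rate strictly above K; the bound for K is recovered in the limit.
  have hlim : Filter.Tendsto (fun k => δ * Real.exp (k * (t - T₀))) (nhdsWithin K (Ioi K))
      (nhds (δ * Real.exp (K * (t - T₀)))) :=
    (Continuous.tendsto (by fun_prop) K).mono_left nhdsWithin_le_nhds
  refine ge_of_tendsto hlim ?_
  filter_upwards [self_mem_nhdsWithin] with k hk
  obtain ⟨l, h1, h2, h3⟩ := h.exists_logBound_le ht (E := fun s => δ * Real.exp (k * (s - T₀)))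
    (mem_Ioi.1 hk) (fun s => by
      have := ((((hasDerivAt_id s).sub_const T₀).const_mul k).exp).const_mul δ
      refine this.congr_deriv ?_
      simp only [id]
      ring) (fun s => by positivity) (by simpa using hinit)
  exact (h.log_maxGradPerp_le ht h1 h2).trans h3

end IsControlledFamily

end SQG

/-! ### Assembly of the two estimates. -/

theorem mainTheorem6 (M b : ℝ) (hb : 1 < b) :
    ∃ Cu : ℝ, 0 < Cu ∧
      ∀ (T : EReal) (θ : ℝ → SQG.Plane → ℝ), SQG.IsSolution T θ →
        (∀ x, |θ 0 x| ≤ M) → eLpNorm (θ 0) 2 volume ≤ ENNReal.ofReal M →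
        -- the velocity bound that defines `Cu`
        (∀ t ∈ SQG.timeIco 0 T, b ≤ SQG.maxGradPerp (θ t) →
          ∀ x, ‖SQG.velocity (θ t) x‖ ≤ Cu * Real.log (SQG.maxGradPerp (θ t))) ∧
        -- the growth estimate
        (∀ (T₀ c₀ C₀ Cl L₀ : ℝ) (X : ℝ → ℝ → SQG.Plane) (L : ℝ → ℝ),
          0 ≤ T₀ → 0 < c₀ → c₀ ≤ 1 → 0 < C₀ → 0 < Cl → 0 < L₀ →
          (∀ t ∈ SQG.timeIco T₀ T, b ≤ SQG.maxGradPerp (θ t)) →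
          SQG.IsLevelSetSegmentFamily θ T₀ T X L →
          (∀ t ∈ SQG.timeIco T₀ T,
            c₀ * SQG.maxGradPerp (θ t) ≤ SQG.segmentMax θ X L t) →
          (∀ t ∈ SQG.timeIco T₀ T,
            ‖SQG.gradPerp (θ t) (X t (L t))‖ = SQG.segmentMax θ X L t) →
          (∀ t ∈ SQG.timeIco T₀ T,
            ∫ s in (0 : ℝ)..(L t), |SQG.curvature (θ t) (X t s)| ≤ C₀) →
          (∀ t ∈ SQG.timeIco T₀ T,
            ∫ s in (0 : ℝ)..(L t), |SQG.divTangent (θ t) (X t s)| ≤ C₀) →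
          (∀ t ∈ SQG.timeIco T₀ T,
            |inner ℝ (derivWithin (fun r => X r 0) (SQG.timeIco T₀ T) t)
                (SQG.unitTangent (θ t) (X t 0))| ≤ Cl * SQG.maxTangentialSpeed θ X L t) →
          (∀ t ∈ SQG.timeIco T₀ T, L₀ ≤ L t) →
          ∀ t ∈ SQG.timeIco T₀ T,
            SQG.maxGradPerp (θ t) ≤
              Real.exp (Real.log (SQG.constOne C₀ / c₀ * SQG.segmentMean θ X L T₀) *
                Real.exp (Cu * max (SQG.constU C₀) (SQG.constV C₀ Cl) / L₀ * (t - T₀)))) := by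
  obtain ⟨C, hC, hvel⟩ := SQG.exists_velocity_le_log_maxGradPerp M b hb
  -- Doubling the velocity constant absorbs the factor 2 in `rate`; the velocity bound survives
  -- since log Ω ≥ 0.
  refine ⟨2 * C, by positivity, fun T θ hs hM hL => ⟨fun t ht hbt x => ?_, ?_⟩⟩
  · have h1 := hvel T θ hs hM hL t ht hbt x
    have : 0 ≤ Real.log (SQG.maxGradPerp (θ t)) := Real.log_nonneg (by linarith)
    nlinarith
  · intro T₀ c₀ C₀ Cl L₀ X L hT₀ hc₀ _ hC₀ hCl hL₀ hΩ hfam hmax heq hκ hτ hend hlen t ht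
    have h : SQG.IsControlledFamily T θ T₀ X L c₀ C₀ Cl L₀ C := ⟨hs, hT₀, hc₀, hC₀, hCl, hL₀, hC, hfam,
      fun t ht => hb.trans_le (hΩ t ht),
      fun t ht => hvel T θ hs hM hL t (SQG.timeIco_subset hT₀ ht) (hΩ t ht),
      hmax, heq, hκ, hτ, hend, hlen⟩
    exact h.maxGradPerp_le_exp_exp ht
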